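/- For an integer $n$ let $BS(1,n)=\langle a,b \mid bab^{-1}=a^{n}\rangle$, regarded as a structure in the signature $\{\cdot,{}^{-1},1\}$ of groups. A formula of $\mathcal{L}_{\omega_1,\omega}$ is $\Sigma_0$ and $\Pi_0$ if it is finitary and quantifier-free; for $\alpha>0$ a $\Sigma_\alpha$ formula is a countable disjunction of formulas $\exists\bar x\,\psi$ with $\psi$ in $\Pi_\beta$ for some $\beta<\alpha$, a $\Pi_\alpha$ formula is a countable conjunction of formulas $\forall\bar x\,\psi$ with $\psi$ in $\Sigma_\beta$ for some $\beta<\alpha$, and a d-$\Sigma_\alpha$ formula is the conjunction of a $\Sigma_\alpha$ formula and a $\Pi_\alpha$ formula. A formula is computable if all infinite disjunctions and conjunctions in it are over c.e. sets (of indices of the disjuncts or conjuncts). A Scott sentence of a countable structure $\mathcal{A}$ is a sentence whose countable models are exactly the isomorphic copies of $\mathcal{A}$. The index set $I(\mathcal{A})$ is the set of all $e\in\mathbb{N}$ such that the $e$-th partial computable function $\varphi_e$ is the characteristic function of the atomic diagram (the set of Gödel numbers of the true atomic and negated atomic sentences, with elements as constants) of a structure $\mathcal{B}\cong\mathcal{A}$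 with universe a subset of $\mathbb{N}$. A set of natural numbers is d-$\Sigma_2$ if it is the difference of two $\Sigma_2$ sets of the arithmetical hierarchy, and it is $m$-complete d-$\Sigma_2$ if it is d-$\Sigma_2$ and every d-$\Sigma_2$ set is many-one reducible to it. **Theorem.** For every integer $n$, the group $BS(1,n)$ has a computable d-$\Sigma_2$ Scott sentence, and its index set $I(BS(1,n))$ is $m$-complete d-$\Sigma_2$. -/

import Mathlib

open scoped FirstOrder

namespace ScottBS

/-! ### The groups -/

/-- The Baumslag–Solitar group `BS(m, n) = ⟨a, b ∣ b a^m b⁻¹ = a^n⟩`; the generator `a` is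
`0 : Fin 2` and the generator `b` is `1 : Fin 2`. -/
abbrev BaumslagSolitar (m n : ℤ) : Type :=
  PresentedGroup
    ({FreeGroup.of 1 * FreeGroup.of 0 ^ m * (FreeGroup.of 1)⁻¹ * (FreeGroup.of 0 ^ n)⁻¹} :
      Set (FreeGroup (Fin 2)))

/-! ### The signature of groups -/

/-- The function symbols `1`, `⁻¹`, `·`, by arity. -/
inductive GroupFunc : ℕ → Type
  | one : GroupFunc 0
  | inv : GroupFunc 1
  | mul : GroupFunc 2

/-- The signature `{·, ⁻¹, 1}` of groups. -/
abbrev groupLang : FirstOrder.Language.{0, 0} := ⟨GroupFunc, fun _ => Empty⟩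

/-- A group as a structure for the signature of groups. -/
instance groupStructure (G : Type) [Group G] : groupLang.Structure G where
  funMap := fun f x =>
    match f with
    | .one => 1
    | .inv => (x 0)⁻¹
    | .mul => x 0 * x 1
  RelMap := fun r _ => nomatch r

/-! ### Gödel numbers of finitary formulas -/

/-- The Gödel number of a term whose free variables (or names of elements) `a : α` are numbered
by `ν` and whose bound variables are numbered by `Fin n`. -/
def termCode {α : Type} {n : ℕ} (ν : α → ℕ) : groupLang.Term (α ⊕ Fin n) → ℕ
  | .var (.inl a) => Nat.pair 0 (ν a)
  | .var (.inr i) => Nat.pair 1 i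
  | .func GroupFunc.one _ => Nat.pair 2 0
  | .func GroupFunc.inv ts => Nat.pair 3 (termCode ν (ts 0))
  | .func GroupFunc.mul ts => Nat.pair 4 (Nat.pair (termCode ν (ts 0)) (termCode ν (ts 1)))

/-- The Gödel number of a finitary first-order formula. -/
def formulaCode {α : Type} (ν : α → ℕ) : {n : ℕ} → groupLang.BoundedFormula α n → ℕ
  | _, .falsum => Nat.pair 0 0
  | _, .equal s t => Nat.pair 1 (Nat.pair (termCode ν s) (termCode ν t))
  | _, .rel R _ => nomatch R
  | _, .imp φ ψ => Nat.pair 2 (Nat.pair (formulaCode ν φ) (formulaCode ν ψ))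
  | _, .all φ => Nat.pair 3 (formulaCode ν φ)

/-! ### Infinitary formulas -/

/-- Formulas of `L_{ω₁,ω}` in the signature of groups, with free variables among `Fin n`:
finitary first-order formulas, closed under negation, binary conjunction, quantification over
finite blocks of variables, and countable disjunctions and conjunctions.
(Countable families are indexed by `ℕ`, possibly with repetitions; the empty disjunction and
the empty conjunction are available as the finitary formulas `⊥` and `¬ ⊥`.) -/
inductive InfFormula : ℕ → Type
  | fin {n : ℕ} (φ : groupLang.BoundedFormula Empty n) : InfFormula n
  | neg {n : ℕ} (φ : InfFormula n) : InfFormula n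
  | and {n : ℕ} (φ ψ : InfFormula n) : InfFormula n
  | exs {n : ℕ} (k : ℕ) (φ : InfFormula (n + k)) : InfFormula n
  | alls {n : ℕ} (k : ℕ) (φ : InfFormula (n + k)) : InfFormula n
  | disj {n : ℕ} (f : ℕ → InfFormula n) : InfFormula n
  | conj {n : ℕ} (f : ℕ → InfFormula n) : InfFormula n

/-- Satisfaction of an infinitary formula in a structure under an assignment. -/
def InfFormula.Realize (M : Type) [groupLang.Structure M] :
    {n : ℕ} → InfFormula n → (Fin n → M) → Prop
  | _, .fin φ, v => φ.Realize (fun x : Empty => x.elim) v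
  | _, .neg φ, v => ¬ φ.Realize M v
  | _, .and φ ψ, v => φ.Realize M v ∧ ψ.Realize M v
  | _, .exs k φ, v => ∃ y : Fin k → M, φ.Realize M (Fin.append v y)
  | _, .alls k φ, v => ∀ y : Fin k → M, φ.Realize M (Fin.append v y)
  | _, .disj f, v => ∃ i, (f i).Realize M v
  | _, .conj f, v => ∀ i, (f i).Realize M v

/-- The `e`-th partial computable function of one argument. -/
def phi (e : ℕ) : ℕ →. ℕ := (Denumerable.ofNat Nat.Partrec.Code e).eval

/-- The `e`-th computably enumerable set, the domain of the `e`-th partial computable function. -/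
def ceSet (e : ℕ) : Set ℕ := {x | (phi e x).Dom}

/-- `φ.HasIndex e`: the number `e` is an index of the infinitary formula `φ`. An index of an
infinite disjunction or conjunction contains an index of a c.e. set which consists of indices
of the disjuncts (conjuncts) and contains at least one index of each of them. -/
def InfFormula.HasIndex : {n : ℕ} → InfFormula n → ℕ → Prop
  | _, .fin φ, e => e = Nat.pair 0 (formulaCode (fun x : Empty => x.elim) φ)
  | _, .neg φ, e => ∃ c, e = Nat.pair 1 c ∧ φ.HasIndex c
  | _, .and φ ψ, e =>
      ∃ c d, e = Nat.pair 2 (Nat.pair c d) ∧ φ.HasIndex c ∧ ψ.HasIndex d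
  | _, .exs k φ, e => ∃ c, e = Nat.pair 3 (Nat.pair k c) ∧ φ.HasIndex c
  | _, .alls k φ, e => ∃ c, e = Nat.pair 4 (Nat.pair k c) ∧ φ.HasIndex c
  | _, .disj f, e => ∃ c, e = Nat.pair 5 c ∧
      (∀ x ∈ ceSet c, ∃ i, (f i).HasIndex x) ∧ ∀ i, ∃ x ∈ ceSet c, (f i).HasIndex x
  | _, .conj f, e => ∃ c, e = Nat.pair 6 c ∧
      (∀ x ∈ ceSet c, ∃ i, (f i).HasIndex x) ∧ ∀ i, ∃ x ∈ ceSet c, (f i).HasIndex x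

/-- A computable infinitary formula: all infinite disjunctions and conjunctions in it are over
c.e. sets. -/
def InfFormula.IsComputable {n : ℕ} (φ : InfFormula n) : Prop := ∃ e, φ.HasIndex e

mutual

/-- `Σ_α` formulas: the `Σ_0` formulas are the finitary quantifier-free ones, and for `α > 0` a
`Σ_α` formula is a countable disjunction of formulas `∃ x̄ ψ` with `ψ` in `Π_β`, `β < α`. -/
inductive InfFormula.IsSigma : ℕ → {n : ℕ} → InfFormula n → Prop
  | zero {n : ℕ} (φ : groupLang.BoundedFormula Empty n) (h : φ.IsQF) :
      InfFormula.IsSigma 0 (.fin φ)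
  | disj {n : ℕ} (α : ℕ) (k β : ℕ → ℕ) (f : ∀ i : ℕ, InfFormula (n + k i))
      (hβ : ∀ i, β i < α) (h : ∀ i, InfFormula.IsPi (β i) (f i)) :
      InfFormula.IsSigma α (.disj fun i => .exs (k i) (f i))

/-- `Π_α` formulas: the `Π_0` formulas are the finitary quantifier-free ones, and for `α > 0` a
`Π_α` formula is a countable conjunction of formulas `∀ x̄ ψ` with `ψ` in `Σ_β`, `β < α`. -/
inductive InfFormula.IsPi : ℕ → {n : ℕ} → InfFormula n → Prop
  | zero {n : ℕ} (φ : groupLang.BoundedFormula Empty n) (h : φ.IsQF) :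
      InfFormula.IsPi 0 (.fin φ)
  | conj {n : ℕ} (α : ℕ) (k β : ℕ → ℕ) (f : ∀ i : ℕ, InfFormula (n + k i))
      (hβ : ∀ i, β i < α) (h : ∀ i, InfFormula.IsSigma (β i) (f i)) :
      InfFormula.IsPi α (.conj fun i => .alls (k i) (f i))

end

/-- d-`Σ_α` formulas: conjunctions of a `Σ_α` formula and a `Π_α` formula. -/
def InfFormula.IsDSigma (α : ℕ) {n : ℕ} (φ : InfFormula n) : Prop :=
  ∃ σ π : InfFormula n, σ.IsSigma α ∧ π.IsPi α ∧ φ = σ.and π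

/-- `φ` is a Scott sentence of `A`: its countable models are exactly the isomorphic copies
of `A`. -/
def IsScottSentence (φ : InfFormula 0) (A : Type) [groupLang.Structure A] : Prop :=
  ∀ (M : Type) [groupLang.Structure M] [Countable M],
    φ.Realize M Fin.elim0 ↔ Nonempty (M ≃[groupLang] A)

/-! ### Index sets -/

/-- The atomic diagram of a structure whose universe `U` is a set of natural numbers, as a set of
Gödel numbers: all atomic sentences and negated atomic sentences, with the elements of `U` as
constants, that are true in the structure. -/
def atomicDiagram (U : Set ℕ) [groupLang.Structure U] : Set ℕ :=
  {k | ∃ φ ψ : groupLang.Formula U,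
    ψ.IsAtomic ∧ (φ = ψ ∨ φ = ψ.not) ∧ φ.Realize id ∧ k = formulaCode Subtype.val φ}

/-- The index set of `A`: all `e` such that `phi e` is the characteristic function of the atomic
diagram of a structure isomorphic to `A` with universe a set of natural numbers. -/
def indexSet (A : Type) [groupLang.Structure A] : Set ℕ :=
  {e | ∃ (U : Set ℕ) (_ : groupLang.Structure U), Nonempty (U ≃[groupLang] A) ∧
    ∀ k, (k ∈ atomicDiagram U → phi e k = Part.some 1) ∧
      (k ∉ atomicDiagram U → phi e k = Part.some 0)}

/-! ### Classes of sets of natural numbers -/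

/-- The (lightface) `Σ₂` sets of the arithmetical hierarchy. -/
def IsSigma2Set (S : Set ℕ) : Prop :=
  ∃ R : ℕ × ℕ × ℕ → Prop, ComputablePred R ∧ ∀ x, x ∈ S ↔ ∃ y, ∀ z, R (x, y, z)

/-- The d-`Σ₂` sets: the differences of two `Σ₂` sets. -/
def IsDSigma2Set (S : Set ℕ) : Prop :=
  ∃ S₁ S₂ : Set ℕ, IsSigma2Set S₁ ∧ IsSigma2Set S₂ ∧ S = S₁ \ S₂

/-- `S` is m-complete d-`Σ₂`: it is d-`Σ₂`, and every d-`Σ₂` set is many-one reducible to it. -/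
def IsMCompleteDSigma2 (S : Set ℕ) : Prop :=
  IsDSigma2Set S ∧ ∀ T : Set ℕ, IsDSigma2Set T → (fun x => x ∈ T) ≤₀ (fun x => x ∈ S)

end ScottBS

namespace ScottBS

/-! ### Algebras of group type, and normal forms -/

-- For `n ≠ 0` the words `b^{-i} a^j b^k` exhaust `BS(1,n)`, and the group acts faithfully as affine
-- maps of `ℚ` with `b` multiplying by `n`, once the exponent of `b` is recorded. For `n = 0` the
-- relation kills `a`, and the group is infinite cyclic.
--
-- Scott sentence. A generating pair is described by universal axioms: the defining relation, and a
-- decidable list of forbidden equations `z^p = x^k y^l`. The forbidden equations with `p = 0`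
-- exclude every unwanted relation between `x` and `y`, so a pair that satisfies the axioms and
-- generates determines the group (`ScottPair.normalForm`). Those with `p > 0` deny roots, and this
-- makes every such pair of the given group generate it (`bs_rigid_general`, `scottPair_line`,
-- `scottPair_plane`). The group is therefore characterised by a `Σ₂` statement, some pair satisfies
-- the axioms, and a `Π₂` statement, every pair that satisfies them generates
-- (`ScottPair.exists_equiv_iff`). Reading both on the diagram computed by `phi e`, together with
-- `Π₂` conditions for being a diagram at all (`diagCond_iff`), bounds the index set.
--
-- Hardness. Let `T = S₁ \ S₂` with `Σ₂` sets `Sᵢ`. For each `x` there are computable monotone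
-- counters `hᵢ(t)`, bounded exactly when `x ∈ Sᵢ`. Put `p = |N| + 1`, which is coprime to `N`.
-- Inside the germs at infinity of sequences in the group, take the subgroup generated by the
-- constant `b`, the sequences `a^(p^(h₁ t - h₁ q))`, and the sequences `a^(p^(h₁ t) f_q(t))`, where
-- `f_q(t)` is `(t+1)!` until `h₂` exceeds `h₂ q` and is frozen from then on. If `h₁` is unbounded,
-- new `p`-power roots keep appearing, and no images of `a`, `b` under an isomorphism could
-- generate. If `h₁` is bounded, the constants `a`, `b` are present and satisfy the axioms. If `h₂`
-- is unbounded, every `f_q` freezes and the group is the original one. If `h₂` is bounded, some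
-- `f_q` grows forever and lies outside the subgroup generated by the constants, against rigidity.
-- So the group is the right one exactly when `x ∈ T`.
--
-- Its word problem is uniformly decidable. At a late stage the exponent of a name is `X + Y (t+1)!`
-- with `X` too small to cancel a nonzero multiple of the factorial, so whether the name is trivial
-- no longer changes after a computable stage (`stageDecomp`, `eq_zero_of_decomp`). The least names
-- of elements then form a structure whose diagram is decidable uniformly in `x`
-- (`exists_computable_mem_indexSet_iff`).

/-- The operations of a group, without any laws. -/
structure Ops (α : Type*) where
  one : α
  inv : α → α
  mul : α → α → α

/-- Maps that preserve the operations. -/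
structure Ops.Hom {α β : Type*} (A : Ops α) (B : Ops β) (f : α → β) : Prop where
  one : f A.one = B.one
  inv : ∀ x, f (A.inv x) = B.inv (f x)
  mul : ∀ x y, f (A.mul x y) = B.mul (f x) (f y)

def groupOps (G : Type*) [Group G] : Ops G := ⟨1, (·⁻¹), (· * ·)⟩

/-- Multiplication of the words `b^{-M} a^r b^K`, represented by `(M, r, K)`, in a group with
`b a = a ^ N b`. -/
def tripleOps (N : ℤ) : Ops (ℕ × ℤ × ℕ) where
  one := (0, 0, 0)
  inv u := (u.2.2, -u.2.1, u.1)
  mul u v := (u.1 + (v.1 - u.2.2),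
    N ^ (v.1 - u.2.2) * u.2.1 + N ^ (u.2.2 - v.1) * v.2.1, (u.2.2 - v.1) + v.2.2)

def triple {G : Type*} [Group G] (a b : G) (u : ℕ × ℤ × ℕ) : G :=
  b⁻¹ ^ u.1 * a ^ u.2.1 * b ^ u.2.2

-- Calculus of the words `b^{-M} a^r b^K`

section Triple

variable {G : Type*} [Group G] {N : ℤ} {a b : G}

theorem pow_mul_zpow_of_rel (h : b * a = a ^ N * b) (e : ℕ) (r : ℤ) :
    b ^ e * a ^ r = a ^ (N ^ e * r) * b ^ e := by
  have h1 : ∀ s : ℤ, b * a ^ s = a ^ (N * s) * b := by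
    intro s
    have : b * a * b⁻¹ = a ^ N := by rw [h]; group
    have h2 : b * a ^ s * b⁻¹ = a ^ (N * s) := by
      rw [← conj_zpow, this, ← zpow_mul]
    rw [← h2]; group
  induction e with
  | zero => simp
  | succ e ih =>
    rw [pow_succ', mul_assoc, ih, ← mul_assoc, h1, mul_assoc]
    congr 2; ring

theorem zpow_mul_inv_pow_of_rel (h : b * a = a ^ N * b) (e : ℕ) (r : ℤ) :
    a ^ r * b⁻¹ ^ e = b⁻¹ ^ e * a ^ (N ^ e * r) := by
  have := pow_mul_zpow_of_rel h e r
  rw [inv_pow, mul_inv_eq_iff_eq_mul, mul_assoc, ← this]; group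

/-- In a product, the inner `b^K b^{-M'}` cancels to a power of `b` of one sign, which is then moved
past the neighbouring power of `a`. Truncated subtraction makes one of the two exponents vanish, so
a single formula covers both cases. -/
theorem triple_hom (h : b * a = a ^ N * b) :
    (tripleOps N).Hom (groupOps G) (triple a b) where
  one := by simp [triple, tripleOps, groupOps]
  inv u := by simp [triple, tripleOps, groupOps, mul_assoc]
  mul u v := by
    obtain ⟨M, r, K⟩ := u
    obtain ⟨M', r', K'⟩ := v
    simp only [triple, tripleOps, groupOps]
    rcases le_total M' K with hk | hk
    · obtain ⟨d, rfl⟩ := Nat.exists_eq_add_of_le hk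
      have e1 : M' - (M' + d) = 0 := by omega
      have e2 : M' + d - M' = d := by omega
      rw [e1, e2, pow_zero, one_mul, add_zero, zpow_add, pow_add]
      have := pow_mul_zpow_of_rel h d r'
      calc _ = b⁻¹ ^ M * a ^ r * (a ^ (N ^ d * r') * b ^ d) * b ^ K' := by group
        _ = b⁻¹ ^ M * a ^ r * (b ^ d * a ^ r') * b ^ K' := by rw [this]
        _ = _ := by rw [add_comm, pow_add]; group
    · obtain ⟨d, rfl⟩ := Nat.exists_eq_add_of_le hk
      have e1 : K + d - K = d := by omega
      have e2 : K - (K + d) = 0 := by omega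
      rw [e1, e2, pow_zero, one_mul, zero_add, zpow_add, pow_add]
      have := zpow_mul_inv_pow_of_rel h d r
      calc _ = b⁻¹ ^ M * (b⁻¹ ^ d * a ^ (N ^ d * r)) * a ^ r' * b ^ K' := by group
        _ = b⁻¹ ^ M * (a ^ r * b⁻¹ ^ d) * a ^ r' * b ^ K' := by rw [this]
        _ = _ := by rw [pow_add]; group

theorem exists_triple_of_mem_closure (h : b * a = a ^ N * b) {g : G}
    (hg : g ∈ Subgroup.closure {a, b}) : ∃ u, g = triple a b u := by
  have H := triple_hom h
  induction hg using Subgroup.closure_induction with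
  | mem x hx =>
    rcases hx with rfl | rfl
    · exact ⟨(0, 1, 0), by simp [triple]⟩
    · exact ⟨(0, 0, 1), by simp [triple]⟩
  | one => exact ⟨_, H.one.symm⟩
  | mul x y _ _ hx hy =>
    obtain ⟨u, rfl⟩ := hx
    obtain ⟨v, rfl⟩ := hy
    exact ⟨_, (H.mul u v).symm⟩
  | inv x _ hx =>
    obtain ⟨u, rfl⟩ := hx
    exact ⟨_, (H.inv u).symm⟩

end Triple

/-- Groups given by the same operations and the same word problem on names are isomorphic. -/
theorem nonempty_mulEquiv_of_names {T G H : Type*} [Group G] [Group H] {A : Ops T}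
    {p : T → G} {q : T → H} (hp : A.Hom (groupOps G) p) (hq : A.Hom (groupOps H) q)
    (sp : p.Surjective) (sq : q.Surjective) (hpq : ∀ t, p t = 1 ↔ q t = 1) :
    Nonempty (G ≃* H) := by
  -- Equality of two values is triviality of the value of the name `s t⁻¹`.
  have key : ∀ s t, p s = p t ↔ q s = q t := by
    intro s t
    have h1 : p (A.mul s (A.inv t)) = p s * (p t)⁻¹ := by rw [hp.mul, hp.inv]; rfl
    have h2 : q (A.mul s (A.inv t)) = q s * (q t)⁻¹ := by rw [hq.mul, hq.inv]; rfl
    rw [← mul_inv_eq_one, ← mul_inv_eq_one (a := q s), ← h1, ← h2, hpq]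
  choose f hf using sp
  let F : G →* H := MonoidHom.mk' (fun g => q (f g)) (by
    intro x y
    have h2 : q (A.mul (f x) (f y)) = q (f x) * q (f y) := hq.mul _ _
    rw [← h2, ← key, hf, hp.mul, hf, hf]; rfl)
  refine ⟨MulEquiv.ofBijective F ⟨?_, ?_⟩⟩
  · intro x y hxy
    rw [← hf x, ← hf y]; exact (key _ _).2 hxy
  · intro h
    obtain ⟨t, rfl⟩ := sq h
    exact ⟨p t, (key _ _).1 (hf _)⟩

/-- Every element of the group has the form `b^{-i} a^j b^k`, where `b a = a ^ N b`, and the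
only coincidences are the obvious ones; if `P` fails, then `b` is trivial. -/
structure NormalForm {G : Type*} [Group G] (N : ℤ) (P : Prop) (a b : G) : Prop where
  rel : b * a = a ^ N * b
  triv : ¬ P → b = 1
  gen : ∀ g, ∃ u, g = triple a b u
  inj : ∀ u, triple a b u = 1 → u.2.1 = 0 ∧ (P → u.1 = u.2.2)

theorem NormalForm.triple_eq_one {G : Type*} [Group G] {N : ℤ} {P : Prop} {a b : G}
    (h : NormalForm N P a b) (u : ℕ × ℤ × ℕ) :
    triple a b u = 1 ↔ u.2.1 = 0 ∧ (P → u.1 = u.2.2) := by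
  refine ⟨h.inj u, fun ⟨h1, h2⟩ => ?_⟩
  by_cases hP : P
  · simp [triple, h1, h2 hP]
  · simp [triple, h1, h.triv hP]

theorem NormalForm.nonempty_mulEquiv {G H : Type*} [Group G] [Group H] {N : ℤ} {P : Prop}
    {a b : G} {x y : H} (h : NormalForm N P a b) (h' : NormalForm N P x y) :
    Nonempty (G ≃* H) :=
  nonempty_mulEquiv_of_names (triple_hom h.rel) (triple_hom h'.rel)
    (fun g => (h.gen g).imp fun _ => Eq.symm) (fun g => (h'.gen g).imp fun _ => Eq.symm)
    (fun u => by rw [h.triple_eq_one, h'.triple_eq_one])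

/-- `x, y` satisfy the relations of the generators, and none of the forbidden equations
`z ^ p = x ^ k y ^ l`, `(p, k, l) ∈ Q`, has a solution. -/
structure IsBasisLike {G : Type*} [Group G] (N : ℤ) (P : Prop) (Q : ℕ → ℤ → ℤ → Prop)
    (x y : G) : Prop where
  rel : y * x = x ^ N * y
  triv : ¬ P → y = 1
  noroot : ∀ p k l, Q p k l → ∀ z : G, z ^ p ≠ x ^ k * y ^ l

/-- A generating pair in normal form whose images under automorphisms are singled out by
relations and forbidden equations. -/
structure ScottPair (G : Type*) [Group G] (N : ℤ) (P : Prop) (Q : ℕ → ℤ → ℤ → Prop)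
    (a b : G) : Prop where
  ne_zero : N ≠ 0
  nf : NormalForm N P a b
  basis : IsBasisLike N P Q a b
  rigid : ∀ x y : G, IsBasisLike N P Q x y → Subgroup.closure {x, y} = ⊤
  forbid₁ : ∀ k : ℤ, k ≠ 0 → Q 0 k 0
  forbid₂ : P → ∀ k l : ℤ, k ≠ 0 ∨ l ≠ 0 → Q 0 k l

/-- A trivial word `x, y` with exponents `i, j, k` says `1 = x^j y^(k-i)`. This is a forbidden
equation with `p = 0` unless the exponents vanish, or unless `y` is trivial and only `j` matters. It
is solved by any `z`, so `1` is used. -/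
theorem ScottPair.normalForm {G H : Type*} [Group G] [Group H] {N : ℤ} {P : Prop}
    {Q : ℕ → ℤ → ℤ → Prop} {a b : G} (h : ScottPair G N P Q a b) {x y : H}
    (hxy : IsBasisLike N P Q x y) (hgen : ∀ g, ∃ u, g = triple x y u) : NormalForm N P x y where
  rel := hxy.rel
  triv := hxy.triv
  gen := hgen
  inj := by
    rintro ⟨i, j, k⟩ hu
    have hu' : (1 : H) = x ^ j * y ^ ((k : ℤ) - i) := by
      simp only [triple, inv_pow] at hu
      have : x ^ j * y ^ k = y ^ i := by
        rw [mul_assoc, inv_mul_eq_one] at hu; exact hu.symm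
      rw [zpow_sub, ← mul_assoc, zpow_natCast, zpow_natCast, this, mul_inv_cancel]
    by_cases hP : P
    · by_contra hc
      refine hxy.noroot 0 j (k - i) (h.forbid₂ hP _ _ ?_) 1 (by rw [pow_zero]; exact hu')
      by_contra! hc'
      exact hc ⟨hc'.1, fun _ => show i = k by omega⟩
    · refine ⟨?_, fun h => absurd h hP⟩
      by_contra hc
      refine hxy.noroot 0 j 0 (h.forbid₁ _ hc) 1 ?_
      rw [pow_zero, zpow_zero]
      rwa [hxy.triv hP, one_zpow] at hu'

theorem ScottPair.gen {G : Type*} [Group G] {N : ℤ} {P : Prop}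
    {Q : ℕ → ℤ → ℤ → Prop} {a b : G} (h : ScottPair G N P Q a b) {x y : G}
    (hxy : IsBasisLike N P Q x y) (g : G) : ∃ u, g = triple x y u :=
  exists_triple_of_mem_closure hxy.rel (by rw [h.rigid x y hxy]; trivial)

/-! ### The groups `BS(1, n)` -/

/-- The affine maps `x ↦ ν ^ k x + r` of the rational line, with the exponent `k` recorded. -/
@[ext] structure Aff (ν : ℚˣ) where
  r : ℚ
  k : ℤ

namespace Aff

variable {ν : ℚˣ}

instance : Mul (Aff ν) := ⟨fun u v => ⟨u.r + ((ν ^ u.k : ℚˣ) : ℚ) * v.r, u.k + v.k⟩⟩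
instance : One (Aff ν) := ⟨⟨0, 0⟩⟩
instance : Inv (Aff ν) := ⟨fun u => ⟨-(((ν ^ (-u.k) : ℚˣ) : ℚ) * u.r), -u.k⟩⟩

@[simp] theorem mul_r (u v : Aff ν) : (u * v).r = u.r + ((ν ^ u.k : ℚˣ) : ℚ) * v.r := rfl
@[simp] theorem mul_k (u v : Aff ν) : (u * v).k = u.k + v.k := rfl
@[simp] theorem one_r : (1 : Aff ν).r = 0 := rfl
@[simp] theorem one_k : (1 : Aff ν).k = 0 := rfl
@[simp] theorem inv_r (u : Aff ν) : (u⁻¹).r = -(((ν ^ (-u.k) : ℚˣ) : ℚ) * u.r) := rfl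
@[simp] theorem inv_k (u : Aff ν) : (u⁻¹).k = -u.k := rfl

instance : Group (Aff ν) :=
  Group.ofLeftAxioms
    (fun u v w => by ext <;> simp [zpow_add]; ring; ring)
    (fun u => by ext <;> simp)
    (fun u => by ext <;> simp)

@[simp] theorem zpow_k (u : Aff ν) (m : ℤ) : (u ^ m).k = m * u.k := by
  let f : Aff ν →* Multiplicative ℤ := MonoidHom.mk' (fun u => .ofAdd u.k) (fun _ _ => rfl)
  have : f (u ^ m) = f u ^ m := map_zpow f u m
  simpa [f] using congrArg Multiplicative.toAdd this

@[simp] theorem pow_k (u : Aff ν) (m : ℕ) : (u ^ m).k = m * u.k := by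
  have := zpow_k u m
  rwa [zpow_natCast] at this

theorem pow_r_of_k_eq_zero (u : Aff ν) (h : ν ^ u.k = 1) (m : ℕ) : (u ^ m).r = m * u.r := by
  induction m with
  | zero => simp
  | succ m ih =>
    rw [pow_succ, mul_r, ih, pow_k, mul_comm (m : ℤ), zpow_mul, h]; push_cast; simp; ring

theorem zpow_r_of_k_eq_zero (u : Aff ν) (h : ν ^ u.k = 1) (m : ℤ) : (u ^ m).r = m * u.r := by
  obtain ⟨m, rfl | rfl⟩ := m.eq_nat_or_neg
  · simpa using pow_r_of_k_eq_zero u h m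
  · have h2 : ν ^ (-(m * u.k) : ℤ) = 1 := by rw [zpow_neg, mul_comm, zpow_mul, h]; simp
    rw [zpow_neg, inv_r, zpow_natCast, pow_r_of_k_eq_zero u h, pow_k, h2]; simp

end Aff

-- The presentation and its faithful affine representation

section BS

variable (n : ℤ)

def bsA : BaumslagSolitar 1 n := PresentedGroup.of 0
def bsB : BaumslagSolitar 1 n := PresentedGroup.of 1

theorem bs_rel : bsB n * bsA n = bsA n ^ n * bsB n := by
  have h : bsB n * bsA n ^ (1 : ℤ) * (bsB n)⁻¹ * (bsA n ^ n)⁻¹ = 1 :=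
    PresentedGroup.one_of_mem (Set.mem_singleton _)
  rw [mul_inv_eq_one, mul_inv_eq_iff_eq_mul] at h
  rwa [zpow_one (bsA n)] at h

theorem bs_closure : Subgroup.closure {bsA n, bsB n} = ⊤ := by
  rw [← PresentedGroup.closure_range_of]
  congr 1
  ext x
  simp only [Set.mem_insert_iff, Set.mem_singleton_iff, Set.mem_range, Fin.exists_fin_two, bsA, bsB,
    eq_comm]

theorem bs_gen (g : BaumslagSolitar 1 n) : ∃ u, g = triple (bsA n) (bsB n) u :=
  exists_triple_of_mem_closure (bs_rel n) (by rw [bs_closure]; trivial)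

variable {n}

def bsLift {H : Type*} [Group H] (x y : H) (h : y * x = x ^ n * y) :
    BaumslagSolitar 1 n →* H :=
  PresentedGroup.toGroup (f := ![x, y]) (by
    rintro r rfl
    simp [h])

theorem bsLift_a {H : Type*} [Group H] (x y : H) (h : y * x = x ^ n * y) :
    bsLift x y h (bsA n) = x := by
  simp [bsLift, bsA]

theorem bsLift_b {H : Type*} [Group H] (x y : H) (h : y * x = x ^ n * y) :
    bsLift x y h (bsB n) = y := by
  simp [bsLift, bsB]

variable (hn : n ≠ 0)

abbrev bsUnit : ℚˣ := Units.mk0 (n : ℚ) (Int.cast_ne_zero.2 hn)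

def bsAff : BaumslagSolitar 1 n →* Aff (bsUnit hn) :=
  bsLift ⟨1, 0⟩ ⟨0, 1⟩ (by
    ext
    · rw [Aff.mul_r, Aff.mul_r, Aff.zpow_r_of_k_eq_zero _ (by simp)]; simp
    · simp)

theorem bsAff_a : bsAff hn (bsA n) = ⟨1, 0⟩ := bsLift_a _ _ _
theorem bsAff_b : bsAff hn (bsB n) = ⟨0, 1⟩ := bsLift_b _ _ _

theorem Aff.pow_b (ν : ℚˣ) (m : ℕ) : (⟨0, 1⟩ : Aff ν) ^ m = ⟨0, m⟩ := by
  induction m with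
  | zero => rfl
  | succ m ih => rw [pow_succ, ih]; ext <;> simp

theorem Aff.zpow_a (ν : ℚˣ) (m : ℤ) : (⟨1, 0⟩ : Aff ν) ^ m = ⟨m, 0⟩ := by
  ext
  · rw [Aff.zpow_r_of_k_eq_zero _ (by simp)]; simp
  · simp

theorem bsAff_triple (u : ℕ × ℤ × ℕ) :
    bsAff hn (triple (bsA n) (bsB n) u) = ⟨u.2.1 / (n : ℚ) ^ u.1, u.2.2 - u.1⟩ := by
  rw [triple, map_mul, map_mul, map_zpow, map_pow, map_pow, map_inv, bsAff_a, bsAff_b,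
    inv_pow, Aff.pow_b, Aff.pow_b, Aff.zpow_a]
  ext
  · simp [div_eq_inv_mul]
  · simp; ring

/-- Every element is a triple, and its image has translation part `j / n^i` and exponent `k - i`. If
both vanish, so does the word. -/
theorem bsAff_injective (hn : n ≠ 0) : Function.Injective (bsAff hn) := by
  rw [injective_iff_map_eq_one]
  intro g hg
  obtain ⟨⟨i, j, k⟩, rfl⟩ := bs_gen n g
  rw [bsAff_triple] at hg
  have h1 := congrArg Aff.r hg
  have h2 := congrArg Aff.k hg
  have hn' : (n : ℚ) ≠ 0 := Int.cast_ne_zero.2 hn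
  simp [hn'] at h1 h2
  have : k = i := by omega
  simp [triple, h1, this]

theorem bs_normalForm (hn : n ≠ 0) : NormalForm n True (bsA n) (bsB n) where
  rel := bs_rel n
  triv h := absurd trivial h
  gen := bs_gen n
  inj := by
    rintro ⟨i, j, k⟩ hu
    have hg := congrArg (bsAff hn) hu
    rw [bsAff_triple, map_one] at hg
    have h1 := congrArg Aff.r hg
    have h2 := congrArg Aff.k hg
    have hn' : (n : ℚ) ≠ 0 := Int.cast_ne_zero.2 hn
    simp [hn'] at h1 h2
    exact ⟨h1, fun _ => show i = k by omega⟩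

end BS

/-! ### Forbidden equations in `BS(1, n)` -/

/-- For `n ≠ 0, 1`: the equations `z ^ p = a ^ k b ^ l` that are used to recognise a basis. -/
def rootsGeneral (n : ℤ) (p : ℕ) (k l : ℤ) : Prop :=
  ¬ (p : ℤ) ∣ l ∨ (l = 0 ∧ ¬ (p : ℤ) ∣ k ∧ (p = 0 ∨ p.Coprime n.natAbs))

/-- In `ℤ²` this is the complete list: `a^k b^l` has a `p`-th root exactly when `p` divides both
exponents. -/
def rootsPlane (p : ℕ) (k l : ℤ) : Prop := ¬ ((p : ℤ) ∣ k ∧ (p : ℤ) ∣ l)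

/-- The second member of the pair is trivial in the cyclic case, so `l = 0` suffices. -/
def rootsLine (p : ℕ) (k l : ℤ) : Prop := l = 0 ∧ ¬ (p : ℤ) ∣ k

-- Recognition of a basis for `n ≠ 0, 1`

section General

variable {n : ℤ}

theorem bsAff_range (hn : n ≠ 0) (g : BaumslagSolitar 1 n) :
    ∃ (i : ℕ) (j : ℤ), (bsAff hn g).r = j / (n : ℚ) ^ i := by
  obtain ⟨⟨i, j, k⟩, rfl⟩ := bs_gen n g
  exact ⟨i, j, by rw [bsAff_triple]⟩

theorem bsAff_zpow_a_zpow_b (hn : n ≠ 0) (k l : ℤ) :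
    bsAff hn (bsA n ^ k * bsB n ^ l) = ⟨k, l⟩ := by
  rw [map_mul, map_zpow, map_zpow, bsAff_a, bsAff_b, Aff.zpow_a]
  ext
  · have h : ∀ m : ℕ, ((⟨0, 1⟩ : Aff (bsUnit hn)) ^ m).r = 0 := fun m => by rw [Aff.pow_b]
    obtain ⟨m, rfl | rfl⟩ := l.eq_nat_or_neg
    · simp [h]
    · simp [h]
  · simp

/-- The exponent of `b` is a homomorphism to `ℤ`, so a `p`-th root forces `p ∣ l`. For `l = 0` and
`p > 0` the root is a translation by an element of `ℤ[1/n]`; since `p` is coprime to `n`, the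
denominator can be cleared and `p ∣ k` follows. -/
theorem bs_basis_general (hn : n ≠ 0) :
    IsBasisLike n True (rootsGeneral n) (bsA n) (bsB n) where
  rel := bs_rel n
  triv h := absurd trivial h
  noroot := by
    intro p k l hQ z hz
    have h := congrArg (bsAff hn) hz
    rw [bsAff_zpow_a_zpow_b, map_pow] at h
    have hk := congrArg Aff.k h
    rw [Aff.pow_k] at hk
    rcases hQ with hQ | ⟨rfl, hk', hp⟩
    · exact hQ ⟨_, hk.symm⟩
    · rcases Nat.eq_zero_or_pos p with rfl | hp0
      · have := congrArg Aff.r h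
        simp at this
        have hk0 : k = 0 := by exact_mod_cast this.symm
        exact hk' (by simp [hk0])
      · have hz0 : (bsAff hn z).k = 0 := by
          rcases mul_eq_zero.1 hk with h0 | h0
          · omega
          · exact h0
        obtain ⟨i, j, hj⟩ := bsAff_range hn z
        have hr := congrArg Aff.r h
        rw [Aff.pow_r_of_k_eq_zero _ (by simp [hz0]), hj] at hr
        have hn' : (n : ℚ) ≠ 0 := Int.cast_ne_zero.2 hn
        field_simp at hr
        norm_cast at hr
        have hcop : IsCoprime (p : ℤ) (n ^ i) := by
          apply IsCoprime.pow_right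
          rw [Int.isCoprime_iff_gcd_eq_one]
          rcases hp with hp | hp
          · omega
          · exact hp
        exact hk' (hcop.dvd_of_dvd_mul_right ⟨j, by linarith⟩)

theorem conj_r {ν : ℚˣ} (g x : Aff ν) (hx : x.k = 0) :
    g * x * g⁻¹ = ⟨((ν ^ g.k : ℚˣ) : ℚ) * x.r, 0⟩ := by
  ext
  · simp only [Aff.mul_r, Aff.inv_r, Aff.mul_k, hx, add_zero, zpow_neg, Units.val_inv_eq_inv_val]
    rw [mul_neg, mul_inv_cancel_left₀ (Units.ne_zero _)]; ring
  · simp [hx]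

theorem zpow_eq_self_cases (hn : n ≠ 0) (hn1 : n ≠ 1) {m : ℤ} (h : (n : ℚ) ^ m = n) :
    m = 1 ∨ n = -1 ∧ Odd m := by
  by_cases h1 : n = -1
  · right
    refine ⟨h1, ?_⟩
    by_contra hodd
    rw [Int.not_odd_iff_even] at hodd
    subst h1
    rw [Int.cast_neg, Int.cast_one, hodd.neg_one_zpow] at h
    norm_num at h
  · left
    have habs : (|n| : ℚ) ^ m = (|n| : ℚ) ^ (1 : ℤ) := by rw [← abs_zpow, h, zpow_one]
    have h2 : (1 : ℚ) < |(n : ℚ)| := by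
      have : 1 < |n| := by
        rcases lt_or_gt_of_ne hn with h | h
        · rw [abs_of_neg h]; omega
        · rw [abs_of_pos h]; omega
      exact_mod_cast this
    exact zpow_right_injective₀ (by linarith) h2.ne' habs

/-- The multiplicity of a prime in `j` is less than `j`, while each prime factor of `n` occurs at
least `j` times in `n ^ j`. -/
theorem dvd_pow_self_of_primes {j n : ℕ} (hj : j ≠ 0) (hn : n ≠ 0)
    (h : ∀ q, q.Prime → q ∣ j → q ∣ n) : j ∣ n ^ j := by
  rw [← Nat.factorization_prime_le_iff_dvd hj (pow_ne_zero _ hn)]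
  intro q hq
  by_cases hqj : q ∣ j
  · rw [Nat.factorization_pow, Finsupp.smul_apply, smul_eq_mul]
    have h1 := hq.factorization_pos_of_dvd hn (h q hq hqj)
    have h2 := (Nat.factorization_lt q hj).le
    nlinarith
  · rw [Nat.factorization_eq_zero_of_not_dvd hqj]; exact Nat.zero_le _

/-- Since `y` scales translations by `n`, conjugating by its powers first clears the denominator of
`x` and later divides by `n ^ m`, which recovers `a`. Removing the translation part of `y` then
recovers `b`. -/
theorem bs_closure_eq_top (hn : n ≠ 0) (S : Subgroup (BaumslagSolitar 1 n))
    {x y : BaumslagSolitar 1 n} (hx : x ∈ S) (hy : y ∈ S) {i : ℕ} {j : ℤ} {m : ℕ}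
    (hxr : bsAff hn x = ⟨j / (n : ℚ) ^ i, 0⟩) (hj : j ∣ n ^ m) (hyk : (bsAff hn y).k = 1) :
    S = ⊤ := by
  have hn' : (n : ℚ) ≠ 0 := Int.cast_ne_zero.2 hn
  have hA : bsA n ∈ S := by
    obtain ⟨c, hc⟩ := hj
    have hconj : bsAff hn (y ^ i * x * (y ^ i)⁻¹) = ⟨j, 0⟩ := by
      rw [map_mul, map_mul, map_inv, hxr, conj_r _ _ rfl]
      ext
      · simp [hyk]; field_simp
      · rfl
    -- The `c`-th power of the translation by `j` is the translation by `n ^ m`, which conjugation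
    -- by `y⁻¹ ^ m` brings back to `1`.
    have : bsA n = y⁻¹ ^ m * (y ^ i * x * (y ^ i)⁻¹) ^ c * (y⁻¹ ^ m)⁻¹ := by
      apply bsAff_injective hn
      rw [map_mul, map_mul, map_zpow, hconj, map_inv, conj_r, bsAff_a]
      · ext
        · rw [Aff.zpow_r_of_k_eq_zero _ (by simp)]
          simp [hyk]
          have : (n : ℚ) ^ m = j * c := by exact_mod_cast hc
          have h0 : (j : ℚ) * c ≠ 0 := this ▸ pow_ne_zero _ hn'
          rw [this, mul_comm (c : ℚ), inv_mul_cancel₀ h0]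
        · rfl
      · simp
    rw [this]
    exact S.mul_mem (S.mul_mem (S.pow_mem (S.inv_mem hy) _) (S.zpow_mem (S.mul_mem (S.mul_mem
      (S.pow_mem hy _) hx) (S.inv_mem (S.pow_mem hy _))) _))
      (S.inv_mem (S.pow_mem (S.inv_mem hy) _))
  have hB : bsB n ∈ S := by
    obtain ⟨i', j', h⟩ := bsAff_range hn y
    -- The translation by `j' / n ^ i'` is a conjugate of `a ^ j'` by a power of `y`.
    have : bsB n = (y⁻¹ ^ i' * bsA n ^ j' * (y⁻¹ ^ i')⁻¹)⁻¹ * y := by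
      apply bsAff_injective hn
      rw [map_mul, map_inv, map_mul, map_mul, map_inv, map_zpow, bsAff_a, conj_r, bsAff_b]
      · ext
        · simp [hyk, h, Aff.zpow_a]
          rw [div_eq_inv_mul]; ring
        · simp [hyk]
      · simp
    rw [this]
    exact S.mul_mem (S.inv_mem (S.mul_mem (S.mul_mem (S.pow_mem (S.inv_mem hy) _)
      (S.zpow_mem hA _)) (S.inv_mem (S.pow_mem (S.inv_mem hy) _)))) hy
  rw [eq_top_iff, ← bs_closure, Subgroup.closure_le]
  rintro z (rfl | rfl)
  · exact hA
  · exact hB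

/-- With `ν = -1` such a `u` acts as a point reflection, so its square has no translation part and
trivial linear part. -/
theorem Aff.odd_pow {ν : ℚˣ} (hν : (ν : ℚ) = -1) {u : Aff ν} (hu : u.k = 1 ∨ u.k = -1)
    (m : ℕ) : (u ^ (2 * m + 1)).r = u.r := by
  have hν' : ν = -1 := by ext; simpa using hν
  subst hν'
  have h2 : (u ^ 2).r = 0 := by
    rw [pow_two, mul_r]
    rcases hu with h | h <;> rw [h] <;> simp
  have h3 : ((u ^ 2) ^ m).r = 0 := by
    rw [pow_r_of_k_eq_zero, h2, mul_zero]
    rw [pow_k, zpow_mul]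
    norm_num
  have h4 : (-1 : ℚˣ) ^ ((m : ℤ) * (((2 : ℕ) : ℤ) * u.k)) = 1 := by
    rw [mul_comm, mul_assoc, zpow_mul]
    norm_num
  rw [pow_succ, pow_mul, mul_r, h3, pow_k, pow_k, h4]; simp

theorem exists_aff_of_k (hn : n ≠ 0) (y : BaumslagSolitar 1 n) (e : ℤ) :
    ∃ z, (bsAff hn z).r = (bsAff hn y).r ∧ (bsAff hn z).k = e := by
  refine ⟨y * (bsB n) ^ (e - (bsAff hn y).k), ?_, ?_⟩
  · have h := bsAff_zpow_a_zpow_b hn 0 (e - (bsAff hn y).k)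
    rw [zpow_zero, one_mul] at h
    rw [map_mul, h]; simp
  · have h := bsAff_zpow_a_zpow_b hn 0 (e - (bsAff hn y).k)
    rw [zpow_zero, one_mul] at h
    rw [map_mul, h]; simp

/-- The relation makes `x` a translation `j / n ^ i`. A prime factor of `j` not dividing `n` would
give `x` a forbidden root, so `j` divides a power of `n`. The relation also gives `n ^ k = n` for
the exponent `k` of `y`. Hence `k = 1`, except for `n = -1`, where `k` is only known to be odd and
the forbidden roots of `y` leave `k = ±1`. -/
theorem bs_rigid_general (hn : n ≠ 0) (hn1 : n ≠ 1) (x y : BaumslagSolitar 1 n)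
    (h : IsBasisLike n True (rootsGeneral n) x y) : Subgroup.closure {x, y} = ⊤ := by
  have hn' : (n : ℚ) ≠ 0 := Int.cast_ne_zero.2 hn
  set S := Subgroup.closure {x, y} with hS
  have hxS : x ∈ S := Subgroup.subset_closure (by simp)
  have hyS : y ∈ S := Subgroup.subset_closure (by simp)
  have hrel := congrArg (bsAff hn) h.rel
  rw [map_mul, map_mul, map_zpow] at hrel
  -- Comparing exponents in the relation gives `(n - 1) k = 0`.
  have hxk : (bsAff hn x).k = 0 := by
    have := congrArg Aff.k hrel
    simp only [Aff.mul_k, Aff.zpow_k] at this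
    have h3 : (n - 1) * (bsAff hn x).k = 0 := by linarith
    rcases mul_eq_zero.1 h3 with h3 | h3
    · omega
    · exact h3
  obtain ⟨i, j, hxr⟩ := bsAff_range hn x
  have hx : bsAff hn x = ⟨j / (n : ℚ) ^ i, 0⟩ := Aff.ext hxr hxk
  have hj0 : j ≠ 0 := by
    rintro rfl
    refine h.noroot 0 1 0 (Or.inr ⟨rfl, by simp, Or.inl rfl⟩) 1 ?_
    have : x = 1 := bsAff_injective hn (by rw [hx, map_one]; ext <;> simp)
    simp [this]
  have hprimes : ∀ q : ℕ, q.Prime → q ∣ j.natAbs → q ∣ n.natAbs := by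
    intro q hq hqj
    by_contra hqn
    obtain ⟨c, hc⟩ := Int.natCast_dvd.2 hqj
    -- With `j = q c`, the translation by `c / n ^ i` is a `q`-th root of `x`.
    refine h.noroot q 1 0 (Or.inr ⟨rfl, ?_, Or.inr ((Nat.Prime.coprime_iff_not_dvd hq).2 hqn)⟩)
      (triple (bsA n) (bsB n) (i, c, i)) ?_
    · intro hd
      have := Int.natCast_dvd.1 hd
      exact hq.one_lt.ne' (Nat.dvd_one.1 this)
    · apply bsAff_injective hn
      rw [map_pow, bsAff_triple, zpow_one x, zpow_zero y, mul_one, hx, hc]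
      ext
      · rw [Aff.pow_r_of_k_eq_zero _ (by simp)]; push_cast; ring
      · simp
  have hjn : j ∣ n ^ j.natAbs := by
    rw [← Int.natAbs_dvd_natAbs, Int.natAbs_pow]
    exact dvd_pow_self_of_primes (Int.natAbs_ne_zero.2 hj0) (Int.natAbs_ne_zero.2 hn) hprimes
  have hyk : (n : ℚ) ^ (bsAff hn y).k = n := by
    have := congrArg Aff.r hrel
    rw [Aff.mul_r, Aff.mul_r, Aff.zpow_r_of_k_eq_zero _ (by simp [hxk]), Aff.zpow_k, hx] at this
    simp at this
    rw [add_comm] at this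
    have h2 := add_right_cancel this
    have h3 : (j : ℚ) / (n : ℚ) ^ i ≠ 0 := by
      have : (j : ℚ) ≠ 0 := Int.cast_ne_zero.2 hj0
      positivity
    exact mul_right_cancel₀ h3 h2
  rcases zpow_eq_self_cases hn hn1 hyk with hk | ⟨hn2, m, hm⟩
  · exact bs_closure_eq_top hn S hxS hyS hx hjn hk
  · have hk : (bsAff hn y).k = 1 ∨ (bsAff hn y).k = -1 := by
      by_contra hc
      -- Keep the translation part of `y` and reduce its exponent to its sign. As `n = -1`, odd
      -- powers preserve the translation part, so `z` is a root of `y` of order `|k|`.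
      obtain ⟨z, hz1, hz2⟩ := exists_aff_of_k hn y (if 0 < (bsAff hn y).k then 1 else -1)
      obtain ⟨m', hm'⟩ : ∃ m' : ℕ, (bsAff hn y).k.natAbs = 2 * m' + 1 :=
        ⟨(bsAff hn y).k.natAbs / 2, by omega⟩
      refine h.noroot (bsAff hn y).k.natAbs 0 1 (Or.inl ?_) z ?_
      · intro hd
        have := Int.natCast_dvd.1 hd
        have := Nat.dvd_one.1 this
        omega
      · apply bsAff_injective hn
        rw [map_pow, zpow_zero x, zpow_one y, one_mul]
        ext
        · rw [hm', Aff.odd_pow, hz1]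
          · simp [hn2]
          · rw [hz2]; split_ifs <;> simp
        · rw [Aff.pow_k, hz2]; split_ifs <;> omega
    rcases hk with hk | hk
    · exact bs_closure_eq_top hn S hxS hyS hx hjn hk
    · exact bs_closure_eq_top hn S hxS (S.inv_mem hyS) hx hjn (by simp [hk])

theorem scottPair_general (hn : n ≠ 0) (hn1 : n ≠ 1) :
    ScottPair (BaumslagSolitar 1 n) n True (rootsGeneral n) (bsA n) (bsB n) where
  ne_zero := hn
  nf := bs_normalForm hn
  basis := bs_basis_general hn
  rigid := bs_rigid_general hn hn1
  forbid₁ k hk := Or.inr ⟨rfl, by simpa using hk, Or.inl rfl⟩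
  forbid₂ _ k l hkl := by
    by_cases hl : l = 0
    · exact Or.inr ⟨hl, by simpa [hl] using hkl, Or.inl rfl⟩
    · exact Or.inl (by simpa using hl)

end General

-- The case `n = 0`: an infinite cyclic group

section Line

/-- The homomorphism from `BS(1, 0)` to the integers that kills `a`. -/
def bsZeroDeg : BaumslagSolitar 1 0 →* Multiplicative ℤ :=
  bsLift 1 (.ofAdd 1) (by simp)

theorem bsZero_a : bsA 0 = 1 := by
  have := bs_rel 0
  rw [zpow_zero (bsA 0), one_mul] at this
  simpa using this

theorem bsZeroDeg_b_zpow (j : ℤ) : bsZeroDeg (bsB 0 ^ j) = .ofAdd j := by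
  rw [map_zpow, bsZeroDeg, bsLift_b, ← ofAdd_zsmul]; simp

theorem bsZero_exists (g : BaumslagSolitar 1 0) : ∃ j : ℤ, g = bsB 0 ^ j := by
  obtain ⟨⟨i, j, k⟩, rfl⟩ := bs_gen 0 g
  refine ⟨k - i, ?_⟩
  rw [triple, bsZero_a, one_zpow, mul_one, zpow_sub, zpow_natCast, zpow_natCast, inv_pow]
  exact ((Commute.refl (bsB 0)).pow_pow k i).inv_right.eq.symm

/-- As `a = 1`, the generator `b` plays the role of the first member of the pair and the second one
is trivial, hence `N = 1` and `P` false. An element without proper roots is `b` or its inverse. -/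
theorem scottPair_line :
    ScottPair (BaumslagSolitar 1 0) 1 False rootsLine (bsB 0) 1 where
  ne_zero := one_ne_zero
  nf :=
    { rel := by simp
      triv := fun _ => rfl
      gen := fun g => by
        obtain ⟨j, rfl⟩ := bsZero_exists g
        exact ⟨(0, j, 0), by simp [triple]⟩
      inj := by
        rintro ⟨i, j, k⟩ h
        simp only [triple, inv_one, one_pow, one_mul, mul_one] at h
        have := bsZeroDeg_b_zpow j
        rw [h, map_one] at this
        exact ⟨(congrArg Multiplicative.toAdd this).symm, False.elim⟩ }
  basis :=
    { rel := by simp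
      triv := fun _ => rfl
      noroot := by
        rintro p k l ⟨rfl, hk⟩ z hz
        obtain ⟨j, rfl⟩ := bsZero_exists z
        rw [zpow_zero (1 : BaumslagSolitar 1 0), mul_one] at hz
        have := congrArg bsZeroDeg hz
        rw [map_pow, bsZeroDeg_b_zpow, bsZeroDeg_b_zpow, ← ofAdd_nsmul] at this
        have := congrArg Multiplicative.toAdd this
        exact hk ⟨j, by simpa [mul_comm] using this.symm⟩ }
  rigid := by
    intro x y h
    obtain ⟨j, rfl⟩ := bsZero_exists x
    have hy : y = 1 := h.triv id
    have hj : j.natAbs = 1 := by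
      by_contra hj
      -- The element `b ^ j` is the `|j|`-th power of `b ^ sign j`; this also covers `j = 0`, where
      -- the order of the root is `0`.
      refine h.noroot j.natAbs 1 0 ⟨rfl, ?_⟩ (bsB 0 ^ j.sign) ?_
      · intro hd
        exact hj (Nat.dvd_one.1 (Int.natCast_dvd.1 hd))
      · rw [zpow_one (bsB 0 ^ j), zpow_zero y, mul_one, ← zpow_natCast, ← zpow_mul,
          Int.sign_mul_natAbs]
    have hb : bsB 0 ∈ Subgroup.closure {bsB 0 ^ j, y} := by
      have hx : bsB 0 ^ j ∈ Subgroup.closure {bsB 0 ^ j, y} := Subgroup.subset_closure (by simp)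
      rcases Int.natAbs_eq_iff.1 hj with rfl | rfl
      · simpa using hx
      · simpa using Subgroup.inv_mem _ hx
    rw [eq_top_iff]
    intro g _
    obtain ⟨i, rfl⟩ := bsZero_exists g
    exact Subgroup.zpow_mem _ hb i
  forbid₁ k hk := ⟨rfl, by simpa using hk⟩
  forbid₂ h := h.elim

end Line

-- The case `n = 1`: the free abelian group of rank two

section Plane

theorem bsOne_r (g : BaumslagSolitar 1 1) :
    ∃ j k : ℤ, g = bsA 1 ^ j * bsB 1 ^ k := by
  obtain ⟨⟨i, j, k⟩, rfl⟩ := bs_gen 1 g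
  have hc : Commute (bsB 1) (bsA 1) := by
    have := bs_rel 1
    rwa [zpow_one (bsA 1)] at this
  refine ⟨j, k - i, ?_⟩
  rw [triple, zpow_sub, zpow_natCast, zpow_natCast, inv_pow,
    ((hc.pow_left i).zpow_right j).inv_left.eq, mul_assoc,
    ((Commute.refl (bsB 1)).pow_pow i k).inv_left.eq]

theorem bsOne_mul_comm (g h : BaumslagSolitar 1 1) : g * h = h * g := by
  apply bsAff_injective one_ne_zero
  rw [map_mul, map_mul]
  ext
  · simp [add_comm]
  · simp [add_comm]

theorem bsOne_pow (z1 z2 : ℤ) (p : ℕ) :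
    (bsA 1 ^ z1 * bsB 1 ^ z2) ^ p = bsA 1 ^ (p * z1) * bsB 1 ^ (p * z2) := by
  rw [(show Commute _ _ from bsOne_mul_comm _ _).mul_pow, ← zpow_natCast, ← zpow_natCast,
    ← zpow_mul, ← zpow_mul, mul_comm z1, mul_comm z2]

theorem bsOne_zpow (z1 z2 p : ℤ) :
    (bsA 1 ^ z1 * bsB 1 ^ z2) ^ p = bsA 1 ^ (p * z1) * bsB 1 ^ (p * z2) := by
  rw [(show Commute _ _ from bsOne_mul_comm _ _).mul_zpow, ← zpow_mul, ← zpow_mul, mul_comm z1,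
    mul_comm z2]

theorem bsOne_mul (x1 x2 y1 y2 : ℤ) :
    (bsA 1 ^ x1 * bsB 1 ^ x2) * (bsA 1 ^ y1 * bsB 1 ^ y2) =
      bsA 1 ^ (x1 + y1) * bsB 1 ^ (x2 + y2) := by
  rw [zpow_add, zpow_add, mul_assoc, ← mul_assoc (bsB 1 ^ x2), bsOne_mul_comm (bsB 1 ^ x2)]
  simp only [mul_assoc]

theorem bsOne_inj {k l k' l' : ℤ}
    (h : bsA 1 ^ k * bsB 1 ^ l = bsA 1 ^ k' * bsB 1 ^ l') : k = k' ∧ l = l' := by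
  have h1 := congrArg (bsAff one_ne_zero) h
  rw [bsAff_zpow_a_zpow_b, bsAff_zpow_a_zpow_b, Aff.mk.injEq] at h1
  exact ⟨by exact_mod_cast h1.1, h1.2⟩

/-- A pair generates `ℤ²` when its determinant is `±1`. Otherwise some prime divides the
determinant, so some combination of the pair with coefficients not all divisible by that prime has a
root of that order, which is forbidden. -/
theorem scottPair_plane :
    ScottPair (BaumslagSolitar 1 1) 1 True rootsPlane (bsA 1) (bsB 1) where
  ne_zero := one_ne_zero
  nf := bs_normalForm one_ne_zero
  basis :=
    { rel := bs_rel 1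
      triv := fun h => absurd trivial h
      noroot := by
        intro p k l hQ z hz
        obtain ⟨z1, z2, rfl⟩ := bsOne_r z
        rw [bsOne_pow] at hz
        obtain ⟨h1, h2⟩ := bsOne_inj hz
        exact hQ ⟨⟨_, h1.symm⟩, ⟨_, h2.symm⟩⟩ }
  rigid := by
    intro x y h
    obtain ⟨x1, x2, rfl⟩ := bsOne_r x
    obtain ⟨y1, y2, rfl⟩ := bsOne_r y
    set D := x1 * y2 - x2 * y1 with hD
    have key : ∀ (p : ℕ) (k l z1 z2 : ℤ), k * x1 + l * y1 = p * z1 → k * x2 + l * y2 = p * z2 →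
        (p : ℤ) ∣ k ∧ (p : ℤ) ∣ l := by
      intro p k l z1 z2 h1 h2
      by_contra hc
      refine h.noroot p k l hc (bsA 1 ^ z1 * bsB 1 ^ z2) ?_
      rw [bsOne_pow, bsOne_zpow, bsOne_zpow, bsOne_mul, h1, h2]
    have hD1 : D.natAbs = 1 := by
      by_contra hne
      obtain ⟨q, hq, hqD⟩ := Nat.exists_prime_and_dvd hne
      obtain ⟨c, hc⟩ := Int.natCast_dvd.2 hqD
      -- The rows of the adjugate matrix combine `x` and `y` into `(D, 0)` and `(0, D)`, both
      -- multiples of `q`. Hence `q` divides all four entries, so `x` itself is a `q`-th power,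
      -- which would force `q ∣ 1`.
      obtain ⟨⟨c1, h1⟩, c2, h2⟩ := key q y2 (-x2) c 0 (by rw [← hc, hD]; ring) (by ring)
      obtain ⟨⟨c3, h3⟩, c4, h4⟩ := key q (-y1) x1 0 c (by ring) (by rw [← hc, hD]; ring)
      obtain ⟨h5, -⟩ := key q 1 0 c4 (-c2) (by rw [← h4]; ring) (by rw [mul_neg, ← h2]; ring)
      exact hq.one_lt.ne' (Nat.dvd_one.1 (Int.natCast_dvd.1 h5))
    set S := Subgroup.closure {bsA 1 ^ x1 * bsB 1 ^ x2, bsA 1 ^ y1 * bsB 1 ^ y2} with hS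
    have hxS : bsA 1 ^ x1 * bsB 1 ^ x2 ∈ S := Subgroup.subset_closure (by simp)
    have hyS : bsA 1 ^ y1 * bsB 1 ^ y2 ∈ S := Subgroup.subset_closure (by simp)
    have hDD : D * D = 1 := by rcases Int.natAbs_eq_iff.1 hD1 with h | h <;> rw [h] <;> rfl
    rw [eq_top_iff]
    intro g _
    obtain ⟨j, k, rfl⟩ := bsOne_r g
    -- Cramer's rule, where `D` is its own inverse because `D * D = 1`.
    have : bsA 1 ^ j * bsB 1 ^ k =
        (bsA 1 ^ x1 * bsB 1 ^ x2) ^ (D * (j * y2 - k * y1)) *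
          (bsA 1 ^ y1 * bsB 1 ^ y2) ^ (D * (k * x1 - j * x2)) := by
      rw [bsOne_zpow, bsOne_zpow, bsOne_mul]
      congr 2
      · calc j = D * D * j := by rw [hDD, one_mul]
          _ = _ := by rw [hD]; ring
      · calc k = D * D * k := by rw [hDD, one_mul]
          _ = _ := by rw [hD]; ring
    rw [this]
    exact S.mul_mem (S.zpow_mem hxS _) (S.zpow_mem hyS _)
  forbid₁ k hk := fun h => hk (by simpa using h.1)
  forbid₂ _ k l hkl := by
    rintro ⟨h1, h2⟩
    simp at h1 h2
    tauto

end Plane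

/-! ### The axioms of a basis, as a family of equations and inequations -/

/-- The data of an axiomatisation of a basis; `q` decides the set of forbidden equations, with
integer exponents represented as differences of natural numbers. -/
structure BasisSpec where
  N : ℤ
  P : Bool
  q : ℕ × ℕ × ℕ × ℕ × ℕ → Bool

def BasisSpec.Q (s : BasisSpec) (p : ℕ) (k l : ℤ) : Prop :=
  s.q (p, k.toNat, (-k).toNat, l.toNat, (-l).toNat) = true

/-- The decision procedure depends only on the integers that are represented, and `N` is `1`
if the second generator is trivial. -/
structure BasisSpec.Coherent (s : BasisSpec) : Prop where
  q : ∀ p k₁ k₂ l₁ l₂ : ℕ, s.q (p, k₁, k₂, l₁, l₂) = true → s.Q p (k₁ - k₂) (l₁ - l₂)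
  N : s.P ≠ true → s.N = 1

/-- Indices of axioms: a selector followed by the exponents of a forbidden equation. -/
abbrev AxIndex := ℕ × ℕ × ℕ × ℕ × ℕ × ℕ

abbrev Vars (α : Type*) := α × α × α × α × α

namespace Ops

variable {α β : Type*} (A : Ops α) {B : Ops β}

def npow (x : α) (n : ℕ) : α := Nat.rec A.one (fun _ r => A.mul x r) n

def dpow (x : α) (k₁ k₂ : ℕ) : α := A.mul (A.npow x k₁) (A.npow (A.inv x) k₂)

/-- The word `y^{-i} x^{j₁ - j₂} y^k`. -/
def normalWord (x y : α) (i : AxIndex) : α :=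
  A.mul (A.mul (A.npow (A.inv y) i.1) (A.dpow x i.2.1 i.2.2.1)) (A.npow y i.2.2.2.1)

/-- The left-hand side of an axiom. -/
def lhs (s : BasisSpec) (v : Vars α) (i : AxIndex) : α :=
  if i.1 = 0 then A.mul (A.mul v.2.2.1 v.2.2.2.1) v.2.2.2.2
  else if i.1 = 1 then A.mul A.one v.2.2.1
  else if i.1 = 2 then A.mul (A.inv v.2.2.1) v.2.2.1
  else if i.1 = 3 then (if s.P = true then A.mul v.2.1 v.1 else v.2.1)
  else if s.q i.2 = true then A.npow v.2.2.1 i.2.1 else A.one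

/-- The right-hand side of an axiom. -/
def rhs (s : BasisSpec) (v : Vars α) (i : AxIndex) : α :=
  if i.1 = 0 then A.mul v.2.2.1 (A.mul v.2.2.2.1 v.2.2.2.2)
  else if i.1 = 1 then v.2.2.1
  else if i.1 = 2 then A.one
  else if i.1 = 3 then
    (if s.P = true then A.mul (A.dpow v.1 s.N.toNat (-s.N).toNat) v.2.1 else A.one)
  else if s.q i.2 = true then
    A.mul (A.dpow v.1 i.2.2.1 i.2.2.2.1) (A.dpow v.2.1 i.2.2.2.2.1 i.2.2.2.2.2)
  else A.one

end Ops

/-- Whether an axiom is an equation (`true`) or an inequation. -/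
def BasisSpec.sign (s : BasisSpec) (i : AxIndex) : Bool := decide (i.1 < 4) || !s.q i.2

def Ops.Holds {α : Type*} (A : Ops α) (s : BasisSpec) (v : Vars α) (i : AxIndex) : Prop :=
  A.lhs s v i = A.rhs s v i ↔ s.sign i = true

def Vars.map {α β : Type*} (f : α → β) (v : Vars α) : Vars β :=
  (f v.1, f v.2.1, f v.2.2.1, f v.2.2.2.1, f v.2.2.2.2)

namespace Ops

variable {α β : Type*} {A : Ops α} {B : Ops β} {f : α → β}

theorem Hom.npow (h : A.Hom B f) (x : α) (n : ℕ) : f (A.npow x n) = B.npow (f x) n := by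
  induction n with
  | zero => exact h.one
  | succ n ih => exact (h.mul _ _).trans (congrArg _ ih)

theorem Hom.dpow (h : A.Hom B f) (x : α) (k₁ k₂ : ℕ) :
    f (A.dpow x k₁ k₂) = B.dpow (f x) k₁ k₂ := by
  simp only [Ops.dpow, h.mul, h.npow, h.inv]

theorem Hom.normalWord (h : A.Hom B f) (x y : α) (i : AxIndex) :
    f (A.normalWord x y i) = B.normalWord (f x) (f y) i := by
  simp only [Ops.normalWord, h.mul, h.npow, h.inv, h.dpow]

/-- Axioms are words over an arbitrary algebra of group type. The same words are evaluated on
elements, formal terms, Gödel numbers and truth values, and homomorphisms translate between these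
readings. -/
theorem Hom.lhs (h : A.Hom B f) (s : BasisSpec) (v : Vars α) (i : AxIndex) :
    f (A.lhs s v i) = B.lhs s (v.map f) i := by
  simp only [Ops.lhs, Vars.map]
  split_ifs <;> simp only [h.mul, h.npow, h.inv, h.one]

theorem Hom.rhs (h : A.Hom B f) (s : BasisSpec) (v : Vars α) (i : AxIndex) :
    f (A.rhs s v i) = B.rhs s (v.map f) i := by
  simp only [Ops.rhs, Vars.map]
  split_ifs <;> simp only [h.mul, h.dpow, h.one]

theorem Hom.holds_iff (h : A.Hom B f) (hf : f.Injective) (s : BasisSpec) (v : Vars α)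
    (i : AxIndex) : B.Holds s (v.map f) i ↔ A.Holds s v i := by
  rw [Ops.Holds, Ops.Holds, ← h.lhs, ← h.rhs, hf.eq_iff]

theorem Hom.comp {γ : Type*} {C : Ops γ} {g : β → γ} (hg : B.Hom C g) (hf : A.Hom B f) :
    A.Hom C (g ∘ f) where
  one := (congrArg g hf.one).trans hg.one
  inv x := (congrArg g (hf.inv x)).trans (hg.inv _)
  mul x y := (congrArg g (hf.mul x y)).trans (hg.mul _ _)

theorem Hom.symm {f : α ≃ β} (h : A.Hom B f) : B.Hom A f.symm where
  one := by rw [← h.one, f.symm_apply_apply]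
  inv x := by rw [f.symm_apply_eq, h.inv, f.apply_symm_apply]
  mul x y := by rw [f.symm_apply_eq, h.mul, f.apply_symm_apply, f.apply_symm_apply]

end Ops

-- The axioms read in a group

section Group

variable {G : Type*} [Group G] (s : BasisSpec)

theorem groupOps_npow (x : G) (n : ℕ) : (groupOps G).npow x n = x ^ n := by
  induction n with
  | zero => exact (pow_zero x).symm
  | succ n ih => exact (congrArg (x * ·) ih).trans (pow_succ' x n).symm

theorem groupOps_dpow (x : G) (k₁ k₂ : ℕ) :
    (groupOps G).dpow x k₁ k₂ = x ^ ((k₁ : ℤ) - k₂) := by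
  rw [zpow_sub, zpow_natCast, zpow_natCast, ← inv_pow, ← groupOps_npow, ← groupOps_npow]; rfl

theorem groupOps_normalWord (x y : G) (i : AxIndex) :
    (groupOps G).normalWord x y i = triple x y (i.1, (i.2.1 : ℤ) - i.2.2.1, i.2.2.2.1) := by
  rw [triple, Ops.normalWord, groupOps_dpow, groupOps_npow, groupOps_npow]; rfl

theorem exists_normalWord {x y g : G} :
    (∃ i, g = (groupOps G).normalWord x y i) ↔ ∃ u, g = triple x y u := by
  constructor
  · rintro ⟨i, rfl⟩
    exact ⟨_, groupOps_normalWord x y i⟩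
  · rintro ⟨⟨i, j, k⟩, rfl⟩
    refine ⟨(i, j.toNat, (-j).toNat, k, 0, 0), ?_⟩
    rw [groupOps_normalWord, Int.toNat_sub_toNat_neg]

variable {s}

/-- Selectors `0` to `2` are the laws of groups and hold for free, selector `3` carries the relation
or the triviality of `y`, and all larger ones carry a forbidden equation, replaced by the harmless
`1 = 1` when the exponents are not on the list. -/
theorem isBasisLike_iff (hs : s.Coherent) {x y : G} :
    IsBasisLike s.N (s.P = true) s.Q x y ↔
      ∀ z₁ z₂ z₃ i, (groupOps G).Holds s (x, y, z₁, z₂, z₃) i := by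
  constructor
  · rintro h z₁ z₂ z₃ ⟨c, p, k₁, k₂, l₁, l₂⟩
    simp only [Ops.Holds, Ops.lhs, Ops.rhs, BasisSpec.sign]
    by_cases h0 : c = 0
    · simp [h0, groupOps, mul_assoc]
    by_cases h1 : c = 1
    · simp [h1, groupOps]
    by_cases h2 : c = 2
    · simp [h2, groupOps]
    by_cases h3 : c = 3
    · subst h3
      by_cases hP : s.P = true
      · simp only [hP, groupOps_dpow, Int.toNat_sub_toNat_neg]
        simpa [groupOps] using h.rel
      · simpa [hP, groupOps] using h.triv hP
    · have h4 : ¬ c < 4 := by omega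
      by_cases hq : s.q (p, k₁, k₂, l₁, l₂) = true
      · simp only [h0, h1, h2, h3, h4, hq, groupOps_dpow, groupOps_npow]
        simpa [groupOps] using h.noroot p _ _ (hs.q _ _ _ _ _ hq) z₁
      · simp [h0, h1, h2, h3, h4, hq]
  · intro h
    have h3 := h 1 1 1 (3, 0, 0, 0, 0, 0)
    simp only [Ops.Holds, Ops.lhs, Ops.rhs, BasisSpec.sign] at h3
    have htriv : ¬ s.P = true → y = 1 := by
      intro hP
      simpa [hP, groupOps] using h3
    refine ⟨?_, htriv, ?_⟩
    · by_cases hP : s.P = true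
      · simp only [hP, groupOps_dpow, Int.toNat_sub_toNat_neg] at h3
        simpa [groupOps] using h3
      -- If `y` is trivial the relation reads `x = x ^ N`, which holds because coherence makes `N =
      -- 1`.
      · rw [htriv hP, hs.N hP]; simp
    · intro p k l hQ z hz
      have h4 := h z 1 1 (4, p, k.toNat, (-k).toNat, l.toNat, (-l).toNat)
      simp only [Ops.Holds, Ops.lhs, Ops.rhs, BasisSpec.sign] at h4
      have hq : s.q (p, k.toNat, (-k).toNat, l.toNat, (-l).toNat) = true := hQ
      simp only [hq, groupOps_dpow, groupOps_npow, Int.toNat_sub_toNat_neg] at h4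
      simp [groupOps] at h4
      exact h4 hz

end Group

/-- Selectors `0`, `1`, `2` are associativity, left unit and left inverse, which already define a
group. -/
theorem Ops.exists_group {M : Type*} {A : Ops M} {s : BasisSpec} {x y : M}
    (h : ∀ z₁ z₂ z₃ i, A.Holds s (x, y, z₁, z₂, z₃) i) : ∃ _ : Group M, groupOps M = A := by
  let _ : Mul M := ⟨A.mul⟩
  let _ : Inv M := ⟨A.inv⟩
  let _ : One M := ⟨A.one⟩
  refine ⟨Group.ofLeftAxioms (fun u v w => ?_) (fun u => ?_) (fun u => ?_), rfl⟩
  · have := h u v w (0, 0, 0, 0, 0, 0)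
    simp [Ops.Holds, Ops.lhs, Ops.rhs, BasisSpec.sign] at this
    exact this
  · have := h u u u (1, 0, 0, 0, 0, 0)
    simp [Ops.Holds, Ops.lhs, Ops.rhs, BasisSpec.sign] at this
    exact this
  · have := h u u u (2, 0, 0, 0, 0, 0)
    simp [Ops.Holds, Ops.lhs, Ops.rhs, BasisSpec.sign] at this
    exact this

/-- Some pair satisfies the axioms of a basis. -/
def Ops.HasBasis {M : Type*} (A : Ops M) (s : BasisSpec) : Prop :=
  ∃ x y, ∀ z₁ z₂ z₃ i, A.Holds s (x, y, z₁, z₂, z₃) i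

/-- Every pair that satisfies the axioms of a basis generates. -/
def Ops.BasisGenerates {M : Type*} (A : Ops M) (s : BasisSpec) : Prop :=
  ∀ x y w, ∃ i z₁ z₂ z₃, ¬ A.Holds s (x, y, z₁, z₂, z₃) i ∨ w = A.normalWord x y i

theorem Ops.Hom.hasBasis {M M' : Type*} {A : Ops M} {B : Ops M'} {f : M ≃ M'}
    (h : A.Hom B f) {s : BasisSpec} (hA : A.HasBasis s) : B.HasBasis s := by
  obtain ⟨x, y, hxy⟩ := hA
  refine ⟨f x, f y, fun z₁ z₂ z₃ i => ?_⟩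
  have := (h.holds_iff f.injective s _ i).2 (hxy (f.symm z₁) (f.symm z₂) (f.symm z₃) i)
  simpa [Vars.map] using this

theorem Ops.Hom.basisGenerates {M M' : Type*} {A : Ops M} {B : Ops M'} {f : M ≃ M'}
    (h : A.Hom B f) {s : BasisSpec} (hA : A.BasisGenerates s) : B.BasisGenerates s := by
  intro x y w
  obtain ⟨i, z₁, z₂, z₃, hi⟩ := hA (f.symm x) (f.symm y) (f.symm w)
  refine ⟨i, f z₁, f z₂, f z₃, ?_⟩
  rw [← h.holds_iff f.injective, f.symm_apply_eq, h.normalWord] at hi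
  simpa [Vars.map] using hi

/-- The semantic content of the Scott sentence. -/
theorem ScottPair.exists_equiv_iff {G : Type*} [Group G] {s : BasisSpec} (hs : s.Coherent)
    {a b : G} (h : ScottPair G s.N (s.P = true) s.Q a b) {M : Type*} (A : Ops M) :
    A.HasBasis s ∧ A.BasisGenerates s ↔ ∃ f : M ≃ G, A.Hom (groupOps G) f := by
  constructor
  · rintro ⟨⟨x, y, hxy⟩, hgen⟩
    obtain ⟨_, rfl⟩ := Ops.exists_group hxy
    have hb := (isBasisLike_iff hs).2 hxy
    have hg : ∀ g : M, ∃ u, g = triple x y u := by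
      intro g
      obtain ⟨i, z₁, z₂, z₃, hi⟩ := hgen x y g
      refine exists_normalWord.1 ⟨i, ?_⟩
      exact hi.resolve_left fun hc => hc (hxy _ _ _ _)
    obtain ⟨e⟩ := (h.normalForm hb hg).nonempty_mulEquiv h.nf
    exact ⟨e.toEquiv, ⟨map_one e, map_inv e, map_mul e⟩⟩
  · rintro ⟨f, hf⟩
    have hf' := hf.symm
    refine ⟨hf'.hasBasis ⟨a, b, (isBasisLike_iff hs).1 h.basis⟩, hf'.basisGenerates ?_⟩
    intro x y w
    -- A basis-like pair generates by rigidity, which supplies the word. Any other pair violates an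
    -- axiom, which supplies the refutation.
    by_cases hxy : IsBasisLike s.N (s.P = true) s.Q x y
    · obtain ⟨i, hi⟩ := exists_normalWord.2 (h.gen hxy w)
      exact ⟨i, 1, 1, 1, Or.inr hi⟩
    · rw [isBasisLike_iff hs] at hxy
      push Not at hxy
      obtain ⟨z₁, z₂, z₃, i, hi⟩ := hxy
      exact ⟨i, z₁, z₂, z₃, Or.inl hi⟩

/-! ### Computability of operations -/

section Computability

variable {α σ : Type*} [Primcodable α] [Primcodable σ]

theorem _root_.Computable.ite_eq {f : α → ℕ} {c : ℕ} {g h : α → σ} (hf : Computable f)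
    (hg : Computable g) (hh : Computable h) :
    Computable fun a => if f a = c then g a else h a := by
  have : Computable fun a => decide (f a = c) :=
    (Primrec.eq (α := ℕ)).decide.to_comp.comp hf (Computable.const c)
  exact (Computable.cond this hg hh).of_eq fun a => by
    by_cases hc : f a = c <;> simp [hc]

theorem _root_.Computable.ite_true {f : α → Bool} {g h : α → σ} (hf : Computable f)
    (hg : Computable g) (hh : Computable h) :
    Computable fun a => if f a = true then g a else h a :=
  (Computable.cond hf hg hh).of_eq fun a => by cases f a <;> simp

theorem _root_.Computable.and {f g : α → Bool} (hf : Computable f) (hg : Computable g) :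
    Computable fun a => f a && g a :=
  Primrec.and.to_comp.comp hf hg

theorem _root_.Computable.or {f g : α → Bool} (hf : Computable f) (hg : Computable g) :
    Computable fun a => f a || g a :=
  Primrec.or.to_comp.comp hf hg

theorem _root_.Computable.not {f : α → Bool} (hf : Computable f) : Computable fun a => !f a :=
  Primrec.not.to_comp.comp hf

theorem _root_.Computable.decide_eq {f g : α → ℕ} (hf : Computable f) (hg : Computable g) :
    Computable fun a => decide (f a = g a) :=
  (Primrec.eq (α := ℕ)).decide.to_comp.comp hf hg

theorem _root_.Computable.natPair {f g : α → ℕ} (hf : Computable f) (hg : Computable g) :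
    Computable fun a => Nat.pair (f a) (g a) :=
  Primrec₂.natPair.to_comp.comp hf hg

structure Ops.IsComputable (A : Ops σ) : Prop where
  inv : Computable A.inv
  mul : Computable₂ A.mul

namespace Ops.IsComputable

variable {A : Ops σ} (hA : A.IsComputable)
include hA

theorem npow {f : α → σ} {n : α → ℕ} (hf : Computable f) (hn : Computable n) :
    Computable fun a => A.npow (f a) (n a) :=
  Computable.nat_rec (h := fun a p => A.mul (f a) p.2) hn (Computable.const A.one)
    (hA.mul.comp (hf.comp Computable.fst) (Computable.snd.comp Computable.snd)).to₂

theorem dpow {f : α → σ} {n m : α → ℕ} (hf : Computable f) (hn : Computable n)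
    (hm : Computable m) : Computable fun a => A.dpow (f a) (n a) (m a) :=
  hA.mul.comp (hA.npow hf hn) (hA.npow (hA.inv.comp hf) hm)

theorem normalWord {f g : α → σ} {i : α → AxIndex} (hf : Computable f) (hg : Computable g)
    (hi : Computable i) : Computable fun a => A.normalWord (f a) (g a) (i a) := by
  have h2 := Computable.snd.comp hi
  have h3 := Computable.snd.comp h2
  have h4 := Computable.snd.comp h3
  exact hA.mul.comp (hA.mul.comp (hA.npow (hA.inv.comp hg) (Computable.fst.comp hi))
    (hA.dpow hf (Computable.fst.comp h2) (Computable.fst.comp h3)))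
    (hA.npow hg (Computable.fst.comp h4))

theorem lhs {s : BasisSpec} (hs : Computable s.q) {v : α → Vars σ} {i : α → AxIndex}
    (hv : Computable v) (hi : Computable i) : Computable fun a => A.lhs s (v a) (i a) := by
  have hc := Computable.fst.comp hi
  have hq := Computable.snd.comp hi
  have x := Computable.fst.comp hv
  have v2 := Computable.snd.comp hv
  have y := Computable.fst.comp v2
  have v3 := Computable.snd.comp v2
  have z1 := Computable.fst.comp v3
  have v4 := Computable.snd.comp v3
  have z2 := Computable.fst.comp v4
  have z3 := Computable.snd.comp v4
  refine Computable.ite_eq hc (hA.mul.comp (hA.mul.comp z1 z2) z3) <|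
    Computable.ite_eq hc (hA.mul.comp (Computable.const _) z1) <|
    Computable.ite_eq hc (hA.mul.comp (hA.inv.comp z1) z1) <|
    Computable.ite_eq hc ?_ <|
    Computable.ite_true (hs.comp hq) (hA.npow z1 (Computable.fst.comp hq)) (Computable.const _)
  split_ifs
  · exact hA.mul.comp y x
  · exact y

theorem rhs {s : BasisSpec} (hs : Computable s.q) {v : α → Vars σ} {i : α → AxIndex}
    (hv : Computable v) (hi : Computable i) : Computable fun a => A.rhs s (v a) (i a) := by
  have hc := Computable.fst.comp hi
  have hq := Computable.snd.comp hi
  have x := Computable.fst.comp hv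
  have v2 := Computable.snd.comp hv
  have y := Computable.fst.comp v2
  have v3 := Computable.snd.comp v2
  have z1 := Computable.fst.comp v3
  have v4 := Computable.snd.comp v3
  have z2 := Computable.fst.comp v4
  have z3 := Computable.snd.comp v4
  have i3 := Computable.snd.comp hq
  have i4 := Computable.snd.comp i3
  have i5 := Computable.snd.comp i4
  refine Computable.ite_eq hc (hA.mul.comp z1 (hA.mul.comp z2 z3)) <|
    Computable.ite_eq hc z1 <|
    Computable.ite_eq hc (Computable.const _) <|
    Computable.ite_eq hc ?_ <|
    Computable.ite_true (hs.comp hq)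
      (hA.mul.comp (hA.dpow x (Computable.fst.comp i3) (Computable.fst.comp i4))
        (hA.dpow y (Computable.fst.comp i5) (Computable.snd.comp i5)))
      (Computable.const _)
  split_ifs
  · exact hA.mul.comp (hA.dpow x (Computable.const _) (Computable.const _)) y
  · exact Computable.const _

end Ops.IsComputable

theorem BasisSpec.computable_sign {s : BasisSpec} (hs : Computable s.q) :
    Computable s.sign :=
  Computable.or (Primrec.nat_lt.decide.to_comp.comp Computable.fst (Computable.const 4))
    (Computable.not (hs.comp Computable.snd))

end Computability

/-! ### Gödel numbers of terms -/

/-- The operations on Gödel numbers of terms. -/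
def codeOps : Ops ℕ := ⟨Nat.pair 2 0, Nat.pair 3, fun s t => Nat.pair 4 (Nat.pair s t)⟩

theorem codeOps_isComputable : codeOps.IsComputable where
  inv := Computable.natPair (Computable.const 3) Computable.id
  mul := (Computable.natPair (Computable.const 4)
    (Computable.natPair Computable.fst Computable.snd)).to₂

/-- Numbers that are not the Gödel number of a compound term or of the constant `1`. -/
def IsAtomCode (k : ℕ) : Prop := k.unpair.1 ≠ 3 ∧ k.unpair.1 ≠ 4 ∧ k ≠ codeOps.one

theorem isAtomCode_pair_zero (a : ℕ) : IsAtomCode (Nat.pair 0 a) := by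
  simp [IsAtomCode, codeOps]

/-- Every number counts as a code: those with unused tags are atoms. The components of a compound
code are smaller than the code, so strong induction applies. -/
theorem code_induction {p : ℕ → Prop} (atom : ∀ k, IsAtomCode k → p k) (one : p codeOps.one)
    (inv : ∀ s, p s → p (codeOps.inv s)) (mul : ∀ s t, p s → p t → p (codeOps.mul s t))
    (k : ℕ) : p k := by
  induction k using Nat.strong_induction_on with
  | _ k ih =>
    by_cases h2 : k = codeOps.one
    · rw [h2]; exact one
    obtain ⟨⟨c, m⟩, rfl⟩ : ∃ x : ℕ × ℕ, Nat.pair x.1 x.2 = k := ⟨k.unpair, Nat.pair_unpair k⟩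
    have hle := Nat.add_le_pair c m
    by_cases h3 : c = 3
    · subst h3; exact inv m (ih m (by simp at hle ⊢; omega))
    by_cases h4 : c = 4
    · subst h4
      have h1 := Nat.unpair_left_le m
      have h2 := Nat.unpair_right_le m
      have := mul m.unpair.1 m.unpair.2 (ih _ (by simp at hle ⊢; omega))
        (ih _ (by simp at hle ⊢; omega))
      simpa [codeOps] using this
    · exact atom _ ⟨by simpa using h3, by simpa using h4, h2⟩

/-- Evaluation of the Gödel number of a term, given the values of the atomic ones. -/
def Ops.fold {α : Type*} (A : Ops α) (g : ℕ → α) (k : ℕ) : α :=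
  if _h : k.unpair.1 = 3 then A.inv (A.fold g k.unpair.2)
  else if _h : k.unpair.1 = 4 then
    A.mul (A.fold g k.unpair.2.unpair.1) (A.fold g k.unpair.2.unpair.2)
  else if k = codeOps.one then A.one
  else g k
termination_by k
decreasing_by
  all_goals
    have hle := Nat.add_le_pair k.unpair.1 k.unpair.2
    rw [Nat.pair_unpair] at hle
    have h1 := Nat.unpair_left_le k.unpair.2
    have h2 := Nat.unpair_right_le k.unpair.2
    omega

-- Evaluation of codes by recursion

section Fold

variable {α β : Type*} (A : Ops α) (g : ℕ → α)

theorem Ops.fold_atom {k : ℕ} (h : IsAtomCode k) : A.fold g k = g k := by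
  rw [Ops.fold]; simp [h.1, h.2.1, h.2.2]

theorem Ops.fold_hom : codeOps.Hom A (A.fold g) where
  one := by rw [Ops.fold]; simp [codeOps]
  inv s := by rw [Ops.fold]; simp [codeOps]
  mul s t := by rw [Ops.fold]; simp [codeOps]

@[simp] theorem Ops.fold_one : A.fold g codeOps.one = A.one := (A.fold_hom g).one

@[simp] theorem Ops.fold_inv (s : ℕ) : A.fold g (codeOps.inv s) = A.inv (A.fold g s) :=
  (A.fold_hom g).inv s

@[simp] theorem Ops.fold_mul (s t : ℕ) :
    A.fold g (codeOps.mul s t) = A.mul (A.fold g s) (A.fold g t) :=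
  (A.fold_hom g).mul s t

variable {A}

theorem Ops.Hom.fold {B : Ops β} {f : α → β} (h : A.Hom B f) (k : ℕ) :
    f (A.fold g k) = B.fold (f ∘ g) k := by
  induction k using code_induction with
  | atom k hk => rw [A.fold_atom g hk, B.fold_atom _ hk]; rfl
  | one => simp [h.one]
  | inv s ih => simp [h.inv, ih]
  | mul s t ihs iht => simp [h.mul, ihs, iht]

/-- This is course-of-values recursion. The step function receives the list of values at all smaller
codes, and the length of the list is the current code. -/
theorem Ops.IsComputable.fold {γ : Type*} [Primcodable γ] [Primcodable α]
    (hA : A.IsComputable) {g : γ → ℕ → α} (hg : Computable₂ g) :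
    Computable₂ fun c k => A.fold (g c) k := by
  let step : γ → List α → α := fun c l =>
    if l.length.unpair.1 = 3 then A.inv (l.getD l.length.unpair.2 A.one)
    else if l.length.unpair.1 = 4 then
      A.mul (l.getD l.length.unpair.2.unpair.1 A.one) (l.getD l.length.unpair.2.unpair.2 A.one)
    else if l.length = codeOps.one then A.one
    else g c l.length
  have hstep : Computable₂ step := by
    have hl : Computable fun p : γ × List α => p.2.length :=
      Computable.list_length.comp Computable.snd
    have hu := Computable.unpair.comp hl
    have hu1 := Computable.fst.comp hu
    have hu2 := Computable.snd.comp hu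
    have hv := Computable.unpair.comp hu2
    have hget : ∀ {f : γ × List α → ℕ}, Computable f →
        Computable fun p : γ × List α => p.2.getD (f p) A.one := fun hf =>
      (Primrec.list_getD A.one).to_comp.comp Computable.snd hf
    exact (Computable.ite_eq hu1 (hA.inv.comp (hget hu2)) <|
      Computable.ite_eq hu1 (hA.mul.comp (hget (Computable.fst.comp hv))
        (hget (Computable.snd.comp hv))) <|
      Computable.ite_eq hl (Computable.const _) (hg.comp Computable.fst hl)).to₂
  refine Computable.nat_strong_rec _ (g := fun c l => some (step c l))
    (Computable.option_some.comp hstep).to₂ fun c n => ?_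
  have hget : ∀ m, m < n →
      ((List.range n).map fun k => A.fold (g c) k).getD m A.one = A.fold (g c) m := by
    intro m hm
    simp [hm]
  have hle := Nat.add_le_pair n.unpair.1 n.unpair.2
  rw [Nat.pair_unpair] at hle
  have h1 := Nat.unpair_left_le n.unpair.2
  have h2 := Nat.unpair_right_le n.unpair.2
  simp only [step, List.length_map, List.length_range]
  conv_rhs => rw [Ops.fold]
  congr 1
  split_ifs with h3 h4
  · rw [hget _ (by omega)]
  · rw [hget _ (by omega), hget _ (by omega)]
  · rfl
  · rfl

end Fold


open FirstOrder Language

/-! ### The Scott sentence -/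

/-- The operations of a structure for the signature of groups. -/
def structOps (M : Type) [groupLang.Structure M] : Ops M where
  one := Structure.funMap (L := groupLang) GroupFunc.one Fin.elim0
  inv x := Structure.funMap (L := groupLang) GroupFunc.inv ![x]
  mul x y := Structure.funMap (L := groupLang) GroupFunc.mul ![x, y]

theorem structOps_group (G : Type) [Group G] : structOps G = groupOps G := rfl

def termOps (β : Type) : Ops (groupLang.Term β) where
  one := .func GroupFunc.one Fin.elim0
  inv x := .func GroupFunc.inv ![x]
  mul x y := .func GroupFunc.mul ![x, y]

theorem realize_hom {β M : Type} [groupLang.Structure M] (v : β → M) :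
    (termOps β).Hom (structOps M) (Term.realize v) where
  one := congrArg (Structure.funMap (L := groupLang) GroupFunc.one) (Subsingleton.elim _ _)
  inv x := congrArg (Structure.funMap (L := groupLang) GroupFunc.inv) (by
    ext i; fin_cases i; rfl)
  mul x y := congrArg (Structure.funMap (L := groupLang) GroupFunc.mul) (by
    ext i; fin_cases i <;> rfl)

theorem termCode_hom {α : Type} {n : ℕ} (ν : α → ℕ) :
    (termOps (α ⊕ Fin n)).Hom codeOps (termCode ν) where
  one := rfl
  inv _ := rfl
  mul _ _ := rfl

theorem nonempty_structEquiv_iff {M A : Type} [groupLang.Structure M] [groupLang.Structure A] :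
    Nonempty (M ≃[groupLang] A) ↔ ∃ f : M ≃ A, (structOps M).Hom (structOps A) f := by
  constructor
  · rintro ⟨f⟩
    refine ⟨f.toEquiv, ⟨?_, fun x => ?_, fun x y => ?_⟩⟩
    · exact (f.map_fun GroupFunc.one _).trans (congrArg _ (Subsingleton.elim _ _))
    · exact (f.map_fun GroupFunc.inv _).trans (congrArg _ (by ext i; fin_cases i; rfl))
    · exact (f.map_fun GroupFunc.mul _).trans (congrArg _ (by ext i; fin_cases i <;> rfl))
  · rintro ⟨f, hf⟩
    refine ⟨⟨f, fun {k} F x => ?_, fun R => nomatch R⟩⟩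
    change GroupFunc k at F
    cases F with
    | one =>
      rw [Subsingleton.elim x Fin.elim0, Subsingleton.elim (_ ∘ _) Fin.elim0]
      exact hf.one
    | inv =>
      have h : x = ![x 0] := by ext i; fin_cases i; rfl
      have h' : (f : M → A) ∘ ![x 0] = ![f (x 0)] := by ext i; fin_cases i; rfl
      rw [h]
      exact (hf.inv _).trans (congrArg (Structure.funMap (L := groupLang) GroupFunc.inv) h'.symm)
    | mul =>
      have h : x = ![x 0, x 1] := by ext i; fin_cases i <;> rfl
      have h' : (f : M → A) ∘ ![x 0, x 1] = ![f (x 0), f (x 1)] := by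
        ext i; fin_cases i <;> rfl
      rw [h]
      exact (hf.mul _ _).trans (congrArg (Structure.funMap (L := groupLang) GroupFunc.mul) h'.symm)

def axIndex (i : ℕ) : AxIndex :=
  (i.unpair.1, i.unpair.2.unpair.1, i.unpair.2.unpair.2.unpair.1,
    i.unpair.2.unpair.2.unpair.2.unpair.1, i.unpair.2.unpair.2.unpair.2.unpair.2.unpair.1,
    i.unpair.2.unpair.2.unpair.2.unpair.2.unpair.2)

theorem axIndex_surjective : Function.Surjective axIndex := by
  rintro ⟨a, b, c, d, e, f⟩
  exact ⟨Nat.pair a (Nat.pair b (Nat.pair c (Nat.pair d (Nat.pair e f)))), by simp [axIndex]⟩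

theorem computable_axIndex : Computable axIndex := by
  have h1 := Computable.unpair
  have h2 := h1.comp (Computable.snd.comp h1)
  have h3 := h1.comp (Computable.snd.comp h2)
  have h4 := h1.comp (Computable.snd.comp h3)
  have h5 := h1.comp (Computable.snd.comp h4)
  exact (Computable.fst.comp h1).pair <| (Computable.fst.comp h2).pair <|
    (Computable.fst.comp h3).pair <| (Computable.fst.comp h4).pair <|
    (Computable.fst.comp h5).pair (Computable.snd.comp h5)

-- The two halves of the sentence and their complexity

section Formulas

variable (s : BasisSpec)

abbrev FinVar (n : ℕ) (i : Fin n) : groupLang.Term (Empty ⊕ Fin n) := .var (.inr i)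

def axFormula {n : ℕ} (v : Vars (Fin n)) (i : AxIndex) : groupLang.BoundedFormula Empty n :=
  if s.sign i = true then
    .equal ((termOps _).lhs s (v.map (FinVar n)) i) ((termOps _).rhs s (v.map (FinVar n)) i)
  else (BoundedFormula.equal ((termOps _).lhs s (v.map (FinVar n)) i)
    ((termOps _).rhs s (v.map (FinVar n)) i)).imp .falsum

theorem axFormula_isQF {n : ℕ} (v : Vars (Fin n)) (i : AxIndex) : (axFormula s v i).IsQF := by
  rw [axFormula]
  split_ifs
  · exact (BoundedFormula.IsAtomic.equal _ _).isQF
  · exact (BoundedFormula.IsAtomic.equal _ _).isQF.imp .falsum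

theorem realize_axFormula {n : ℕ} (v : Vars (Fin n)) (i : AxIndex) {M : Type}
    [groupLang.Structure M] (w : Fin n → M) :
    (axFormula s v i).Realize (fun x : Empty => x.elim) w ↔ (structOps M).Holds s (v.map w) i := by
  have h1 := (realize_hom (Sum.elim (fun x : Empty => x.elim) w)).lhs s (v.map (FinVar n)) i
  have h2 := (realize_hom (Sum.elim (fun x : Empty => x.elim) w)).rhs s (v.map (FinVar n)) i
  rw [axFormula, Ops.Holds]
  split_ifs with h
  · rw [h]
    simp only [BoundedFormula.Realize, h1, h2, iff_true]; rfl
  · simp only [BoundedFormula.Realize, h1, h2, h, Bool.false_eq_true, iff_false]; rfl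

theorem formulaCode_axFormula {n : ℕ} (v : Vars (Fin n)) (i : AxIndex) (ν : Empty → ℕ) :
    formulaCode ν (axFormula s v i) =
      if s.sign i = true then
        Nat.pair 1 (Nat.pair (codeOps.lhs s (v.map fun j : Fin n => Nat.pair 1 j) i)
          (codeOps.rhs s (v.map fun j : Fin n => Nat.pair 1 j) i))
      else Nat.pair 2 (Nat.pair
        (Nat.pair 1 (Nat.pair (codeOps.lhs s (v.map fun j : Fin n => Nat.pair 1 j) i)
          (codeOps.rhs s (v.map fun j : Fin n => Nat.pair 1 j) i))) (Nat.pair 0 0)) := by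
  have h1 := (termCode_hom ν).lhs s (v.map (FinVar n)) i
  have h2 := (termCode_hom ν).rhs s (v.map (FinVar n)) i
  rw [axFormula]
  split_ifs
  · simp only [formulaCode, h1, h2]; rfl
  · simp only [formulaCode, h1, h2]; rfl

def basisMatrix (i : ℕ) : groupLang.BoundedFormula Empty (0 + 2 + 3) :=
  axFormula s ((0 : Fin 5), (1 : Fin 5), (2 : Fin 5), (3 : Fin 5), (4 : Fin 5)) (axIndex i)

/-- Variables `0`, `1` are the pair, `2` is the element to be generated, and `3`, `4`, `5` are the
auxiliary arguments of the axiom. The implication encodes "the axiom fails, or the element is the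
word". -/
def genMatrix (i : ℕ) : groupLang.BoundedFormula Empty (0 + 3 + 3) :=
  (axFormula s ((0 : Fin 6), (1 : Fin 6), (3 : Fin 6), (4 : Fin 6), (5 : Fin 6)) (axIndex i)).imp
    (.equal (FinVar 6 2) ((termOps _).normalWord (FinVar 6 0) (FinVar 6 1) (axIndex i)))

/-- Only one outer disjunct is needed; it is repeated along `ℕ` to have the prescribed `Σ₂` shape.
-/
def basisSentence : InfFormula 0 :=
  .disj fun _ => .exs 2 (.conj fun i => .alls 3 (.fin (basisMatrix s i)))

def genSentence : InfFormula 0 :=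
  .conj fun _ => .alls 3 (.disj fun i => .exs 3 (.fin (genMatrix s i)))

theorem basisSentence_isSigma : (basisSentence s).IsSigma 2 :=
  .disj 2 (fun _ => 2) (fun _ => 1) _ (fun _ => one_lt_two) fun _ =>
    .conj 1 (fun _ => 3) (fun _ => 0) _ (fun _ => one_pos) fun _ =>
      .zero _ (axFormula_isQF _ _ _)

theorem genSentence_isPi : (genSentence s).IsPi 2 :=
  .conj 2 (fun _ => 3) (fun _ => 1) _ (fun _ => one_lt_two) fun _ =>
    .disj 1 (fun _ => 3) (fun _ => 0) _ (fun _ => one_pos) fun _ =>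
      .zero _ ((axFormula_isQF _ _ _).imp (BoundedFormula.IsAtomic.equal _ _).isQF)

theorem realize_basisSentence (M : Type) [groupLang.Structure M] :
    (basisSentence s).Realize M Fin.elim0 ↔ (structOps M).HasBasis s := by
  simp only [basisSentence, InfFormula.Realize, basisMatrix, realize_axFormula, Vars.map]
  constructor
  · rintro ⟨_, y, hy⟩
    refine ⟨y 0, y 1, fun z₁ z₂ z₃ i => ?_⟩
    obtain ⟨i, rfl⟩ := axIndex_surjective i
    exact hy i ![z₁, z₂, z₃]
  · rintro ⟨x, y, h⟩
    exact ⟨0, ![x, y], fun i z => h (z 0) (z 1) (z 2) (axIndex i)⟩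

theorem realize_genSentence (M : Type) [groupLang.Structure M] :
    (genSentence s).Realize M Fin.elim0 ↔ (structOps M).BasisGenerates s := by
  have hw : ∀ (i : ℕ) (w : Fin 6 → M), (genMatrix s i).Realize (fun x : Empty => x.elim) w ↔
      (¬ (structOps M).Holds s (w 0, w 1, w 3, w 4, w 5) (axIndex i) ∨
        w 2 = (structOps M).normalWord (w 0) (w 1) (axIndex i)) := by
    intro i w
    have h1 := (realize_hom (Sum.elim (fun x : Empty => x.elim) w)).normalWord
      (FinVar 6 0) (FinVar 6 1) (axIndex i)
    have h2 := realize_axFormula s ((0 : Fin 6), (1 : Fin 6), (3 : Fin 6), (4 : Fin 6), (5 : Fin 6))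
      (axIndex i) w
    rw [← imp_iff_not_or]
    exact imp_congr h2 (by
      simp only [BoundedFormula.Realize]
      exact iff_of_eq (congrArg₂ Eq rfl h1))
  simp only [genSentence, InfFormula.Realize]
  constructor
  · intro h x y w
    obtain ⟨i, z, hz⟩ := h 0 ![x, y, w]
    exact ⟨axIndex i, z 0, z 1, z 2, (hw i _).1 hz⟩
  · intro h _ y
    obtain ⟨i, z₁, z₂, z₃, hz⟩ := h (y 0) (y 1) (y 2)
    obtain ⟨i, rfl⟩ := axIndex_surjective i
    exact ⟨i, ![z₁, z₂, z₃], (hw i _).2 hz⟩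

end Formulas

/-- The unbounded search for a preimage of `x` halts exactly on the range of `g`. -/
theorem exists_ceSet_eq_range {g : ℕ → ℕ} (hg : Computable g) : ∃ c, ceSet c = Set.range g := by
  let f : ℕ →. ℕ := fun x => Nat.rfind fun i => Part.some (decide (g i = x))
  have hf : Partrec f := Partrec.rfind (Computable.decide_eq (hg.comp Computable.snd)
    Computable.fst).partrec.to₂
  obtain ⟨c, hc⟩ := Nat.Partrec.Code.exists_code.1 (Partrec.nat_iff.1 hf)
  refine ⟨Encodable.encode c, ?_⟩
  ext x
  have : phi (Encodable.encode c) = f := by rw [phi, Denumerable.ofNat_encode, hc]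
  change (phi (Encodable.encode c) x).Dom ↔ _
  rw [this]
  refine Nat.rfind_dom'.trans ⟨?_, ?_⟩
  · rintro ⟨i, hi, -⟩
    exact ⟨i, by simpa using hi⟩
  · rintro ⟨i, hi⟩
    exact ⟨i, by simpa using hi, fun _ => trivial⟩

theorem InfFormula.HasIndex.disj {n : ℕ} {f : ℕ → InfFormula n} {g : ℕ → ℕ} (hg : Computable g)
    (h : ∀ i, (f i).HasIndex (g i)) : ∃ e, (InfFormula.disj f).HasIndex e := by
  obtain ⟨c, hc⟩ := exists_ceSet_eq_range hg
  refine ⟨Nat.pair 5 c, c, rfl, ?_, fun i => ⟨g i, by rw [hc]; exact ⟨i, rfl⟩, h i⟩⟩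
  rw [hc]
  rintro _ ⟨i, rfl⟩
  exact ⟨i, h i⟩

theorem InfFormula.HasIndex.conj {n : ℕ} {f : ℕ → InfFormula n} {g : ℕ → ℕ} (hg : Computable g)
    (h : ∀ i, (f i).HasIndex (g i)) : ∃ e, (InfFormula.conj f).HasIndex e := by
  obtain ⟨c, hc⟩ := exists_ceSet_eq_range hg
  refine ⟨Nat.pair 6 c, c, rfl, ?_, fun i => ⟨g i, by rw [hc]; exact ⟨i, rfl⟩, h i⟩⟩
  rw [hc]
  rintro _ ⟨i, rfl⟩
  exact ⟨i, h i⟩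

-- Computable indices for the two halves

section Index

variable {s : BasisSpec} (hs : Computable s.q)
include hs

theorem computable_axFormula_code {n : ℕ} (v : Vars (Fin n)) (ν : Empty → ℕ) :
    Computable fun i => formulaCode ν (axFormula s v (axIndex i)) := by
  simp only [formulaCode_axFormula]
  have hA := codeOps_isComputable
  have hl := hA.lhs hs (Computable.const (v.map fun j : Fin n => Nat.pair 1 j)) computable_axIndex
  have hr := hA.rhs hs (Computable.const (v.map fun j : Fin n => Nat.pair 1 j)) computable_axIndex
  have he := (Computable.const 1).natPair (hl.natPair hr)
  exact Computable.ite_true ((BasisSpec.computable_sign hs).comp computable_axIndex) he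
    ((Computable.const 2).natPair (he.natPair (Computable.const _)))

theorem basisSentence_hasIndex : ∃ e, (basisSentence s).HasIndex e := by
  obtain ⟨c, hc⟩ := InfFormula.HasIndex.conj
    (f := fun i => .alls (n := 0 + 2) 3 (.fin (basisMatrix s i)))
    ((Computable.const 4).natPair ((Computable.const 3).natPair ((Computable.const 0).natPair
      (computable_axFormula_code hs _ _)))) fun i => ⟨_, rfl, rfl⟩
  exact InfFormula.HasIndex.disj (Computable.const (Nat.pair 3 (Nat.pair 2 c)))
    fun i => ⟨c, rfl, hc⟩

theorem genSentence_hasIndex : ∃ e, (genSentence s).HasIndex e := by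
  have hA := codeOps_isComputable
  have hcode : Computable fun i => formulaCode (fun x : Empty => x.elim) (genMatrix s i) := by
    have hw := hA.normalWord (Computable.const (Nat.pair 1 0)) (Computable.const (Nat.pair 1 1))
      computable_axIndex
    refine ((Computable.const 2).natPair ((computable_axFormula_code hs
      ((0 : Fin 6), (1 : Fin 6), (3 : Fin 6), (4 : Fin 6), (5 : Fin 6)) (fun x => x.elim)).natPair
      ((Computable.const 1).natPair ((Computable.const (Nat.pair 1 2)).natPair hw)))).of_eq
      fun i => ?_
    have := (termCode_hom (fun x : Empty => x.elim)).normalWord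
      (FinVar 6 0) (FinVar 6 1) (axIndex i)
    simp only [genMatrix, formulaCode]
    rw [this]
    rfl
  obtain ⟨c, hc⟩ := InfFormula.HasIndex.disj
    (f := fun i => .exs (n := 0 + 3) 3 (.fin (genMatrix s i)))
    ((Computable.const 3).natPair ((Computable.const 3).natPair ((Computable.const 0).natPair
      hcode))) fun i => ⟨_, rfl, rfl⟩
  exact InfFormula.HasIndex.conj (Computable.const (Nat.pair 4 (Nat.pair 3 c)))
    fun i => ⟨c, rfl, hc⟩

end Index

theorem ScottPair.exists_structEquiv_iff {G : Type} [Group G] {s : BasisSpec} (hs : s.Coherent)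
    {a b : G} (h : ScottPair G s.N (s.P = true) s.Q a b) (M : Type) [groupLang.Structure M] :
    Nonempty (M ≃[groupLang] G) ↔ (structOps M).HasBasis s ∧ (structOps M).BasisGenerates s := by
  rw [nonempty_structEquiv_iff, h.exists_equiv_iff hs, structOps_group]

theorem ScottPair.exists_scottSentence {G : Type} [Group G] {s : BasisSpec} (hs : s.Coherent)
    (hq : Computable s.q) {a b : G} (h : ScottPair G s.N (s.P = true) s.Q a b) :
    ∃ φ : InfFormula 0, φ.IsDSigma 2 ∧ φ.IsComputable ∧ IsScottSentence φ G := by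
  refine ⟨(basisSentence s).and (genSentence s),
    ⟨_, _, basisSentence_isSigma s, genSentence_isPi s, rfl⟩, ?_, ?_⟩
  · obtain ⟨c, hc⟩ := basisSentence_hasIndex hq
    obtain ⟨d, hd⟩ := genSentence_hasIndex hq
    exact ⟨_, c, d, rfl, hc, hd⟩
  · intro M _ _
    rw [h.exists_structEquiv_iff hs, ← realize_basisSentence, ← realize_genSentence]
    rfl

end ScottBS

namespace ScottBS


open FirstOrder Language

/-! ### Atomic diagrams -/

def eqCode (s t : ℕ) : ℕ := Nat.pair 1 (Nat.pair s t)
def negCode (k : ℕ) : ℕ := Nat.pair 2 (Nat.pair k (Nat.pair 0 0))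
def cstCode (u : ℕ) : ℕ := Nat.pair 0 u

def propOps : Ops Prop := ⟨True, id, And⟩

/-- `k` is the Gödel number of a closed term with constants from `U`. -/
def IsTermCode (U : Set ℕ) (k : ℕ) : Prop :=
  propOps.fold (fun k => k.unpair.1 = 0 ∧ k.unpair.2 ∈ U) k

open Classical in
/-- The value of a closed term with constants from `U`. -/
noncomputable def termVal {U : Set ℕ} (A : Ops U) (k : ℕ) : U :=
  A.fold (fun k => if h : k.unpair.2 ∈ U then ⟨k.unpair.2, h⟩ else A.one) k

-- Codes of closed terms, their values, and the diagram

section TermCode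

variable {U : Set ℕ} {A : Ops U}

theorem isTermCode_atom {k : ℕ} (h : IsAtomCode k) :
    IsTermCode U k ↔ k.unpair.1 = 0 ∧ k.unpair.2 ∈ U := by
  rw [IsTermCode, propOps.fold_atom _ h]

@[simp] theorem isTermCode_cst {u : ℕ} : IsTermCode U (cstCode u) ↔ u ∈ U := by
  rw [cstCode, isTermCode_atom (isAtomCode_pair_zero u)]; simp

@[simp] theorem isTermCode_one : IsTermCode U codeOps.one := by
  rw [IsTermCode, Ops.fold_one]; trivial

@[simp] theorem isTermCode_inv {s : ℕ} : IsTermCode U (codeOps.inv s) ↔ IsTermCode U s := by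
  rw [IsTermCode, Ops.fold_inv]; rfl

@[simp] theorem isTermCode_mul {s t : ℕ} :
    IsTermCode U (codeOps.mul s t) ↔ IsTermCode U s ∧ IsTermCode U t := by
  rw [IsTermCode, Ops.fold_mul]; rfl

theorem termVal_hom : codeOps.Hom A (termVal A) := A.fold_hom _

@[simp] theorem termVal_cst (u : U) : termVal A (cstCode u) = u := by
  rw [termVal, cstCode, A.fold_atom _ (isAtomCode_pair_zero _)]; simp

@[simp] theorem termVal_inv {s : ℕ} : termVal A (codeOps.inv s) = A.inv (termVal A s) :=
  termVal_hom.inv s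

@[simp] theorem termVal_mul {s t : ℕ} :
    termVal A (codeOps.mul s t) = A.mul (termVal A s) (termVal A t) :=
  termVal_hom.mul s t

theorem exists_term_of_isTermCode {k : ℕ} (h : IsTermCode U k) :
    ∃ s : groupLang.Term (U ⊕ Fin 0), termCode Subtype.val s = k := by
  induction k using code_induction with
  | atom k hk =>
    obtain ⟨h0, h1⟩ := (isTermCode_atom hk).1 h
    refine ⟨.var (.inl ⟨_, h1⟩), ?_⟩
    rw [termCode, ← h0, Nat.pair_unpair]
  | one => exact ⟨_, (termCode_hom Subtype.val).one⟩
  | inv s ih =>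
    obtain ⟨s, rfl⟩ := ih (isTermCode_inv.1 h)
    exact ⟨_, (termCode_hom Subtype.val).inv s⟩
  | mul s t ihs iht =>
    obtain ⟨s, rfl⟩ := ihs (isTermCode_mul.1 h).1
    obtain ⟨t, rfl⟩ := iht (isTermCode_mul.1 h).2
    exact ⟨_, (termCode_hom Subtype.val).mul s t⟩

theorem termCode_spec [groupLang.Structure U] (s : groupLang.Term (U ⊕ Fin 0)) (xs : Fin 0 → U) :
    IsTermCode U (termCode Subtype.val s) ∧
      termVal (structOps U) (termCode Subtype.val s) = s.realize (Sum.elim id xs) := by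
  induction s with
  | var x =>
    rcases x with u | i
    · exact ⟨isTermCode_cst.2 u.2, termVal_cst u⟩
    · exact i.elim0
  | func f ts ih =>
    rename_i n
    change GroupFunc n at f
    cases f with
    | one =>
      refine ⟨isTermCode_one, ?_⟩
      exact termVal_hom.one.trans (congrArg (Structure.funMap (L := groupLang) GroupFunc.one)
        (Subsingleton.elim _ _))
    | inv =>
      refine ⟨isTermCode_inv.2 (ih 0).1, ?_⟩
      refine (termVal_inv.trans (congrArg _ (ih 0).2)).trans
        (congrArg (Structure.funMap (L := groupLang) GroupFunc.inv) ?_)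
      ext i; fin_cases i; rfl
    | mul =>
      refine ⟨isTermCode_mul.2 ⟨(ih 0).1, (ih 1).1⟩, ?_⟩
      refine (termVal_mul.trans (congrArg₂ _ (ih 0).2 (ih 1).2)).trans
        (congrArg (Structure.funMap (L := groupLang) GroupFunc.mul) ?_)
      ext i; fin_cases i <;> rfl

/-- The atomic diagram in terms of Gödel numbers. -/
def opsDiagram (A : Ops U) : Set ℕ :=
  {k | ∃ s t, IsTermCode U s ∧ IsTermCode U t ∧
    ((k = eqCode s t ∧ termVal A s = termVal A t) ∨
      (k = negCode (eqCode s t) ∧ termVal A s ≠ termVal A t))}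

theorem atomicDiagram_eq [groupLang.Structure U] :
    atomicDiagram U = opsDiagram (structOps U) := by
  ext k
  constructor
  · rintro ⟨φ, ψ, hψ, hφ, hr, rfl⟩
    cases hψ with
    | rel R => exact nomatch R
    | equal s t =>
      have hs := termCode_spec s default
      have ht := termCode_spec t default
      refine ⟨_, _, hs.1, ht.1, ?_⟩
      rw [hs.2, ht.2]
      rcases hφ with rfl | rfl
      · exact Or.inl ⟨rfl, hr⟩
      · exact Or.inr ⟨rfl, hr⟩
  · rintro ⟨s, t, hs, ht, h⟩
    obtain ⟨s, rfl⟩ := exists_term_of_isTermCode hs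
    obtain ⟨t, rfl⟩ := exists_term_of_isTermCode ht
    rw [(termCode_spec s default).2, (termCode_spec t default).2] at h
    rcases h with ⟨rfl, h⟩ | ⟨rfl, h⟩
    · exact ⟨s.bdEqual t, _, .equal _ _, Or.inl rfl, h, rfl⟩
    · exact ⟨(s.bdEqual t).not, _, .equal _ _, Or.inr rfl, h, rfl⟩

theorem eqCode_mem_opsDiagram {s t : ℕ} :
    eqCode s t ∈ opsDiagram A ↔ IsTermCode U s ∧ IsTermCode U t ∧ termVal A s = termVal A t := by
  constructor
  · rintro ⟨s', t', hs, ht, ⟨h, h'⟩ | ⟨h, -⟩⟩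
    · obtain ⟨rfl, rfl⟩ : s = s' ∧ t = t' := by simpa [eqCode] using h
      exact ⟨hs, ht, h'⟩
    · simp [eqCode, negCode] at h
  · rintro ⟨hs, ht, h⟩
    exact ⟨s, t, hs, ht, Or.inl ⟨rfl, h⟩⟩

theorem negCode_mem_opsDiagram {s t : ℕ} :
    negCode (eqCode s t) ∈ opsDiagram A ↔
      IsTermCode U s ∧ IsTermCode U t ∧ termVal A s ≠ termVal A t := by
  constructor
  · rintro ⟨s', t', hs, ht, ⟨h, -⟩ | ⟨h, h'⟩⟩
    · simp [eqCode, negCode] at h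
    · obtain ⟨rfl, rfl⟩ : s = s' ∧ t = t' := by simpa [eqCode, negCode] using h
      exact ⟨hs, ht, h'⟩
  · rintro ⟨hs, ht, h⟩
    exact ⟨s, t, hs, ht, Or.inr ⟨rfl, h⟩⟩

end TermCode

/-- A structure with given operations. -/
abbrev Ops.toStructure {M : Type} (A : Ops M) : groupLang.Structure M where
  funMap := fun f x =>
    match f with
    | .one => A.one
    | .inv => A.inv (x 0)
    | .mul => A.mul (x 0) (x 1)
  RelMap := fun r _ => nomatch r

theorem mem_indexSet_iff {G : Type} [Group G] {e : ℕ} :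
    e ∈ indexSet G ↔ ∃ (U : Set ℕ) (A : Ops U), (∃ f : U ≃ G, A.Hom (groupOps G) f) ∧
      ∀ k, (k ∈ opsDiagram A → phi e k = Part.some 1) ∧
        (k ∉ opsDiagram A → phi e k = Part.some 0) := by
  constructor
  · rintro ⟨U, _, h, hk⟩
    rw [atomicDiagram_eq] at hk
    exact ⟨U, structOps U, nonempty_structEquiv_iff.1 h, hk⟩
  · rintro ⟨U, A, h, hk⟩
    let _ := A.toStructure
    refine ⟨U, A.toStructure, nonempty_structEquiv_iff.2 h, ?_⟩
    rw [atomicDiagram_eq]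
    exact hk

/-- Structures with the same atomic diagram are isomorphic. -/
theorem exists_hom_of_opsDiagram_eq {U V : Set ℕ} {A : Ops U} {B : Ops V}
    (h : opsDiagram A = opsDiagram B) : ∃ f : U ≃ V, A.Hom B f := by
  -- The diagram determines the universe: `u = u` belongs to it exactly when `u` is an element.
  have hU : ∀ u, u ∈ U ↔ u ∈ V := fun u => by
    have := Set.ext_iff.1 h (eqCode (cstCode u) (cstCode u))
    simpa [eqCode_mem_opsDiagram] using this
  obtain rfl : U = V := Set.ext hU
  refine ⟨Equiv.refl _, ?_, fun x => ?_, fun x y => ?_⟩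
  · have := Set.ext_iff.1 h (eqCode codeOps.one (cstCode A.one))
    simp only [eqCode_mem_opsDiagram, isTermCode_one, isTermCode_cst, Subtype.coe_prop,
      termVal_cst, termVal_hom.one, true_and, true_iff] at this
    exact this.symm
  · have := Set.ext_iff.1 h (eqCode (codeOps.inv (cstCode x)) (cstCode (A.inv x)))
    simp only [eqCode_mem_opsDiagram, isTermCode_inv, isTermCode_cst, Subtype.coe_prop,
      termVal_cst, termVal_inv, true_and, true_iff] at this
    exact this.symm
  · have := Set.ext_iff.1 h (eqCode (codeOps.mul (cstCode x) (cstCode y)) (cstCode (A.mul x y)))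
    simp only [eqCode_mem_opsDiagram, isTermCode_mul, isTermCode_cst, Subtype.coe_prop,
      termVal_cst, termVal_mul, true_and, true_iff] at this
    exact this.symm

/-- The closure conditions that characterise atomic diagrams. -/
structure IsDiagram (D : Set ℕ) : Prop where
  cst : ∀ u v, eqCode (cstCode v) (cstCode u) ∈ D → u = v
  mem : ∀ s u, eqCode s (cstCode u) ∈ D → eqCode (cstCode u) (cstCode u) ∈ D
  uniq : ∀ s u v, eqCode s (cstCode u) ∈ D → eqCode s (cstCode v) ∈ D → u = v
  one : ∃ u, eqCode codeOps.one (cstCode u) ∈ D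
  inv_ex : ∀ u, eqCode (cstCode u) (cstCode u) ∈ D →
    ∃ v, eqCode (codeOps.inv (cstCode u)) (cstCode v) ∈ D
  mul_ex : ∀ u v, eqCode (cstCode u) (cstCode u) ∈ D → eqCode (cstCode v) (cstCode v) ∈ D →
    ∃ w, eqCode (codeOps.mul (cstCode u) (cstCode v)) (cstCode w) ∈ D
  inv_of : ∀ s u, eqCode (codeOps.inv s) (cstCode u) ∈ D →
    ∃ v, eqCode s (cstCode v) ∈ D
  inv : ∀ s u v, eqCode s (cstCode v) ∈ D → eqCode (codeOps.inv (cstCode v)) (cstCode u) ∈ D →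
    eqCode (codeOps.inv s) (cstCode u) ∈ D
  mul_of : ∀ s t u, eqCode (codeOps.mul s t) (cstCode u) ∈ D →
    ∃ v w, eqCode s (cstCode v) ∈ D ∧ eqCode t (cstCode w) ∈ D
  mul : ∀ s t u v w, eqCode s (cstCode v) ∈ D → eqCode t (cstCode w) ∈ D →
    eqCode (codeOps.mul (cstCode v) (cstCode w)) (cstCode u) ∈ D →
    eqCode (codeOps.mul s t) (cstCode u) ∈ D
  atom : ∀ s u, eqCode s (cstCode u) ∈ D →
    s.unpair.1 = 0 ∨ s.unpair.1 = 3 ∨ s.unpair.1 = 4 ∨ s = codeOps.one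
  cases : ∀ k, k ∈ D → ∃ s t u v, eqCode s (cstCode u) ∈ D ∧ eqCode t (cstCode v) ∈ D ∧
    ((k = eqCode s t ∧ u = v) ∨ (k = negCode (eqCode s t) ∧ u ≠ v))
  eq : ∀ s t u, eqCode s (cstCode u) ∈ D → eqCode t (cstCode u) ∈ D → eqCode s t ∈ D
  ne : ∀ s t u v, eqCode s (cstCode u) ∈ D → eqCode t (cstCode v) ∈ D →
    u = v ∨ negCode (eqCode s t) ∈ D

theorem eqCode_cst_mem_opsDiagram {U : Set ℕ} {A : Ops U} {s u : ℕ} :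
    eqCode s (cstCode u) ∈ opsDiagram A ↔ IsTermCode U s ∧ u = termVal A s := by
  rw [eqCode_mem_opsDiagram]
  constructor
  · rintro ⟨hs, hu, h⟩
    refine ⟨hs, ?_⟩
    rw [h, termVal_cst ⟨u, isTermCode_cst.1 hu⟩]
  · rintro ⟨hs, rfl⟩
    exact ⟨hs, isTermCode_cst.2 (Subtype.coe_prop _), (termVal_cst _).symm⟩

theorem isDiagram_opsDiagram {U : Set ℕ} (A : Ops U) : IsDiagram (opsDiagram A) := by
  constructor <;> simp only [eqCode_cst_mem_opsDiagram] <;>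
    try simp only [isTermCode_cst, isTermCode_inv, isTermCode_mul, isTermCode_one,
      eqCode_mem_opsDiagram, negCode_mem_opsDiagram, termVal_inv, termVal_mul, true_and]
  · rintro u v ⟨hv, h⟩
    rw [h, termVal_cst ⟨v, hv⟩]
  · rintro s u ⟨hs, rfl⟩
    exact ⟨Subtype.coe_prop _, by rw [termVal_cst]⟩
  · rintro s u v ⟨-, rfl⟩ ⟨-, rfl⟩
    rfl
  · exact ⟨_, rfl⟩
  · rintro u ⟨hu, -⟩
    exact ⟨_, hu, rfl⟩
  · rintro u v ⟨hu, -⟩ ⟨hv, -⟩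
    exact ⟨_, ⟨hu, hv⟩, rfl⟩
  · rintro s u ⟨hs, -⟩
    exact ⟨_, hs, rfl⟩
  · rintro s u v ⟨hs, rfl⟩ ⟨-, rfl⟩
    exact ⟨hs, by rw [termVal_cst]⟩
  · rintro s t u ⟨⟨hs, ht⟩, -⟩
    exact ⟨_, _, ⟨hs, rfl⟩, ht, rfl⟩
  · rintro s t u v w ⟨hs, rfl⟩ ⟨ht, rfl⟩ ⟨-, rfl⟩
    exact ⟨⟨hs, ht⟩, by rw [termVal_cst, termVal_cst]⟩
  · rintro s u ⟨hs, -⟩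
    by_contra! hc
    exact hc.1 ((isTermCode_atom ⟨hc.2.1, hc.2.2.1, hc.2.2.2⟩).1 hs).1
  · rintro k ⟨s, t, hs, ht, h⟩
    refine ⟨s, t, _, _, ⟨hs, rfl⟩, ⟨ht, rfl⟩, ?_⟩
    rwa [Ne, ← Subtype.ext_iff]
  · rintro s t u ⟨hs, h⟩ ⟨ht, h'⟩
    exact ⟨hs, ht, Subtype.ext (h.symm.trans h')⟩
  · rintro s t u v ⟨hs, h⟩ ⟨ht, h'⟩
    by_cases huv : u = v
    · exact Or.inl huv
    · refine Or.inr ⟨hs, ht, fun hc => huv ?_⟩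
      rw [h, h', hc]

/-- The universe consists of the constants with `u = u` in `D`, and the operations are read off the
equations between a single operation on constants and a constant. Induction on terms then shows that
`D` equates a term with a constant exactly when that constant is its value. -/
theorem IsDiagram.exists_ops {D : Set ℕ} (h : IsDiagram D) :
    ∃ (U : Set ℕ) (A : Ops U), D = opsDiagram A := by
  let U : Set ℕ := {u | eqCode (cstCode u) (cstCode u) ∈ D}
  obtain ⟨o, ho⟩ := h.one
  have hinv : ∀ u : U, ∃ v : U, eqCode (codeOps.inv (cstCode u)) (cstCode v) ∈ D := fun u =>
    let ⟨v, hv⟩ := h.inv_ex u u.2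
    ⟨⟨v, h.mem _ _ hv⟩, hv⟩
  have hmul : ∀ u v : U, ∃ w : U,
      eqCode (codeOps.mul (cstCode u) (cstCode v)) (cstCode w) ∈ D := fun u v =>
    let ⟨w, hw⟩ := h.mul_ex u v u.2 v.2
    ⟨⟨w, h.mem _ _ hw⟩, hw⟩
  choose inv hinv using hinv
  choose mul hmul using hmul
  let A : Ops U := ⟨⟨o, h.mem _ _ ho⟩, inv, mul⟩
  refine ⟨U, A, ?_⟩
  have key₁ : ∀ s, IsTermCode U s → eqCode s (cstCode (termVal A s)) ∈ D := by
    intro s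
    induction s using code_induction with
    | atom k hk =>
      intro hs
      obtain ⟨h0, h1⟩ := (isTermCode_atom hk).1 hs
      obtain ⟨u, rfl⟩ : ∃ u, k = cstCode u := ⟨k.unpair.2, by
        rw [cstCode, ← h0, Nat.pair_unpair]⟩
      simp only [cstCode, Nat.unpair_pair] at h1
      rw [termVal_cst ⟨u, h1⟩]
      exact h1
    | one => 
      intro _
      rw [termVal_hom.one]
      exact ho
    | inv s ih =>
      intro hs
      rw [termVal_inv]
      exact h.inv _ _ _ (ih (isTermCode_inv.1 hs)) (hinv _)
    | mul s t ihs iht =>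
      intro hst
      rw [termVal_mul]
      exact h.mul _ _ _ _ _ (ihs (isTermCode_mul.1 hst).1) (iht (isTermCode_mul.1 hst).2)
        (hmul _ _)
  -- Conversely, anything to which `D` assigns a constant value is a genuine closed term: the
  -- clauses `inv_of` and `mul_of` descend to subterms, and `atom` excludes junk tags.
  have key₂ : ∀ s u, eqCode s (cstCode u) ∈ D → IsTermCode U s := by
    intro s
    induction s using code_induction with
    | atom k hk =>
      intro u hu
      rw [isTermCode_atom hk]
      rcases h.atom _ _ hu with h0 | h0 | h0 | h0
      · refine ⟨h0, ?_⟩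
        obtain ⟨v, rfl⟩ : ∃ v, k = cstCode v := ⟨k.unpair.2, by
          rw [cstCode, ← h0, Nat.pair_unpair]⟩
        obtain rfl := h.cst _ _ hu
        simpa [cstCode, U] using hu
      · exact absurd h0 hk.1
      · exact absurd h0 hk.2.1
      · exact absurd h0 hk.2.2
    | one => exact fun _ _ => isTermCode_one
    | inv s ih =>
      intro u hu
      obtain ⟨v, hv⟩ := h.inv_of _ _ hu
      exact isTermCode_inv.2 (ih v hv)
    | mul s t ihs iht =>
      intro u hu
      obtain ⟨v, w, hv, hw⟩ := h.mul_of _ _ _ hu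
      exact isTermCode_mul.2 ⟨ihs v hv, iht w hw⟩
  have key₃ : ∀ s u, eqCode s (cstCode u) ∈ D → u = termVal A s := fun s u hu =>
    h.uniq _ _ _ hu (key₁ s (key₂ s u hu))
  ext k
  constructor
  · intro hk
    obtain ⟨s, t, u, v, hu, hv, hk⟩ := h.cases k hk
    refine ⟨s, t, key₂ _ _ hu, key₂ _ _ hv, ?_⟩
    rwa [key₃ _ _ hu, key₃ _ _ hv, Ne, ← Subtype.ext_iff] at hk
  · rintro ⟨s, t, hs, ht, ⟨rfl, he⟩ | ⟨rfl, he⟩⟩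
    · exact h.eq _ _ _ (key₁ s hs) (he ▸ key₁ t ht)
    · exact (h.ne _ _ _ _ (key₁ s hs) (key₁ t ht)).resolve_left fun hc => he (Subtype.ext hc)

end ScottBS

namespace ScottBS

/-! ### Semidecidable predicates -/

/-- Predicates of the form `∃ s, f a s` with `f` computable. -/
def SemiDec {α : Type*} [Primcodable α] (p : α → Prop) : Prop :=
  ∃ f : α → ℕ → Bool, Computable₂ f ∧ ∀ a, p a ↔ ∃ s, f a s = true

namespace SemiDec

variable {α β : Type*} [Primcodable α] [Primcodable β] {p q : α → Prop}

theorem of_bool {f : α → Bool} (hf : Computable f) (h : ∀ a, p a ↔ f a = true) : SemiDec p :=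
  ⟨fun a _ => f a, (hf.comp Computable.fst).to₂, fun a => by simp [h]⟩

theorem eq {f g : α → ℕ} (hf : Computable f) (hg : Computable g) : SemiDec fun a => f a = g a :=
  of_bool (Computable.decide_eq hf hg) fun a => by simp

theorem ne {f g : α → ℕ} (hf : Computable f) (hg : Computable g) : SemiDec fun a => f a ≠ g a :=
  of_bool (Computable.not (Computable.decide_eq hf hg)) fun a => by simp

theorem and (hp : SemiDec p) (hq : SemiDec q) : SemiDec fun a => p a ∧ q a := by
  obtain ⟨f, hf, hf'⟩ := hp
  obtain ⟨g, hg, hg'⟩ := hq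
  have hu := Computable.unpair.comp (Computable.snd (α := α) (β := ℕ))
  refine ⟨fun a s => f a s.unpair.1 && g a s.unpair.2,
    (Computable.and (hf.comp Computable.fst (Computable.fst.comp hu))
      (hg.comp Computable.fst (Computable.snd.comp hu))).to₂, fun a => ?_⟩
  simp only [hf', hg']
  constructor
  · rintro ⟨⟨s, hs⟩, t, ht⟩
    exact ⟨Nat.pair s t, by simp [hs, ht]⟩
  · rintro ⟨s, hs⟩
    rw [Bool.and_eq_true] at hs
    exact ⟨⟨_, hs.1⟩, _, hs.2⟩

theorem or (hp : SemiDec p) (hq : SemiDec q) : SemiDec fun a => p a ∨ q a := by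
  obtain ⟨f, hf, hf'⟩ := hp
  obtain ⟨g, hg, hg'⟩ := hq
  refine ⟨fun a s => f a s || g a s, (Computable.or hf hg).to₂, fun a => ?_⟩
  simp only [hf', hg', Bool.or_eq_true, exists_or]

/-- The stage codes a candidate witness together with a stage at which it is confirmed. -/
theorem ex {p : α → β → Prop} (hp : SemiDec fun x : α × β => p x.1 x.2) :
    SemiDec fun a => ∃ b, p a b := by
  obtain ⟨f, hf, hf'⟩ := hp
  have hu := Computable.unpair.comp (Computable.snd (α := α) (β := ℕ))
  let F : α × ℕ → Bool := fun x =>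
    Option.casesOn (motive := fun _ => Bool) (Encodable.decode (α := β) x.2.unpair.1) false
      fun b => f (x.1, b) x.2.unpair.2
  have hF : Computable F := by
    refine Computable.option_casesOn
      ((Computable.decode (α := β)).comp (Computable.fst.comp hu)) (Computable.const false) ?_
    exact (hf.comp ((Computable.fst.comp Computable.fst).pair Computable.snd)
      (Computable.snd.comp (hu.comp Computable.fst))).to₂
  refine ⟨fun a s => F (a, s), hF.to₂, fun a => ?_⟩
  constructor
  · rintro ⟨b, hb⟩
    obtain ⟨s, hs⟩ := (hf' (a, b)).1 hb
    exact ⟨Nat.pair (Encodable.encode b) s, by simpa [F] using hs⟩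
  · rintro ⟨s, hs⟩
    cases hd : Encodable.decode (α := β) s.unpair.1 with
    | none => simp [F, hd] at hs
    | some b =>
      simp only [F, hd] at hs
      exact ⟨b, (hf' (a, b)).2 ⟨_, hs⟩⟩

theorem mem_phi {e k v : α → ℕ} (he : Computable e) (hk : Computable k) (hv : Computable v) :
    SemiDec fun a => v a ∈ phi (e a) (k a) := by
  refine ⟨fun a s => decide (Nat.Partrec.Code.evaln s (Denumerable.ofNat _ (e a)) (k a) =
    some (v a)), ?_, fun a => ?_⟩
  · have h1 : Computable fun x : α × ℕ =>
        Nat.Partrec.Code.evaln x.2 (Denumerable.ofNat _ (e x.1)) (k x.1) :=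
      Nat.Partrec.Code.primrec_evaln.to_comp.comp
        ((Computable.snd.pair ((Computable.ofNat _).comp (he.comp Computable.fst))).pair
          (hk.comp Computable.fst))
    exact ((Primrec.eq (α := Option ℕ)).decide.to_comp.comp h1
      (Computable.option_some.comp (hv.comp Computable.fst))).to₂
  · simp only [decide_eq_true_eq]
    exact Nat.Partrec.Code.evaln_complete

end SemiDec

/-- The failure of a semidecidable property is `Π₁`. Numbers that code no element of `β` are made to
fail the matrix, so they cannot act as witnesses. -/
theorem SemiDec.isSigma2Set {β : Type*} [Primcodable β] {p : ℕ → β → Prop}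
    (hp : SemiDec fun x : ℕ × β => p x.1 x.2) : IsSigma2Set {e | ∃ b, ¬ p e b} := by
  obtain ⟨f, hf, hf'⟩ := hp
  let g : ℕ × ℕ × ℕ → Bool := fun x => Option.casesOn (Encodable.decode (α := β) x.2.1) false
    fun b => !f (x.1, b) x.2.2
  have hg : Computable g := by
    refine Computable.option_casesOn ((Computable.decode (α := β)).comp (Computable.fst.comp Computable.snd))
      (Computable.const false) ?_
    exact (Computable.not (hf.comp ((Computable.fst.comp Computable.fst).pair Computable.snd)
      (Computable.snd.comp (Computable.snd.comp Computable.fst)))).to₂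
  refine ⟨fun x => g x = true, ⟨fun x => instDecidableEqBool (g x) true, hg.of_eq fun x => by simp⟩, fun e => ?_⟩
  have hb' : ∀ b, p e b ↔ ∃ s, f (e, b) s = true := fun b => hf' (e, b)
  change (∃ b, ¬ p e b) ↔ _
  simp only [hb']
  constructor
  · rintro ⟨b, hb⟩
    refine ⟨Encodable.encode b, fun z => ?_⟩
    simpa [g] using fun h => hb ⟨z, h⟩
  · rintro ⟨y, hy⟩
    cases hd : Encodable.decode (α := β) y with
    | none => simp [g, hd] at hy
    | some b =>
      refine ⟨b, ?_⟩
      rintro ⟨z, hz⟩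
      simpa [g, hd, hz] using hy z

/-! ### The index set is d-`Σ₂` -/

/-- `phi e` takes the value `b` on the equation `s = t`. -/
def EqVal (b e s t : ℕ) : Prop := b ∈ phi e (eqCode s t)

theorem computable_eqCode {α : Type*} [Primcodable α] {s t : α → ℕ} (hs : Computable s)
    (ht : Computable t) : Computable fun a => eqCode (s a) (t a) :=
  Computable.natPair (Computable.const 1) (Computable.natPair hs ht)

theorem computable_cstCode {α : Type*} [Primcodable α] {s : α → ℕ} (hs : Computable s) :
    Computable fun a => cstCode (s a) :=
  Computable.natPair (Computable.const 0) hs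

theorem computable_negCode {α : Type*} [Primcodable α] {s : α → ℕ} (hs : Computable s) :
    Computable fun a => negCode (s a) :=
  Computable.natPair (Computable.const 2) (Computable.natPair hs (Computable.const _))

theorem SemiDec.eqVal {α : Type*} [Primcodable α] {b e s t : α → ℕ} (hb : Computable b)
    (he : Computable e) (hs : Computable s) (ht : Computable t) :
    SemiDec fun a => EqVal (b a) (e a) (s a) (t a) :=
  SemiDec.mem_phi he (computable_eqCode hs ht) hb

-- The diagram conditions in semidecidable form

section Conditions

variable (e : ℕ)

/-- `k` is a genuine Gödel number of an element of the diagram, with witnesses. -/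
def DiagWitness (k : ℕ) (x : ℕ × ℕ × ℕ × ℕ) : Prop :=
  EqVal 1 e x.1 (cstCode x.2.2.1) ∧ EqVal 1 e x.2.1 (cstCode x.2.2.2) ∧
    ((k = eqCode x.1 x.2.1 ∧ x.2.2.1 = x.2.2.2) ∨
      (k = negCode (eqCode x.1 x.2.1) ∧ x.2.2.1 ≠ x.2.2.2))

/-- The conditions for `phi e` to be the characteristic function of an atomic diagram, with the
hypotheses in negated form. -/
def DiagCond (k s t u v w : ℕ) : Prop :=
  (1 ∈ phi e k ∨ 0 ∈ phi e k) ∧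
  (EqVal 0 e (cstCode v) (cstCode u) ∨ u = v) ∧
  (EqVal 0 e s (cstCode u) ∨ EqVal 1 e (cstCode u) (cstCode u)) ∧
  (EqVal 0 e s (cstCode u) ∨ EqVal 0 e s (cstCode v) ∨ u = v) ∧
  (∃ u, EqVal 1 e codeOps.one (cstCode u)) ∧
  (EqVal 0 e (cstCode u) (cstCode u) ∨ ∃ v, EqVal 1 e (codeOps.inv (cstCode u)) (cstCode v)) ∧
  (EqVal 0 e (cstCode u) (cstCode u) ∨ EqVal 0 e (cstCode v) (cstCode v) ∨
    ∃ w, EqVal 1 e (codeOps.mul (cstCode u) (cstCode v)) (cstCode w)) ∧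
  (EqVal 0 e (codeOps.inv s) (cstCode u) ∨ ∃ v, EqVal 1 e s (cstCode v)) ∧
  (EqVal 0 e s (cstCode v) ∨ EqVal 0 e (codeOps.inv (cstCode v)) (cstCode u) ∨
    EqVal 1 e (codeOps.inv s) (cstCode u)) ∧
  (EqVal 0 e (codeOps.mul s t) (cstCode u) ∨
    ((∃ v, EqVal 1 e s (cstCode v)) ∧ ∃ w, EqVal 1 e t (cstCode w))) ∧
  (EqVal 0 e s (cstCode v) ∨ EqVal 0 e t (cstCode w) ∨
    EqVal 0 e (codeOps.mul (cstCode v) (cstCode w)) (cstCode u) ∨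
    EqVal 1 e (codeOps.mul s t) (cstCode u)) ∧
  (EqVal 0 e s (cstCode u) ∨
    (s.unpair.1 = 0 ∨ s.unpair.1 = 3 ∨ s.unpair.1 = 4 ∨ s = codeOps.one)) ∧
  (0 ∈ phi e k ∨ ∃ x, DiagWitness e k x) ∧
  (EqVal 0 e s (cstCode u) ∨ EqVal 0 e t (cstCode u) ∨ EqVal 1 e s t) ∧
  (EqVal 0 e s (cstCode u) ∨ EqVal 0 e t (cstCode v) ∨ u = v ∨ 1 ∈ phi e (negCode (eqCode s t)))

/-- The first clause makes `phi e` total with values `0` and `1`. Then the value `0` is the same as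
non-membership, and each disjunction becomes the corresponding implication of `IsDiagram`. -/
theorem diagCond_iff : (∀ k s t u v w, DiagCond e k s t u v w) ↔
    (∀ k, 1 ∈ phi e k ∨ 0 ∈ phi e k) ∧ IsDiagram {k | 1 ∈ phi e k} := by
  by_cases htot : ∀ k, 1 ∈ phi e k ∨ 0 ∈ phi e k
  · have h0 : ∀ k, 0 ∈ phi e k ↔ ¬ 1 ∈ phi e k := fun k =>
      ⟨fun h h' => absurd (Part.mem_unique h h') (by norm_num), (htot k).resolve_left⟩
    have h1 : ∀ k, k ∈ {k | 1 ∈ phi e k} ↔ 1 ∈ phi e k := fun _ => Iff.rfl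
    constructor
    · intro h
      refine ⟨htot, ?_⟩
      simp only [DiagCond, EqVal, h0, ← imp_iff_not_or] at h
      constructor <;> simp only [h1]
      · exact fun u v => (h 0 0 0 u v 0).2.1
      · exact fun s u => (h 0 s 0 u 0 0).2.2.1
      · exact fun s u v => (h 0 s 0 u v 0).2.2.2.1
      · exact (h 0 0 0 0 0 0).2.2.2.2.1
      · exact fun u => (h 0 0 0 u 0 0).2.2.2.2.2.1
      · exact fun u v => (h 0 0 0 u v 0).2.2.2.2.2.2.1
      · exact fun s u => (h 0 s 0 u 0 0).2.2.2.2.2.2.2.1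
      · exact fun s u v => (h 0 s 0 u v 0).2.2.2.2.2.2.2.2.1
      · intro s t u hu
        obtain ⟨⟨v, hv⟩, w, hw⟩ := (h 0 s t u 0 0).2.2.2.2.2.2.2.2.2.1 hu
        exact ⟨v, w, hv, hw⟩
      · exact fun s t u v w => (h 0 s t u v w).2.2.2.2.2.2.2.2.2.2.1
      · exact fun s u => (h 0 s 0 u 0 0).2.2.2.2.2.2.2.2.2.2.2.1
      · intro k hk
        obtain ⟨⟨s, t, u, v⟩, hx⟩ := (h k 0 0 0 0 0).2.2.2.2.2.2.2.2.2.2.2.2.1 hk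
        exact ⟨s, t, u, v, hx⟩
      · exact fun s t u => (h 0 s t u 0 0).2.2.2.2.2.2.2.2.2.2.2.2.2.1
      · exact fun s t u v => (h 0 s t u v 0).2.2.2.2.2.2.2.2.2.2.2.2.2.2
    · rintro ⟨-, h⟩ k s t u v w
      simp only [DiagCond, EqVal, h0, ← imp_iff_not_or]
      refine ⟨(em _).imp_right id, h.cst u v, h.mem s u, h.uniq s u v, h.one, h.inv_ex u, h.mul_ex u v,
        h.inv_of s u, h.inv s u v, fun hu => ?_, h.mul s t u v w, h.atom s u, fun hk => ?_,
        h.eq s t u, h.ne s t u v⟩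
      · obtain ⟨v, w, hv, hw⟩ := h.mul_of s t u hu
        exact ⟨⟨v, hv⟩, w, hw⟩
      · obtain ⟨s, t, u, v, hx⟩ := h.cases k hk
        exact ⟨(s, t, u, v), hx⟩
  · exact ⟨fun h => absurd (fun k => (h k 0 0 0 0 0).1) htot, fun h => absurd h.1 htot⟩

end Conditions

section SemiDec

variable {α : Type*} [Primcodable α]

theorem SemiDec.exists_eqVal {e s : α → ℕ} (he : Computable e) (hs : Computable s) :
    SemiDec fun a => ∃ v, EqVal 1 (e a) (s a) (cstCode v) :=
  .ex (p := fun a v => EqVal 1 (e a) (s a) (cstCode v)) <|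
    .eqVal (Computable.const 1) (he.comp Computable.fst) (hs.comp Computable.fst)
      (computable_cstCode Computable.snd)

theorem SemiDec.diagWitness {e k : α → ℕ} (he : Computable e) (hk : Computable k) :
    SemiDec fun a => ∃ x, DiagWitness (e a) (k a) x := by
  refine .ex (p := fun a x => DiagWitness (e a) (k a) x) ?_
  have he' := he.comp (Computable.fst (α := α) (β := ℕ × ℕ × ℕ × ℕ))
  have hk' := hk.comp (Computable.fst (α := α) (β := ℕ × ℕ × ℕ × ℕ))
  have hx := Computable.snd (α := α) (β := ℕ × ℕ × ℕ × ℕ)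
  have h2 := Computable.snd.comp hx
  have h3 := Computable.snd.comp h2
  have hs := Computable.fst.comp hx
  have ht := Computable.fst.comp h2
  have hu := Computable.fst.comp h3
  have hv := Computable.snd.comp h3
  have hst := computable_eqCode hs ht
  exact .and (.eqVal (Computable.const 1) he' hs (computable_cstCode hu)) <|
    .and (.eqVal (Computable.const 1) he' ht (computable_cstCode hv)) <|
    .or (.and (.eq hk' hst) (.eq hu hv)) (.and (.eq hk' (computable_negCode hst)) (.ne hu hv))

theorem SemiDec.diagCond {e k s t u v w : α → ℕ} (he : Computable e) (hk : Computable k)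
    (hs : Computable s) (ht : Computable t) (hu : Computable u) (hv : Computable v)
    (hw : Computable w) :
    SemiDec fun a => DiagCond (e a) (k a) (s a) (t a) (u a) (v a) (w a) := by
  have c0 := Computable.const (α := α) 0
  have c1 := Computable.const (α := α) 1
  have cu := computable_cstCode hu
  have cv := computable_cstCode hv
  have cw := computable_cstCode hw
  have hinv : ∀ {f : α → ℕ}, Computable f → Computable fun a => codeOps.inv (f a) :=
    fun hf => codeOps_isComputable.inv.comp hf
  have hmul : ∀ {f g : α → ℕ}, Computable f → Computable g →
      Computable fun a => codeOps.mul (f a) (g a) :=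
    fun hf hg => codeOps_isComputable.mul.comp hf hg
  have htag := Computable.fst.comp (Computable.unpair.comp hs)
  exact .and (.or (.mem_phi he hk c1) (.mem_phi he hk c0)) <|
    .and (.or (.eqVal c0 he cv cu) (.eq hu hv)) <|
    .and (.or (.eqVal c0 he hs cu) (.eqVal c1 he cu cu)) <|
    .and (.or (.eqVal c0 he hs cu) (.or (.eqVal c0 he hs cv) (.eq hu hv))) <|
    .and (.exists_eqVal he (Computable.const _)) <|
    .and (.or (.eqVal c0 he cu cu) (.exists_eqVal he (hinv cu))) <|
    .and (.or (.eqVal c0 he cu cu) (.or (.eqVal c0 he cv cv) (.exists_eqVal he (hmul cu cv)))) <|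
    .and (.or (.eqVal c0 he (hinv hs) cu) (.exists_eqVal he hs)) <|
    .and (.or (.eqVal c0 he hs cv) (.or (.eqVal c0 he (hinv cv) cu)
      (.eqVal c1 he (hinv hs) cu))) <|
    .and (.or (.eqVal c0 he (hmul hs ht) cu) (.and (.exists_eqVal he hs)
      (.exists_eqVal he ht))) <|
    .and (.or (.eqVal c0 he hs cv) (.or (.eqVal c0 he ht cw) (.or (.eqVal c0 he (hmul cv cw) cu)
      (.eqVal c1 he (hmul hs ht) cu)))) <|
    .and (.or (.eqVal c0 he hs cu) (.or (.eq htag c0) (.or (.eq htag (Computable.const 3))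
      (.or (.eq htag (Computable.const 4)) (.eq hs (Computable.const _)))))) <|
    .and (.or (.mem_phi he hk c0) (.diagWitness he hk)) <|
    .and (.or (.eqVal c0 he hs cu) (.or (.eqVal c0 he ht cu) (.eqVal c1 he hs ht))) <|
    .or (.eqVal c0 he hs cu) (.or (.eqVal c0 he ht cv) (.or (.eq hu hv)
      (.mem_phi he (computable_negCode (computable_eqCode hs ht)) c1)))

end SemiDec

-- The axioms evaluated on a diagram

section Evaluate

variable (s : BasisSpec) (e : ℕ)

/-- `phi e` refutes an axiom. -/
def Refutes (v : Vars ℕ) (i : AxIndex) : Prop :=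
  EqVal (if s.sign i = true then 0 else 1) e (codeOps.lhs s (v.map cstCode) i)
    (codeOps.rhs s (v.map cstCode) i)

/-- Some axiom is refuted at `x, y`. -/
def RefutesPair (x : ℕ × ℕ) : Prop :=
  EqVal 0 e (cstCode x.1) (cstCode x.1) ∨ EqVal 0 e (cstCode x.2) (cstCode x.2) ∨
    ∃ z : (ℕ × ℕ × ℕ) × AxIndex, EqVal 1 e (cstCode z.1.1) (cstCode z.1.1) ∧
      EqVal 1 e (cstCode z.1.2.1) (cstCode z.1.2.1) ∧
      EqVal 1 e (cstCode z.1.2.2) (cstCode z.1.2.2) ∧ Refutes s e (x.1, x.2, z.1) z.2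

/-- Some axiom is refuted at `x, y`, or `w` is a word in `x, y`. -/
def RefutesOrGenerates (x y w : ℕ) : Prop :=
  EqVal 0 e (cstCode x) (cstCode x) ∨ EqVal 0 e (cstCode y) (cstCode y) ∨
    EqVal 0 e (cstCode w) (cstCode w) ∨
    ∃ z : (ℕ × ℕ × ℕ) × AxIndex, EqVal 1 e (cstCode z.1.1) (cstCode z.1.1) ∧
      EqVal 1 e (cstCode z.1.2.1) (cstCode z.1.2.1) ∧
      EqVal 1 e (cstCode z.1.2.2) (cstCode z.1.2.2) ∧
      (Refutes s e (x, y, z.1) z.2 ∨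
        EqVal 1 e (cstCode w) (codeOps.normalWord (cstCode x) (cstCode y) z.2))

variable {e} {U : Set ℕ} {A : Ops U}

theorem propOps_true : Ops.Hom (α := Unit) ⟨(), id, fun _ _ => ()⟩ propOps fun _ => True :=
  ⟨rfl, fun _ => rfl, fun _ _ => (true_and True).symm⟩

theorem isTermCode_hom : codeOps.Hom propOps (IsTermCode U) := propOps.fold_hom _

/-- Being a term code is a homomorphism to truth values, and a word evaluated on arguments that are
all `True` is `True`. -/
theorem isTermCode_lhs (v : Vars U) (i : AxIndex) :
    IsTermCode U (codeOps.lhs s (v.map fun u : U => cstCode u) i) := by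
  have h1 := propOps_true.lhs s ((), (), (), (), ()) i
  have h2 := (isTermCode_hom (U := U)).lhs s (v.map fun u : U => cstCode u) i
  have h3 : Vars.map (IsTermCode U) (v.map fun u : U => cstCode u) =
      Vars.map (fun _ => True) ((), (), (), (), ()) := by
    simp [Vars.map]
  rw [h2, h3, ← h1]; trivial

theorem isTermCode_rhs (v : Vars U) (i : AxIndex) :
    IsTermCode U (codeOps.rhs s (v.map fun u : U => cstCode u) i) := by
  have h1 := propOps_true.rhs s ((), (), (), (), ()) i
  have h2 := (isTermCode_hom (U := U)).rhs s (v.map fun u : U => cstCode u) i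
  have h3 : Vars.map (IsTermCode U) (v.map fun u : U => cstCode u) =
      Vars.map (fun _ => True) ((), (), (), (), ()) := by
    simp [Vars.map]
  rw [h2, h3, ← h1]; trivial

theorem isTermCode_normalWord (x y : U) (i : AxIndex) :
    IsTermCode U (codeOps.normalWord (cstCode x) (cstCode y) i) := by
  have h1 := propOps_true.normalWord () () i
  have h2 := (isTermCode_hom (U := U)).normalWord (cstCode x) (cstCode y) i
  have h3 : ∀ u : U, IsTermCode U (cstCode u) = True := fun u => by simp
  rw [h2, h3, h3, ← h1]; trivial

theorem map_termVal_cst (v : Vars U) :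
    Vars.map (termVal A) (v.map fun u : U => cstCode u) = v := by
  simp [Vars.map]

theorem eqVal_one_cst (h1 : ∀ k, 1 ∈ phi e k ↔ k ∈ opsDiagram A) (u : ℕ) :
    EqVal 1 e (cstCode u) (cstCode u) ↔ u ∈ U := by
  rw [EqVal, h1, eqCode_mem_opsDiagram]; simp

theorem eqVal_zero_cst (h0 : ∀ k, 0 ∈ phi e k ↔ k ∉ opsDiagram A) (u : ℕ) :
    EqVal 0 e (cstCode u) (cstCode u) ↔ u ∉ U := by
  rw [EqVal, h0, eqCode_mem_opsDiagram]; simp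

variable (h1 : ∀ k, 1 ∈ phi e k ↔ k ∈ opsDiagram A) (h0 : ∀ k, 0 ∈ phi e k ↔ k ∉ opsDiagram A)
include h1 h0

/-- An equation is refuted by the value `0`, an inequation by the value `1`; on a genuine diagram
both answers are eventually given, so refutation is failure. -/
theorem refutes_iff (v : Vars U) (i : AxIndex) :
    Refutes s e (v.map Subtype.val) i ↔ ¬ A.Holds s v i := by
  have hl := (termVal_hom (A := A)).lhs s (v.map fun u : U => cstCode u) i
  have hr := (termVal_hom (A := A)).rhs s (v.map fun u : U => cstCode u) i
  have key : eqCode (codeOps.lhs s (v.map fun u : U => cstCode u) i)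
      (codeOps.rhs s (v.map fun u : U => cstCode u) i) ∈ opsDiagram A ↔
      A.lhs s v i = A.rhs s v i := by
    rw [eqCode_mem_opsDiagram, hl, hr, map_termVal_cst]
    simp [isTermCode_lhs, isTermCode_rhs]
  change EqVal _ e (codeOps.lhs s (v.map fun u : U => cstCode u) i)
    (codeOps.rhs s (v.map fun u : U => cstCode u) i) ↔ _
  rw [EqVal, Ops.Holds]
  split_ifs with h
  · rw [h0, key, h]; simp
  · rw [h1, key]; simp [h]

theorem exists_not_refutesPair_iff : (∃ x, ¬ RefutesPair s e x) ↔ A.HasBasis s := by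
  constructor
  · rintro ⟨⟨x, y⟩, h⟩
    simp only [RefutesPair, eqVal_zero_cst h0, eqVal_one_cst h1] at h
    push Not at h
    obtain ⟨hx, hy, h⟩ := h
    refine ⟨⟨x, hx⟩, ⟨y, hy⟩, fun z₁ z₂ z₃ i => ?_⟩
    by_contra hc
    rw [← refutes_iff s h1 h0] at hc
    exact h ((z₁, z₂, z₃), i) z₁.2 z₂.2 z₃.2 hc
  · rintro ⟨x, y, h⟩
    refine ⟨(x, y), ?_⟩
    simp only [RefutesPair, eqVal_zero_cst h0, eqVal_one_cst h1]
    push Not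
    refine ⟨x.2, y.2, ?_⟩
    rintro ⟨⟨z₁, z₂, z₃⟩, i⟩ hz₁ hz₂ hz₃ hr
    exact (refutes_iff s h1 h0 (x, y, ⟨z₁, hz₁⟩, ⟨z₂, hz₂⟩, ⟨z₃, hz₃⟩) i).1 hr (h _ _ _ _)

theorem forall_refutesOrGenerates_iff :
    (∀ x y w, RefutesOrGenerates s e x y w) ↔ A.BasisGenerates s := by
  have hw : ∀ (x y w : U) i, EqVal 1 e (cstCode w)
      (codeOps.normalWord (cstCode x) (cstCode y) i) ↔ w = A.normalWord x y i := by
    intro x y w i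
    rw [EqVal, h1, eqCode_mem_opsDiagram, (termVal_hom (A := A)).normalWord]
    simp [isTermCode_normalWord]
  constructor
  · intro h x y w
    have := h x y w
    simp only [RefutesOrGenerates, eqVal_zero_cst h0, eqVal_one_cst h1, Subtype.coe_prop,
      not_true_eq_false, false_or, hw] at this
    obtain ⟨⟨⟨z₁, z₂, z₃⟩, i⟩, hz₁, hz₂, hz₃, hi⟩ := this
    refine ⟨i, ⟨z₁, hz₁⟩, ⟨z₂, hz₂⟩, ⟨z₃, hz₃⟩, ?_⟩
    rwa [← refutes_iff s h1 h0]
  · intro h x y w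
    simp only [RefutesOrGenerates, eqVal_zero_cst h0, eqVal_one_cst h1]
    by_cases hx : x ∈ U
    · by_cases hy : y ∈ U
      · by_cases hw' : w ∈ U
        · obtain ⟨i, z₁, z₂, z₃, hi⟩ := h ⟨x, hx⟩ ⟨y, hy⟩ ⟨w, hw'⟩
          refine Or.inr (Or.inr (Or.inr ⟨((z₁, z₂, z₃), i), z₁.2, z₂.2, z₃.2, ?_⟩))
          rwa [← refutes_iff s h1 h0, ← hw] at hi
        · exact Or.inr (Or.inr (Or.inl hw'))
      · exact Or.inr (Or.inl hy)
    · exact Or.inl hx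

end Evaluate

section SemiDec

variable {α : Type*} [Primcodable α] {s : BasisSpec} (hs : Computable s.q)
include hs

theorem SemiDec.refutes {e x y z₁ z₂ z₃ : α → ℕ} {i : α → AxIndex} (he : Computable e)
    (hx : Computable x) (hy : Computable y) (hz₁ : Computable z₁) (hz₂ : Computable z₂)
    (hz₃ : Computable z₃) (hi : Computable i) :
    SemiDec fun a => Refutes s (e a) (x a, y a, z₁ a, z₂ a, z₃ a) (i a) := by
  have hv := (computable_cstCode hx).pair <| (computable_cstCode hy).pair <|
    (computable_cstCode hz₁).pair <| (computable_cstCode hz₂).pair (computable_cstCode hz₃)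
  exact .eqVal (.ite_true ((BasisSpec.computable_sign hs).comp hi) (.const 0) (.const 1)) he
    (codeOps_isComputable.lhs hs hv hi) (codeOps_isComputable.rhs hs hv hi)

theorem SemiDec.refutesPair :
    SemiDec fun a : ℕ × (ℕ × ℕ) => RefutesPair s a.1 a.2 := by
  have he := Computable.fst (α := ℕ) (β := ℕ × ℕ)
  have hx := Computable.fst.comp (Computable.snd (α := ℕ) (β := ℕ × ℕ))
  have hy := Computable.snd.comp (Computable.snd (α := ℕ) (β := ℕ × ℕ))
  refine .or (.eqVal (.const 0) he (computable_cstCode hx) (computable_cstCode hx)) <|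
    .or (.eqVal (.const 0) he (computable_cstCode hy) (computable_cstCode hy)) ?_
  have hf := Computable.fst (α := ℕ × (ℕ × ℕ)) (β := (ℕ × ℕ × ℕ) × AxIndex)
  have hz := Computable.fst.comp
    (Computable.snd (α := ℕ × (ℕ × ℕ)) (β := (ℕ × ℕ × ℕ) × AxIndex))
  have hi := Computable.snd.comp
    (Computable.snd (α := ℕ × (ℕ × ℕ)) (β := (ℕ × ℕ × ℕ) × AxIndex))
  have hz₁ := Computable.fst.comp hz
  have hz' := Computable.snd.comp hz
  have hz₂ := Computable.fst.comp hz'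
  have hz₃ := Computable.snd.comp hz'
  exact .ex <|
    .and (.eqVal (.const 1) (he.comp hf) (computable_cstCode hz₁) (computable_cstCode hz₁)) <|
    .and (.eqVal (.const 1) (he.comp hf) (computable_cstCode hz₂) (computable_cstCode hz₂)) <|
    .and (.eqVal (.const 1) (he.comp hf) (computable_cstCode hz₃) (computable_cstCode hz₃)) <|
    .refutes hs (he.comp hf) (hx.comp hf) (hy.comp hf) hz₁ hz₂ hz₃ hi

theorem SemiDec.refutesOrGenerates {e x y w : α → ℕ} (he : Computable e)
    (hx : Computable x) (hy : Computable y) (hw : Computable w) :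
    SemiDec fun a => RefutesOrGenerates s (e a) (x a) (y a) (w a) := by
  refine .or (.eqVal (.const 0) he (computable_cstCode hx) (computable_cstCode hx)) <|
    .or (.eqVal (.const 0) he (computable_cstCode hy) (computable_cstCode hy)) <|
    .or (.eqVal (.const 0) he (computable_cstCode hw) (computable_cstCode hw)) ?_
  have hf := Computable.fst (α := α) (β := (ℕ × ℕ × ℕ) × AxIndex)
  have hz := Computable.fst.comp (Computable.snd (α := α) (β := (ℕ × ℕ × ℕ) × AxIndex))
  have hi := Computable.snd.comp (Computable.snd (α := α) (β := (ℕ × ℕ × ℕ) × AxIndex))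
  have hz₁ := Computable.fst.comp hz
  have hz' := Computable.snd.comp hz
  have hz₂ := Computable.fst.comp hz'
  have hz₃ := Computable.snd.comp hz'
  have hc := computable_cstCode hz₁
  have hc₂ := computable_cstCode hz₂
  have hc₃ := computable_cstCode hz₃
  have h1 := SemiDec.eqVal (.const 1) (he.comp hf) hc hc
  have h2 := SemiDec.eqVal (.const 1) (he.comp hf) hc₂ hc₂
  have h3 := SemiDec.eqVal (.const 1) (he.comp hf) hc₃ hc₃
  have h4 := SemiDec.refutes hs (he.comp hf) (hx.comp hf) (hy.comp hf) hz₁ hz₂ hz₃ hi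
  have h5 := SemiDec.eqVal (.const 1) (he.comp hf) (computable_cstCode (hw.comp hf))
    (codeOps_isComputable.normalWord (computable_cstCode (hx.comp hf))
      (computable_cstCode (hy.comp hf)) hi)
  have h6 := h1.and (h2.and (h3.and (h4.or h5)))
  exact .ex h6

end SemiDec

/-- The first set says that some pair is never refuted, the second that a diagram condition or the
generation clause fails somewhere; one tuple of numbers serves both kinds of failure. Totality
belongs to the second set, so the first one need only be correct for genuine diagrams. -/
theorem ScottPair.isDSigma2Set_indexSet {G : Type} [Group G] {s : BasisSpec} (hs : s.Coherent)
    (hq : Computable s.q) {a b : G} (h : ScottPair G s.N (s.P = true) s.Q a b) :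
    IsDSigma2Set (indexSet G) := by
  refine ⟨{e | ∃ x, ¬ RefutesPair s e x},
    {e | ∃ x : ℕ × ℕ × ℕ × ℕ × ℕ × ℕ, ¬ (DiagCond e x.1 x.2.1 x.2.2.1 x.2.2.2.1 x.2.2.2.2.1
      x.2.2.2.2.2 ∧ RefutesOrGenerates s e x.1 x.2.1 x.2.2.1)},
    (SemiDec.refutesPair hq).isSigma2Set, ?_, ?_⟩
  · refine SemiDec.isSigma2Set (p := fun e (x : ℕ × ℕ × ℕ × ℕ × ℕ × ℕ) =>
      DiagCond e x.1 x.2.1 x.2.2.1 x.2.2.2.1 x.2.2.2.2.1 x.2.2.2.2.2 ∧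
        RefutesOrGenerates s e x.1 x.2.1 x.2.2.1) ?_
    have h0 := Computable.fst (α := ℕ) (β := ℕ × ℕ × ℕ × ℕ × ℕ × ℕ)
    have h1 := Computable.snd (α := ℕ) (β := ℕ × ℕ × ℕ × ℕ × ℕ × ℕ)
    have h2 := Computable.snd.comp h1
    have h3 := Computable.snd.comp h2
    have h4 := Computable.snd.comp h3
    have h5 := Computable.snd.comp h4
    exact .and (.diagCond h0 (Computable.fst.comp h1) (Computable.fst.comp h2)
      (Computable.fst.comp h3) (Computable.fst.comp h4) (Computable.fst.comp h5)
      (Computable.snd.comp h5))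
      (.refutesOrGenerates hq h0 (Computable.fst.comp h1) (Computable.fst.comp h2)
      (Computable.fst.comp h3))
  · ext e
    rw [Set.mem_sdiff, mem_indexSet_iff]
    have hforall : (¬ e ∈ {e | ∃ x : ℕ × ℕ × ℕ × ℕ × ℕ × ℕ, ¬ (DiagCond e x.1 x.2.1 x.2.2.1
        x.2.2.2.1 x.2.2.2.2.1 x.2.2.2.2.2 ∧ RefutesOrGenerates s e x.1 x.2.1 x.2.2.1)}) ↔
        (∀ k s t u v w, DiagCond e k s t u v w) ∧ ∀ x y w, RefutesOrGenerates s e x y w := by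
      change ¬ (∃ _, _) ↔ _
      push Not
      constructor
      · exact fun H => ⟨fun k s t u v w => (H (k, s, t, u, v, w)).1,
          fun x y w => (H (x, y, w, 0, 0, 0)).2⟩
      · exact fun H x => ⟨H.1 _ _ _ _ _ _, H.2 _ _ _⟩
    rw [hforall, diagCond_iff]
    change _ ↔ (∃ _, _) ∧ _
    constructor
    · rintro ⟨U, A, hA, hk⟩
      have h1 : ∀ k, 1 ∈ phi e k ↔ k ∈ opsDiagram A := fun k => by
        by_cases hd : k ∈ opsDiagram A
        · simp [(hk k).1 hd, hd]
        · simp [(hk k).2 hd, hd]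
      have h0 : ∀ k, 0 ∈ phi e k ↔ k ∉ opsDiagram A := fun k => by
        by_cases hd : k ∈ opsDiagram A
        · simp [(hk k).1 hd, hd]
        · simp [(hk k).2 hd, hd]
      rw [exists_not_refutesPair_iff s h1 h0, forall_refutesOrGenerates_iff s h1 h0]
      obtain ⟨hA1, hA2⟩ := (h.exists_equiv_iff hs A).2 hA
      refine ⟨hA1, ⟨fun k => ?_, ?_⟩, hA2⟩
      · rw [h0, h1]; exact em _
      · have : {k | 1 ∈ phi e k} = opsDiagram A := Set.ext h1
        rw [this]
        exact isDiagram_opsDiagram A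
    · rintro ⟨hR, ⟨htot, hD⟩, hG⟩
      obtain ⟨U, A, hUA⟩ := hD.exists_ops
      have h1 : ∀ k, 1 ∈ phi e k ↔ k ∈ opsDiagram A := fun k => Set.ext_iff.1 hUA k
      have h0 : ∀ k, 0 ∈ phi e k ↔ k ∉ opsDiagram A := fun k => by
        rw [← h1]
        exact ⟨fun h h' => absurd (Part.mem_unique h h') (by norm_num), (htot k).resolve_left⟩
      rw [exists_not_refutesPair_iff s h1 h0] at hR
      rw [forall_refutesOrGenerates_iff s h1 h0] at hG
      exact ⟨U, A, (h.exists_equiv_iff hs A).1 ⟨hR, hG⟩,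
        fun k => ⟨fun hk => Part.eq_some_iff.2 ((h1 k).2 hk),
          fun hk => Part.eq_some_iff.2 ((h0 k).2 hk)⟩⟩

/-! ### Groups with a uniformly decidable word problem -/

theorem exists_hom_groupOps_iff {G H : Type*} [Group G] [Group H] :
    (∃ f : G ≃ H, (groupOps G).Hom (groupOps H) f) ↔ Nonempty (G ≃* H) := by
  constructor
  · rintro ⟨f, hf⟩
    exact ⟨MulEquiv.mk' f hf.mul⟩
  · rintro ⟨e⟩
    exact ⟨e.toEquiv, ⟨map_one e, map_inv e, map_mul e⟩⟩

/-- The smallest names of the elements of a group. -/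
def leastNames {H : Type*} (ev : ℕ → H) : Set ℕ := {u | ∀ v < u, ev v ≠ ev u}

theorem leastNames_bijective {H : Type*} {ev : ℕ → H} (hev : ev.Surjective) :
    Function.Bijective fun u : leastNames ev => ev u := by
  constructor
  · rintro ⟨u, hu⟩ ⟨v, hv⟩ (h : ev u = ev v)
    rcases lt_trichotomy u v with huv | rfl | huv
    · exact absurd h (hv u huv)
    · rfl
    · exact absurd h.symm (hu v huv)
  · intro g
    classical
    have h := hev g
    refine ⟨⟨Nat.find h, fun v hv => ?_⟩, Nat.find_spec h⟩
    rw [Nat.find_spec h]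
    exact Nat.find_min h hv

noncomputable def leastEquiv {H : Type*} {ev : ℕ → H} (hev : ev.Surjective) :
    leastNames ev ≃ H := Equiv.ofBijective _ (leastNames_bijective hev)

noncomputable def leastOps {H : Type*} [Group H] {ev : ℕ → H} (hev : ev.Surjective) :
    Ops (leastNames ev) where
  one := (leastEquiv hev).symm 1
  inv u := (leastEquiv hev).symm (leastEquiv hev u)⁻¹
  mul u v := (leastEquiv hev).symm (leastEquiv hev u * leastEquiv hev v)

theorem leastEquiv_hom {H : Type*} [Group H] {ev : ℕ → H} (hev : ev.Surjective) :
    (leastOps hev).Hom (groupOps H) (leastEquiv hev) where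
  one := (leastEquiv hev).apply_symm_apply _
  inv _ := (leastEquiv hev).apply_symm_apply _
  mul _ _ := (leastEquiv hev).apply_symm_apply _

/-- The name denoted by the Gödel number of a term whose constants are names. -/
def substCode (k : ℕ) : ℕ := codeOps.fold (fun k => k.unpair.2) k

/-- A constant is itself a name and hence a code. Replacing each constant by the code it names
flattens the term into one name, whose value is unchanged because `ev` is a homomorphism. -/
theorem ev_substCode {H : Type*} [Group H] {ev : ℕ → H} (hev : ev.Surjective)
    (hom : codeOps.Hom (groupOps H) ev) {k : ℕ} (hk : IsTermCode (leastNames ev) k) :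
    ev (substCode k) = leastEquiv hev (termVal (leastOps hev) k) := by
  induction k using code_induction with
  | atom k hk' =>
    have h := (isTermCode_atom hk').1 hk
    rw [substCode, Ops.fold_atom _ _ hk', termVal, Ops.fold_atom _ _ hk', dif_pos h.2]
    rfl
  | one =>
    rw [substCode, Ops.fold_one, hom.one, termVal_hom.one, (leastEquiv_hom hev).one]
  | inv s ih =>
    rw [substCode, Ops.fold_inv, hom.inv, termVal_inv, (leastEquiv_hom hev).inv]
    exact congrArg _ (ih (isTermCode_inv.1 hk))
  | mul s t ihs iht =>
    rw [substCode, Ops.fold_mul, hom.mul, termVal_mul, (leastEquiv_hom hev).mul]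
    exact congrArg₂ _ (ihs (isTermCode_mul.1 hk).1) (iht (isTermCode_mul.1 hk).2)

def boolOps : Ops Bool := ⟨true, id, and⟩

theorem boolOps_hom : boolOps.Hom propOps fun b => b = true :=
  ⟨by simp [boolOps, propOps], fun _ => rfl, fun x y => by simp [boolOps, propOps]⟩

-- Deciding the diagram from an equality test on names

section Decide

variable (E : ℕ → ℕ → Bool)

def decideLeast (u : ℕ) : Bool := Nat.rec true (fun v r => r && !E v u) u

theorem decideLeast_iff {H : Type*} {ev : ℕ → H} (hE : ∀ u v, E u v = true ↔ ev u = ev v)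
    (u : ℕ) : decideLeast E u = true ↔ u ∈ leastNames ev := by
  have h : ∀ m : ℕ, (Nat.rec true (fun v r => r && !E v u) m : Bool) = true ↔
      ∀ v < m, ev v ≠ ev u := by
    intro m
    induction m with
    | zero => simp
    | succ m ih =>
      simp only [Bool.and_eq_true, ih, Bool.not_eq_true', ← Bool.not_eq_true, hE,
        Nat.lt_succ_iff_lt_or_eq, or_imp, forall_and, forall_eq, ne_eq]
  exact h u

def decideTermCode (k : ℕ) : Bool :=
  boolOps.fold (fun k => decide (k.unpair.1 = 0) && decideLeast E k.unpair.2) k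

theorem decideTermCode_iff {H : Type*} {ev : ℕ → H} (hE : ∀ u v, E u v = true ↔ ev u = ev v)
    (k : ℕ) : decideTermCode E k = true ↔ IsTermCode (leastNames ev) k := by
  rw [decideTermCode, IsTermCode, boolOps_hom.fold]
  have : ((fun b => b = true) ∘ fun k : ℕ =>
      decide (k.unpair.1 = 0) && decideLeast E k.unpair.2) =
      fun k => k.unpair.1 = 0 ∧ k.unpair.2 ∈ leastNames ev := by
    funext k
    simp [decideLeast_iff E hE]
  rw [this]

def decideDiagram (k : ℕ) : Bool :=
  -- Tag `2` is an implication, here a negation, so `m` is the equation inside. Wrong guesses are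
  -- harmless: `k` is compared below with the rebuilt codes.
  let m := if k.unpair.1 = 2 then k.unpair.2.unpair.1 else k
  let s := m.unpair.2.unpair.1
  let t := m.unpair.2.unpair.2
  (decideTermCode E s && decideTermCode E t) &&
    ((decide (k = eqCode s t) && E (substCode s) (substCode t)) ||
      (decide (k = negCode (eqCode s t)) && !E (substCode s) (substCode t)))

theorem decideDiagram_iff {H : Type*} [Group H] {ev : ℕ → H} (hev : ev.Surjective)
    (hom : codeOps.Hom (groupOps H) ev) (hE : ∀ u v, E u v = true ↔ ev u = ev v)
    (k : ℕ) : decideDiagram E k = true ↔ k ∈ opsDiagram (leastOps hev) := by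
  have key : ∀ s t, IsTermCode (leastNames ev) s → IsTermCode (leastNames ev) t →
      (E (substCode s) (substCode t) = true ↔
        termVal (leastOps hev) s = termVal (leastOps hev) t) := by
    intro s t hs ht
    rw [hE, ev_substCode hev hom hs, ev_substCode hev hom ht, (leastEquiv hev).injective.eq_iff]
  constructor
  · intro h
    simp only [decideDiagram, Bool.and_eq_true, Bool.or_eq_true, decide_eq_true_eq,
      decideTermCode_iff E hE, Bool.not_eq_true', ← Bool.not_eq_true] at h
    obtain ⟨⟨hs, ht⟩, h⟩ := h
    rw [key _ _ hs ht] at h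
    exact ⟨_, _, hs, ht, h⟩
  · rintro ⟨s, t, hs, ht, h⟩
    have hs' := (decideTermCode_iff E hE s).2 hs
    have ht' := (decideTermCode_iff E hE t).2 ht
    rw [Ne, ← key s t hs ht] at h
    rcases h with ⟨rfl, h⟩ | ⟨rfl, h⟩
    · simp [decideDiagram, eqCode, hs', ht', h]
    · simp [decideDiagram, eqCode, negCode, hs', ht', h]

end Decide

section Computable

variable {α : Type*} [Primcodable α] {E : α → ℕ → ℕ → Bool}

theorem computable_substCode : Computable substCode :=
  (codeOps_isComputable.fold (γ := Unit) (g := fun _ k => k.unpair.2)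
    (Computable.snd.comp (Computable.unpair.comp Computable.snd)).to₂).comp
    (Computable.const ()) Computable.id

variable (hE : Computable fun p : α × ℕ × ℕ => E p.1 p.2.1 p.2.2)
include hE

theorem computable_decideLeast : Computable₂ fun a u => decideLeast (E a) u := by
  refine Computable.nat_rec (h := fun (p : α × ℕ) (q : ℕ × Bool) => q.2 && !E p.1 q.1 p.2)
    Computable.snd (Computable.const true) ?_
  exact (Computable.and (Computable.snd.comp Computable.snd) (Computable.not (hE.comp
    ((Computable.fst.comp Computable.fst).pair ((Computable.fst.comp Computable.snd).pair
      (Computable.snd.comp Computable.fst)))))).to₂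

theorem computable_decideTermCode : Computable₂ fun a k => decideTermCode (E a) k := by
  have hb : boolOps.IsComputable := ⟨Computable.id, Primrec.and.to_comp⟩
  refine hb.fold (g := fun a k => decide (k.unpair.1 = 0) && decideLeast (E a) k.unpair.2) ?_
  have hu := Computable.unpair.comp (Computable.snd (α := α) (β := ℕ))
  exact (Computable.and (Computable.decide_eq (Computable.fst.comp hu) (Computable.const 0))
    ((computable_decideLeast hE).comp Computable.fst (Computable.snd.comp hu))).to₂

theorem computable_decideDiagram : Computable₂ fun a k => decideDiagram (E a) k := by
  have ha := Computable.fst (α := α) (β := ℕ)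
  have hk := Computable.snd (α := α) (β := ℕ)
  have hu := Computable.unpair.comp hk
  have hm := Computable.ite_eq (c := 2) (Computable.fst.comp hu)
    (Computable.fst.comp (Computable.unpair.comp (Computable.snd.comp hu))) hk
  have hm' := Computable.unpair.comp (Computable.snd.comp (Computable.unpair.comp hm))
  have hs := Computable.fst.comp hm'
  have ht := Computable.snd.comp hm'
  have hst := computable_eqCode hs ht
  have hE' := hE.comp (ha.pair ((computable_substCode.comp hs).pair (computable_substCode.comp ht)))
  have hd := computable_decideTermCode hE
  exact (Computable.and (Computable.and (hd.comp ha hs) (hd.comp ha ht))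
    (Computable.or (Computable.and (Computable.decide_eq hk hst) hE')
      (Computable.and (Computable.decide_eq hk (computable_negCode hst))
        (Computable.not hE')))).to₂

end Computable

/-- The s-m-n theorem: `curry` fixes the first argument of one code for the whole family. -/
theorem exists_computable_index {χ : ℕ → ℕ → Bool} (hχ : Computable₂ χ) :
    ∃ f : ℕ → ℕ, Computable f ∧ ∀ x k, phi (f x) k = Part.some (if χ x k = true then 1 else 0) := by
  let F : ℕ → ℕ := fun m => if χ m.unpair.1 m.unpair.2 = true then 1 else 0
  have hF : Computable F := by
    refine Computable.ite_true ?_ (Computable.const 1) (Computable.const 0)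
    exact hχ.comp (Computable.fst.comp Computable.unpair) (Computable.snd.comp Computable.unpair)
  obtain ⟨c, hc⟩ := Nat.Partrec.Code.exists_code.1 (Partrec.nat_iff.1 hF.partrec)
  refine ⟨fun x => Encodable.encode (c.curry x), Computable.encode.comp
    ((Nat.Partrec.Code.primrec₂_curry.to_comp).comp (Computable.const c) Computable.id),
    fun x k => ?_⟩
  rw [phi, Denumerable.ofNat_encode, Nat.Partrec.Code.eval_curry, hc]
  simp [F]

/-- Groups with uniformly decidable word problem are realised by a computable function of the
parameter. -/
theorem exists_computable_mem_indexSet_iff {G : Type} [Group G] {E : ℕ → ℕ → ℕ → Bool}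
    (hE : Computable fun p : ℕ × ℕ × ℕ => E p.1 p.2.1 p.2.2) (H : ℕ → Type*) [∀ x, Group (H x)]
    (ev : ∀ x, ℕ → H x) (hev : ∀ x, (ev x).Surjective)
    (hom : ∀ x, codeOps.Hom (groupOps (H x)) (ev x))
    (hEv : ∀ x u v, E x u v = true ↔ ev x u = ev x v) :
    ∃ f : ℕ → ℕ, Computable f ∧ ∀ x, f x ∈ indexSet G ↔ Nonempty (H x ≃* G) := by
  obtain ⟨f, hf, hphi⟩ := exists_computable_index (computable_decideDiagram hE)
  refine ⟨f, hf, fun x => ?_⟩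
  have hd := decideDiagram_iff (E x) (hev x) (hom x) (hEv x)
  have hl := leastEquiv_hom (hev x)
  rw [mem_indexSet_iff, ← exists_hom_groupOps_iff]
  constructor
  · rintro ⟨U, A, ⟨g, hg⟩, hk⟩
    have : opsDiagram (leastOps (hev x)) = opsDiagram A := by
      ext k
      rw [← hd]
      by_cases hkA : k ∈ opsDiagram A
      · have := (hk k).1 hkA
        rw [hphi] at this
        simpa [hkA] using this
      · have := (hk k).2 hkA
        rw [hphi] at this
        simpa [hkA] using this
    obtain ⟨j, hj⟩ := exists_hom_of_opsDiagram_eq this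
    exact ⟨((leastEquiv (hev x)).symm.trans j).trans g, hg.comp (hj.comp hl.symm)⟩
  · rintro ⟨g, hg⟩
    refine ⟨_, leastOps (hev x), ⟨(leastEquiv (hev x)).trans g, hg.comp hl⟩, fun k => ?_⟩
    rw [hphi, ← hd]
    exact ⟨fun h => by rw [if_pos h], fun h => by rw [if_neg h]⟩

/-! ### Approximations of `Σ₂` sets -/

def holdsBelow (R : ℕ → Bool) (t : ℕ) : Bool := Nat.rec true (fun z r => r && R z) t

theorem holdsBelow_iff {R : ℕ → Bool} {t : ℕ} :
    holdsBelow R t = true ↔ ∀ z < t, R z = true := by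
  induction t with
  | zero => simp [holdsBelow]
  | succ t ih =>
    have : holdsBelow R (t + 1) = (holdsBelow R t && R t) := rfl
    rw [this, Bool.and_eq_true, ih]
    simp only [Nat.lt_succ_iff_lt_or_eq, or_imp, forall_and, forall_eq]

/-- The candidate for a witness `y` of `∃ y, ∀ z, R y z` at stage `t`. -/
def candidate (R : ℕ → ℕ → Bool) (t : ℕ) : ℕ :=
  Nat.rec 0 (fun t r => if holdsBelow (R r) t = true then r else r + 1) t

theorem candidate_succ (R : ℕ → ℕ → Bool) (t : ℕ) : candidate R (t + 1) =
    if holdsBelow (R (candidate R t)) t = true then candidate R t else candidate R t + 1 := rfl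

theorem monotone_candidate (R : ℕ → ℕ → Bool) : Monotone (candidate R) := by
  refine monotone_nat_of_le_succ fun t => ?_
  rw [candidate_succ]
  split_ifs <;> omega

/-- A bounded monotone sequence of natural numbers attains its maximum. -/
theorem exists_max_of_monotone {h : ℕ → ℕ} (hb : ∃ B, ∀ t, h t ≤ B) : ∃ q, ∀ t, h t ≤ h q := by
  obtain ⟨B, hB⟩ := hb
  have hfin : (Set.range h).Finite :=
    (Set.finite_Iic B).subset (by rintro _ ⟨t, rfl⟩; exact hB t)
  obtain ⟨_, ⟨q, rfl⟩, hq⟩ := hfin.exists_maximal ⟨h 0, 0, rfl⟩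
  refine ⟨q, fun t => ?_⟩
  rcases le_total (h t) (h q) with hle | hle
  · exact hle
  · exact hq ⟨t, rfl⟩ hle

/-- The candidate is abandoned only when a counterexample to it has been found. It therefore never
passes a true witness, and if it settles, no counterexample to its final value exists. -/
theorem bounded_candidate_iff (R : ℕ → ℕ → Bool) :
    (∃ B, ∀ t, candidate R t ≤ B) ↔ ∃ y, ∀ z, R y z = true := by
  constructor
  · intro hb
    obtain ⟨q, hq⟩ := exists_max_of_monotone hb
    refine ⟨candidate R q, fun z => ?_⟩
    have h1 : candidate R (max q (z + 1)) = candidate R q :=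
      le_antisymm (hq _) (monotone_candidate R (le_max_left _ _))
    have h2 := hq (max q (z + 1) + 1)
    rw [candidate_succ, h1] at h2
    split_ifs at h2 with h3
    · exact holdsBelow_iff.1 h3 z (by omega)
    · omega
  · rintro ⟨y, hy⟩
    refine ⟨y, fun t => ?_⟩
    induction t with
    | zero => exact Nat.zero_le _
    | succ t ih =>
      rw [candidate_succ]
      split_ifs with h
      · exact ih
      · rcases ih.lt_or_eq with h' | h'
        · exact h'
        · rw [h'] at h
          exact absurd (holdsBelow_iff.2 fun z _ => hy z) h

theorem IsSigma2Set.exists_counter {S : Set ℕ} (hS : IsSigma2Set S) :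
    ∃ h : ℕ → ℕ → ℕ, Computable₂ h ∧ (∀ x, Monotone (h x)) ∧
      ∀ x, x ∈ S ↔ ∃ B, ∀ t, h x t ≤ B := by
  obtain ⟨R, ⟨hdec, hR⟩, hS⟩ := hS
  let R' : ℕ → ℕ → ℕ → Bool := fun x y z => decide (R (x, y, z))
  have hb : Computable fun p : (ℕ × ℕ) × ℕ => holdsBelow (R' p.1.1 p.1.2) p.2 := by
    refine Computable.nat_rec (h := fun (p : (ℕ × ℕ) × ℕ) (q : ℕ × Bool) =>
      q.2 && R' p.1.1 p.1.2 q.1) Computable.snd (Computable.const true) ?_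
    have h1 := Computable.fst.comp (Computable.fst (α := (ℕ × ℕ) × ℕ) (β := ℕ × Bool))
    have h2 := Computable.snd (α := (ℕ × ℕ) × ℕ) (β := ℕ × Bool)
    exact (Computable.and (Computable.snd.comp h2) (hR.comp ((Computable.fst.comp h1).pair
      ((Computable.snd.comp h1).pair (Computable.fst.comp h2))))).to₂
  refine ⟨fun x => candidate (R' x), ?_, fun x => monotone_candidate _, fun x => ?_⟩
  · refine Computable.nat_rec (h := fun (p : ℕ × ℕ) (q : ℕ × ℕ) =>
      if holdsBelow (R' p.1 q.2) q.1 = true then q.2 else q.2 + 1) Computable.snd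
      (Computable.const 0) ?_
    have h1 := Computable.fst (α := ℕ × ℕ) (β := ℕ × ℕ)
    have h2 := Computable.snd (α := ℕ × ℕ) (β := ℕ × ℕ)
    exact (Computable.ite_true (hb.comp (((Computable.fst.comp h1).pair
      (Computable.snd.comp h2)).pair (Computable.fst.comp h2))) (Computable.snd.comp h2)
      (Computable.succ.comp (Computable.snd.comp h2))).to₂
  · rw [bounded_candidate_iff, hS]
    simp [R']

/-! ### Fast-growing sequences that are frozen when the counter moves -/

open Nat in
/-- A sequence that is `(t + 1)!` while `h t ≤ h q`, and constant thereafter. -/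
def frozenFactorial (h : ℕ → ℕ) (q t : ℕ) : ℕ :=
  Nat.rec 1 (fun t r => if h (t + 1) ≤ h q then (t + 2)! else r) t

section Frozen

open Nat

variable {h : ℕ → ℕ} (hm : Monotone h) {q t : ℕ}

theorem frozenFactorial_succ (h : ℕ → ℕ) (q t : ℕ) : frozenFactorial h q (t + 1) =
    if h (t + 1) ≤ h q then (t + 2)! else frozenFactorial h q t := rfl

theorem frozenFactorial_of_le (hq : h t ≤ h q) : frozenFactorial h q t = (t + 1)! := by
  cases t with
  | zero => rfl
  | succ t => rw [frozenFactorial_succ, if_pos hq]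

theorem frozenFactorial_le (h : ℕ → ℕ) (q t : ℕ) : frozenFactorial h q t ≤ (t + 1)! := by
  induction t with
  | zero => exact le_rfl
  | succ t ih =>
    rw [frozenFactorial_succ]
    split_ifs
    · exact le_rfl
    · exact ih.trans (Nat.factorial_le (by omega))

-- At stage `0` the counter cannot exceed its value at `q`, so the freezing value was reached at a
-- stage before `t`, where it is at most `t !`.
include hm in
theorem frozenFactorial_le_of_lt (hq : h q < h t) : frozenFactorial h q t ≤ t ! := by
  cases t with
  | zero => exact absurd (hm (Nat.zero_le q)) (not_le.2 hq)
  | succ t =>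
    rw [frozenFactorial_succ, if_neg (not_le.2 hq)]
    exact frozenFactorial_le _ _ _

end Frozen

/-! ### The approximating sequences of a named group -/

section Approx

open Nat

variable (N : ℤ) (h₁ h₂ : ℕ → ℕ)

/-- Only two properties matter: it is coprime to `N`, and it exceeds `1` when `N ≠ 0`. It need not
be prime. -/
def rootPrime : ℕ := N.natAbs + 1

/-- The values of the generators at stage `t`: powers of `a` with roots that are added whenever
`h₁` moves, powers of `a` that grow until `h₂` moves, and `b`. -/
def genVal (t k : ℕ) : ℕ × ℕ × ℕ :=
  if k.unpair.1 = 0 then (0, rootPrime N ^ (h₁ t - h₁ k.unpair.2), 0)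
  else if k.unpair.1 = 1 then (0, rootPrime N ^ h₁ t * frozenFactorial h₂ k.unpair.2 t, 0)
  else (0, 0, 1)

def natTriple (u : ℕ × ℕ × ℕ) : ℕ × ℤ × ℕ := (u.1, u.2.1, u.2.2)

/-- The value of a name at stage `t`. -/
def stageVal (t u : ℕ) : ℕ × ℤ × ℕ :=
  (tripleOps N).fold (fun k => natTriple (genVal N h₁ h₂ t k)) u

/-- A majorant of `tripleOps`, with `N` replaced by its absolute value and cancellation disregarded.
It does not depend on the counters or on the stage. -/
def boundOps : Ops (ℕ × ℕ × ℕ) where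
  one := (0, 0, 0)
  inv u := (u.2.2, u.2.1, u.1)
  mul u v := (u.1 + (v.1 - u.2.2),
    N.natAbs ^ (v.1 - u.2.2) * u.2.1 + N.natAbs ^ (u.2.2 - v.1) * v.2.1,
    (u.2.2 - v.1) + v.2.2)

def boundGen (k : ℕ) : ℕ × ℕ × ℕ := if k.unpair.1 = 0 ∨ k.unpair.1 = 1 then (0, 1, 0) else (0, 0, 1)

/-- A bound for the coefficients of a name. -/
def boundVal (u : ℕ) : ℕ × ℕ × ℕ := (boundOps N).fold boundGen u

variable {N h₁ h₂}

/-- Decomposition of a value at two consecutive stages. -/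
def StageDecomp (N : ℤ) (h₁ h₂ : ℕ → ℕ) (t : ℕ) (w w' : ℕ × ℤ × ℕ) (b : ℕ × ℕ × ℕ) : Prop :=
  w.1 = b.1 ∧ w'.1 = b.1 ∧ w.2.2 = b.2.2 ∧ w'.2.2 = b.2.2 ∧ ∃ X Y : ℤ,
    w.2.1 = X + Y * (t + 1)! ∧
    w'.2.1 = rootPrime N ^ (h₁ (t + 1) - h₁ t) *
      (X + Y * if h₂ (t + 1) ≤ h₂ t then ((t + 2)! : ℕ) else ((t + 1)! : ℕ)) ∧
    |X| ≤ b.2.1 * (rootPrime N ^ h₁ t * t !) ∧ ((rootPrime N : ℤ) ^ h₁ t) ∣ Y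

theorem le_inv_code (s : ℕ) : s ≤ codeOps.inv s := Nat.right_le_pair _ _

theorem le_mul_code_left (s t : ℕ) : s ≤ codeOps.mul s t :=
  (Nat.left_le_pair s t).trans (Nat.right_le_pair _ _)

theorem le_mul_code_right (s t : ℕ) : t ≤ codeOps.mul s t :=
  (Nat.right_le_pair s t).trans (Nat.right_le_pair _ _)

/-- A name at most `t` involves only generators of index `q ≤ t`. The growing ones all carry the
same factorial and make up `Y`; the roots and the frozen ones are small and make up `X`. The next
stage multiplies everything by one power of `rootPrime N` and changes only the common factorial.
Products and inverses act linearly on `X` and `Y`, because the exponents of `b` do not depend on the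
stage. -/
theorem stageDecomp (hm₁ : Monotone h₁) (hm₂ : Monotone h₂) {t u : ℕ} (hu : u ≤ t) :
    StageDecomp N h₁ h₂ t (stageVal N h₁ h₂ t u) (stageVal N h₁ h₂ (t + 1) u) (boundVal N u) := by
  have hp : 0 < rootPrime N := Nat.succ_pos _
  induction u using code_induction with
  | one =>
    simp only [stageVal, boundVal, Ops.fold_one]
    exact ⟨rfl, rfl, rfl, rfl, 0, 0, by simp [tripleOps], by simp [tripleOps],
      by simp [boundOps], dvd_zero _⟩
  | atom k hk =>
    have hq : k.unpair.2 ≤ t := (Nat.unpair_right_le k).trans hu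
    simp only [stageVal, boundVal, Ops.fold_atom _ _ hk, boundGen, genVal]
    by_cases h0 : k.unpair.1 = 0
    · simp only [h0, if_true, true_or]
      refine ⟨rfl, rfl, rfl, rfl, rootPrime N ^ (h₁ t - h₁ k.unpair.2), 0, ?_, ?_, ?_, dvd_zero _⟩
      · simp [natTriple]
      · simp only [natTriple, zero_mul, add_zero]
        rw [← pow_add]
        push_cast
        congr 1
        have := hm₁ hq
        have := hm₁ (Nat.le_succ t)
        simp only [Nat.succ_eq_add_one] at this
        omega
      · rw [abs_of_nonneg (by positivity)]
        have h1 : rootPrime N ^ (h₁ t - h₁ k.unpair.2) ≤ rootPrime N ^ h₁ t :=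
          Nat.pow_le_pow_right hp (Nat.sub_le _ _)
        have h2 := Nat.le_mul_of_pos_right (rootPrime N ^ h₁ t) (Nat.factorial_pos t)
        rw [Nat.cast_one, one_mul]
        exact_mod_cast h1.trans h2
    · by_cases h1 : k.unpair.1 = 1
      · simp only [h1, if_true, or_true, one_ne_zero, if_false]
        have hroot : rootPrime N ^ h₁ (t + 1) =
            rootPrime N ^ (h₁ (t + 1) - h₁ t) * rootPrime N ^ h₁ t := by
          rw [← pow_add, Nat.sub_add_cancel (hm₁ (Nat.le_succ t))]
        -- Since `q ≤ t`, the counter at `q` is at most that at `t`. With equality the generator is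
        -- still growing and has factor `(t + 1)!`; otherwise it has been frozen at no more than `t
        -- !`.
        rcases (hm₂ hq).eq_or_lt with he | hlt
        · refine ⟨rfl, rfl, rfl, rfl, 0, rootPrime N ^ h₁ t, ?_, ?_, ?_, dvd_rfl⟩
          · simp [natTriple, frozenFactorial_of_le he.ge]
          · rw [hroot, frozenFactorial_succ, he, frozenFactorial_of_le he.ge]
            simp only [natTriple]
            split_ifs <;> push_cast <;> ring
          · simp only [abs_zero]
            positivity
        · refine ⟨rfl, rfl, rfl, rfl,
            (rootPrime N ^ h₁ t * frozenFactorial h₂ k.unpair.2 t : ℕ), 0, ?_, ?_, ?_, dvd_zero _⟩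
          · simp [natTriple]
          · have h3 : ¬ h₂ (t + 1) ≤ h₂ k.unpair.2 :=
              not_le.2 (hlt.trans_le (hm₂ (Nat.le_succ t)))
            rw [hroot, frozenFactorial_succ, if_neg h3]
            simp only [natTriple]
            push_cast
            ring
          · rw [abs_of_nonneg (by positivity)]
            rw [Nat.cast_one, one_mul]
            exact_mod_cast Nat.mul_le_mul_left _ (frozenFactorial_le_of_lt hm₂ hlt)
      · simp only [h0, h1, if_false, or_self]
        exact ⟨rfl, rfl, rfl, rfl, 0, 0, by simp [natTriple], by simp [natTriple], by simp,
          dvd_zero _⟩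
  | inv s ih =>
    obtain ⟨e1, e2, e3, e4, X, Y, hX, hX', hB, hY⟩ := ih ((le_inv_code s).trans hu)
    simp only [stageVal, boundVal, Ops.fold_inv] at e1 e2 e3 e4 hX hX' hB ⊢
    refine ⟨e3, e4, e1, e2, -X, -Y, ?_, ?_, ?_, (dvd_neg).2 hY⟩
    · change -((tripleOps N).fold _ s).2.1 = _
      rw [hX]; ring
    · change -((tripleOps N).fold _ s).2.1 = _
      rw [hX']; ring
    · simpa [boundOps] using hB
  | mul s s' ihs iht =>
    obtain ⟨e1, e2, e3, e4, X, Y, hX, hX', hB, hY⟩ := ihs ((le_mul_code_left s s').trans hu)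
    obtain ⟨f1, f2, f3, f4, Z, W, hZ, hZ', hD, hW⟩ := iht ((le_mul_code_right s s').trans hu)
    simp only [stageVal, boundVal, Ops.fold_mul] at e1 e2 e3 e4 f1 f2 f3 f4 hX hX' hB hZ hZ' hD ⊢
    generalize (boundOps N).fold boundGen s = b at *
    generalize (boundOps N).fold boundGen s' = b' at *
    generalize (tripleOps N).fold _ s = w at *
    generalize (tripleOps N).fold _ s' = w' at *
    generalize (tripleOps N).fold _ s = z at *
    generalize (tripleOps N).fold _ s' = z' at *
    refine ⟨?_, ?_, ?_, ?_, N ^ (b'.1 - b.2.2) * X + N ^ (b.2.2 - b'.1) * Z,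
      N ^ (b'.1 - b.2.2) * Y + N ^ (b.2.2 - b'.1) * W, ?_, ?_, ?_,
      (hY.mul_left _).add (hW.mul_left _)⟩
    · simp only [tripleOps, boundOps, e1, f1, e3]
    · simp only [tripleOps, boundOps, e2, f2, e4]
    · simp only [tripleOps, boundOps, f1, f3, e3]
    · simp only [tripleOps, boundOps, f2, f4, e4]
    · simp only [tripleOps, e3, f1, hX, hZ]; ring
    · simp only [tripleOps, e4, f2, hX', hZ']; ring
    · refine (abs_add_le _ _).trans ?_
      rw [abs_mul, abs_mul, abs_pow, abs_pow, Int.abs_eq_natAbs N]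
      simp only [boundOps]
      push_cast
      rw [add_mul, mul_assoc, mul_assoc]
      gcongr

/-- If `Y` is nonzero, then `|Y f|` is at least `P (t + 1)!`, which exceeds `t P t !` and hence
`|X|`, because the coefficient bound `B` is at most `t`. -/
theorem eq_zero_of_decomp {X Y : ℤ} {B P t f : ℕ} (hP : 0 < P) (hB : B ≤ t)
    (hX : |X| ≤ B * (P * t ! : ℕ)) (hY : (P : ℤ) ∣ Y) (hf : (t + 1)! ≤ f) (h : X + Y * f = 0) :
    X = 0 ∧ Y = 0 := by
  have hY0 : Y = 0 := by
    by_contra hne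
    obtain ⟨y, rfl⟩ := hY
    have hy : 1 ≤ |y| := Int.one_le_abs (by rintro rfl; simp at hne)
    have h1 : |X| = P * |y| * f := by
      rw [eq_neg_of_add_eq_zero_left h, abs_neg, abs_mul, abs_mul, Nat.abs_cast, Nat.abs_cast]
    have h2 : (B * (P * t !) : ℕ) < P * f := by
      calc B * (P * t !) ≤ t * (P * t !) := Nat.mul_le_mul_right _ hB
        _ < (t + 1) * (P * t !) := by
          apply Nat.mul_lt_mul_of_pos_right (Nat.lt_succ_self t)
          exact Nat.mul_pos hP (Nat.factorial_pos t)
        _ = P * (t + 1)! := by rw [Nat.factorial_succ]; ring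
        _ ≤ P * f := Nat.mul_le_mul_left _ hf
    have h3 : (P : ℤ) * f ≤ P * |y| * f := by
      have : (0 : ℤ) ≤ P * f := by positivity
      nlinarith
    have h4 : ((B * (P * t !) : ℕ) : ℤ) < ((P * f : ℕ) : ℤ) := by exact_mod_cast h2
    push_cast at h4 hX
    linarith
  subst hY0
  exact ⟨by simpa using h, rfl⟩

/-- The stage from which on it is decided whether a name denotes the identity. -/
def decisionStage (N : ℤ) (u : ℕ) : ℕ := u + (boundVal N u).2.1

/-- At both stages the exponent vanishes only if `X = Y = 0`, and this condition does not mention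
the stage at which the factorial is taken. -/
theorem stageVal_succ (hm₁ : Monotone h₁) (hm₂ : Monotone h₂) {t u : ℕ}
    (ht : decisionStage N u ≤ t) :
    (stageVal N h₁ h₂ (t + 1) u).1 = (stageVal N h₁ h₂ t u).1 ∧
      (stageVal N h₁ h₂ (t + 1) u).2.2 = (stageVal N h₁ h₂ t u).2.2 ∧
      ((stageVal N h₁ h₂ (t + 1) u).2.1 = 0 ↔ (stageVal N h₁ h₂ t u).2.1 = 0) := by
  rw [decisionStage] at ht
  obtain ⟨e1, e2, e3, e4, X, Y, hX, hX', hB, hY⟩ :=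
    stageDecomp (N := N) hm₁ hm₂ (show u ≤ t by omega)
  refine ⟨e2.trans e1.symm, e4.trans e3.symm, ?_⟩
  have hp : 0 < rootPrime N := Nat.succ_pos _
  have hroot : ((rootPrime N : ℤ) ^ (h₁ (t + 1) - h₁ t)) ≠ 0 := by positivity
  have key : ∀ f : ℕ, (t + 1)! ≤ f → X + Y * f = 0 → X = 0 ∧ Y = 0 := fun f hf h =>
    eq_zero_of_decomp (B := (boundVal N u).2.1) (P := rootPrime N ^ h₁ t) (by positivity)
      (by omega) (by push_cast; exact hB) (by push_cast; exact hY) hf h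
  rw [hX', hX]
  constructor
  · intro h
    replace h := (mul_eq_zero.1 h).resolve_left hroot
    have : X = 0 ∧ Y = 0 := by
      split_ifs at h
      · exact key _ (Nat.factorial_le (by omega)) h
      · exact key _ le_rfl h
    simp [this.1, this.2]
  · intro h
    have := key _ le_rfl h
    simp [this.1, this.2]

theorem stageVal_of_le (hm₁ : Monotone h₁) (hm₂ : Monotone h₂) {t u : ℕ}
    (ht : decisionStage N u ≤ t) :
    (stageVal N h₁ h₂ t u).1 = (stageVal N h₁ h₂ (decisionStage N u) u).1 ∧
      (stageVal N h₁ h₂ t u).2.2 = (stageVal N h₁ h₂ (decisionStage N u) u).2.2 ∧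
      ((stageVal N h₁ h₂ t u).2.1 = 0 ↔
        (stageVal N h₁ h₂ (decisionStage N u) u).2.1 = 0) := by
  induction t, ht using Nat.le_induction with
  | base => exact ⟨rfl, rfl, Iff.rfl⟩
  | succ t ht ih =>
    obtain ⟨h1, h2, h3⟩ := stageVal_succ (N := N) hm₁ hm₂ ht
    exact ⟨h1.trans ih.1, h2.trans ih.2.1, h3.trans ih.2.2⟩

end Approx

/-! ### The group of names -/

/-- The subgroup of values of names. -/
def Ops.Hom.range {T G : Type*} [Group G] {A : Ops T} {f : T → G} (h : A.Hom (groupOps G) f) :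
    Subgroup G where
  carrier := Set.range f
  one_mem' := ⟨A.one, h.one⟩
  mul_mem' := by
    rintro _ _ ⟨s, rfl⟩ ⟨t, rfl⟩
    exact ⟨A.mul s t, h.mul s t⟩
  inv_mem' := by
    rintro _ ⟨s, rfl⟩
    exact ⟨A.inv s, h.inv s⟩

-- Divisibility of exponents in normal forms

section Triple

variable {G H : Type*} [Group G] [Group H] {N : ℤ} {P : Prop} {Q : ℕ → ℤ → ℤ → Prop} {a b : G}

theorem map_triple (f : G →* H) (a b : G) (u : ℕ × ℤ × ℕ) :
    f (triple a b u) = triple (f a) (f b) u := by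
  simp [triple]

theorem IsBasisLike.map {x y : G} (h : IsBasisLike N P Q x y) (e : G ≃* H) :
    IsBasisLike N P Q (e x) (e y) where
  rel := by simpa using congrArg e h.rel
  triv hP := by rw [h.triv hP, map_one]
  noroot p k l hQ z hz := h.noroot p k l hQ (e.symm z) (by
    simpa using congrArg e.symm hz)

theorem NormalForm.zpow_injective (h : NormalForm N P a b) :
    Function.Injective fun r : ℤ => a ^ r := by
  intro r s hrs
  have := (h.inj (0, r - s, 0) (by
    simp only [triple, pow_zero, one_mul, mul_one, zpow_sub]
    exact mul_inv_eq_one.2 hrs)).1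
  exact sub_eq_zero.1 this

/-- The elements `b^{-M} a^r b^K` with `r` divisible by `d`. -/
def divisibleTriples (h : b * a = a ^ N * b) (d : ℤ) : Subgroup G where
  carrier := {g | ∃ u, d ∣ u.2.1 ∧ g = triple a b u}
  one_mem' := ⟨_, dvd_zero _, ((triple_hom h).one).symm⟩
  mul_mem' := by
    rintro _ _ ⟨u, hu, rfl⟩ ⟨v, hv, rfl⟩
    exact ⟨_, (hu.mul_left _).add (hv.mul_left _), ((triple_hom h).mul u v).symm⟩
  inv_mem' := by
    rintro _ ⟨u, hu, rfl⟩
    exact ⟨_, (dvd_neg).2 hu, ((triple_hom h).inv u).symm⟩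

theorem triple_mem {S : Subgroup G} (ha : a ∈ S) (hb : b ∈ S) (u : ℕ × ℤ × ℕ) :
    triple a b u ∈ S :=
  S.mul_mem (S.mul_mem (S.pow_mem (S.inv_mem hb) _) (S.zpow_mem ha _)) (S.pow_mem hb _)

/-- Comparing `a ^ r` with `b^{-M} a^s b^K` by uniqueness of normal forms gives `N ^ K * r = s`, and
`d` is coprime to `N`. -/
theorem NormalForm.dvd_of_mem_divisibleTriples (h : NormalForm N P a b) {d : ℤ}
    (hd : IsCoprime d N) {r : ℤ} (hr : a ^ r ∈ divisibleTriples h.rel d) : d ∣ r := by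
  obtain ⟨⟨M, s, K⟩, hs, hu⟩ := hr
  have h1 := (triple_hom h.rel).mul (0, r, 0) ((tripleOps N).inv (M, s, K))
  rw [(triple_hom h.rel).inv, ← hu] at h1
  have h2 : triple a b (0, r, 0) = a ^ r := by simp [triple]
  rw [h2] at h1
  have h3 := (h.inj _ (h1.trans (mul_inv_cancel _))).1
  simp only [tripleOps, Nat.sub_zero, Nat.zero_sub, pow_zero, one_mul] at h3
  have h4 : d ∣ N ^ K * r := by
    rw [eq_neg_of_add_eq_zero_left h3, neg_neg]
    exact hs
  exact (hd.pow_right).dvd_of_dvd_mul_left h4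

end Triple

-- Germs of sequences, and the isomorphism type of the named group

section Names

open Filter

variable {G : Type*} [Group G] {N : ℤ} {P : Prop} {Q : ℕ → ℤ → ℤ → Prop} {a b : G} {h₁ h₂ : ℕ → ℕ}

/-- The germ of the values of a name. -/
def nameVal (N : ℤ) (h₁ h₂ : ℕ → ℕ) (a b : G) (u : ℕ) : Germ (atTop : Filter ℕ) G :=
  Germ.coeMulHom atTop fun t => triple a b (stageVal N h₁ h₂ t u)

theorem nameVal_hom (h : b * a = a ^ N * b) (h₁ h₂ : ℕ → ℕ) :
    codeOps.Hom (groupOps (Germ (atTop : Filter ℕ) G)) (nameVal N h₁ h₂ a b) where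
  one := by
    simp only [nameVal, stageVal, Ops.fold_one, (triple_hom h).one]
    exact map_one (Germ.coeMulHom _)
  inv s := by
    simp only [nameVal, stageVal, Ops.fold_inv, (triple_hom h).inv]
    exact map_inv (Germ.coeMulHom _) _
  mul s t := by
    simp only [nameVal, stageVal, Ops.fold_mul, (triple_hom h).mul]
    exact map_mul (Germ.coeMulHom _) _ _

theorem coeMulHom_eq_iff {f g : ℕ → G} :
    Germ.coeMulHom atTop f = Germ.coeMulHom atTop g ↔ ∀ᶠ t in atTop, f t = g t := Germ.coe_eq

theorem nameVal_eq_one_iff (h : NormalForm N P a b) (hm₁ : Monotone h₁) (hm₂ : Monotone h₂)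
    (u : ℕ) : nameVal N h₁ h₂ a b u = 1 ↔ (stageVal N h₁ h₂ (decisionStage N u) u).2.1 = 0 ∧
      (P → (stageVal N h₁ h₂ (decisionStage N u) u).1 =
        (stageVal N h₁ h₂ (decisionStage N u) u).2.2) := by
  have key : ∀ t, decisionStage N u ≤ t → (triple a b (stageVal N h₁ h₂ t u) = 1 ↔
      (stageVal N h₁ h₂ (decisionStage N u) u).2.1 = 0 ∧
      (P → (stageVal N h₁ h₂ (decisionStage N u) u).1 =
        (stageVal N h₁ h₂ (decisionStage N u) u).2.2)) := by
    intro t ht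
    obtain ⟨e1, e2, e3⟩ := stageVal_of_le (N := N) hm₁ hm₂ ht
    rw [h.triple_eq_one, e1, e2, e3]
  rw [nameVal, ← map_one (Germ.coeMulHom (atTop : Filter ℕ)), coeMulHom_eq_iff]
  constructor
  · intro hev
    obtain ⟨t, ht, ht'⟩ := (hev.and (eventually_ge_atTop (decisionStage N u))).exists
    exact (key t ht').1 ht
  · intro hu
    filter_upwards [eventually_ge_atTop (decisionStage N u)] with t ht
    exact (key t ht).2 hu

/-- The group of all values of names. -/
abbrev NamedGroup (h : b * a = a ^ N * b) (h₁ h₂ : ℕ → ℕ) : Type _ := (nameVal_hom h h₁ h₂).range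

def namedElt (h : b * a = a ^ N * b) (h₁ h₂ : ℕ → ℕ) (u : ℕ) : NamedGroup h h₁ h₂ :=
  ⟨nameVal N h₁ h₂ a b u, u, rfl⟩

theorem namedElt_surjective (h : b * a = a ^ N * b) (h₁ h₂ : ℕ → ℕ) :
    (namedElt h h₁ h₂).Surjective := by
  rintro ⟨_, u, rfl⟩
  exact ⟨u, rfl⟩

theorem namedElt_hom (h : b * a = a ^ N * b) (h₁ h₂ : ℕ → ℕ) :
    codeOps.Hom (groupOps (NamedGroup h h₁ h₂)) (namedElt h h₁ h₂) where
  one := Subtype.ext (nameVal_hom h h₁ h₂).one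
  inv s := Subtype.ext ((nameVal_hom h h₁ h₂).inv s)
  mul s t := Subtype.ext ((nameVal_hom h h₁ h₂).mul s t)

/-- The embedding of constant sequences. -/
def constGerm (g : G) : Germ (atTop : Filter ℕ) G := Germ.coeMulHom atTop fun _ => g

theorem constGerm_triple (a b : G) (u : ℕ × ℤ × ℕ) :
    triple (constGerm a) (constGerm b) u = constGerm (triple a b u) := by
  have := map_triple (Germ.coeMulHom (atTop : Filter ℕ)) (fun _ => a) (fun _ => b) u
  rw [constGerm, constGerm, ← this, constGerm]
  refine congrArg _ (funext fun t => ?_)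
  exact map_triple (Pi.evalMonoidHom (fun _ : ℕ => G) t) (fun _ => a) (fun _ => b) u

/-- If the first counter is bounded, then the named group contains the constant generators. -/
theorem exists_const_namedElt (h : b * a = a ^ N * b) (h₂ : ℕ → ℕ)
    (hb : ∃ B, ∀ t, h₁ t ≤ B) :
    ∃ x y : NamedGroup h h₁ h₂, (x : Germ (atTop : Filter ℕ) G) = constGerm a ∧
      (y : Germ (atTop : Filter ℕ) G) = constGerm b := by
  obtain ⟨q, hq⟩ := exists_max_of_monotone hb
  -- At the stage `q` where the first counter is maximal, the root exponent is `0` from then on, so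
  -- the generator is eventually `a`. The tag `5` is unused by terms, hence an atom, and atoms with
  -- tags other than `0` and `1` stand for `b`.
  refine ⟨namedElt h h₁ h₂ (Nat.pair 0 q), namedElt h h₁ h₂ (Nat.pair 5 0), ?_, ?_⟩
  · refine coeMulHom_eq_iff.2 ?_
    filter_upwards [eventually_ge_atTop q] with t ht
    have h1 : h₁ t - h₁ q = 0 := by have := hq t; omega
    simp [stageVal, Ops.fold_atom _ _ (isAtomCode_pair_zero q), genVal, natTriple, triple, h1]
  · have h5 : IsAtomCode (Nat.pair 5 0) := by simp [IsAtomCode, codeOps]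
    refine coeMulHom_eq_iff.2 (Eventually.of_forall fun t => ?_)
    simp [stageVal, Ops.fold_atom _ _ h5, genVal, natTriple, triple]

theorem coe_triple_of_const {S : Subgroup (Germ (atTop : Filter ℕ) G)} {x y : S}
    (hx : (x : Germ (atTop : Filter ℕ) G) = constGerm a)
    (hy : (y : Germ (atTop : Filter ℕ) G) = constGerm b) (u : ℕ × ℤ × ℕ) :
    ((triple x y u : S) : Germ (atTop : Filter ℕ) G) = constGerm (triple a b u) := by
  have := map_triple S.subtype x y u
  simp only [Subgroup.subtype_apply] at this
  rw [this, hx, hy, constGerm_triple]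

/-- Relations between constants hold pointwise. A germ solving a forbidden equation would solve it
in `G` at some stage. -/
theorem isBasisLike_of_const (h : IsBasisLike N P Q a b)
    {S : Subgroup (Germ (atTop : Filter ℕ) G)}
    {x y : S} (hx : (x : Germ (atTop : Filter ℕ) G) = constGerm a)
    (hy : (y : Germ (atTop : Filter ℕ) G) = constGerm b) : IsBasisLike N P Q x y := by
  refine ⟨Subtype.ext ?_, fun hP => Subtype.ext ?_, fun p k l hQ z hz => ?_⟩
  · push_cast
    rw [hx, hy, constGerm, constGerm, ← map_mul, ← map_zpow, ← map_mul]
    exact congrArg _ (funext fun _ => h.rel)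
  · rw [hy, h.triv hP]
    exact map_one (Germ.coeMulHom _)
  · have h1 := congrArg (Subtype.val) hz
    push_cast at h1
    rw [hx, hy] at h1
    obtain ⟨z, hz'⟩ := z
    induction z using Germ.inductionOn with
    | _ f =>
      have h2 : Germ.coeMulHom (atTop : Filter ℕ) (f ^ p) =
          Germ.coeMulHom (atTop : Filter ℕ) ((fun _ => a) ^ k * (fun _ => b) ^ l) := by
        rw [map_pow, map_mul, map_zpow, map_zpow]
        exact h1
      obtain ⟨t, ht⟩ := (coeMulHom_eq_iff.1 h2).exists
      exact h.noroot p k l hQ (f t) ht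

/-- If the first counter is bounded and the second one is not, then names have eventually constant
values. -/
theorem eventually_stageVal_const (N : ℤ) (hm₁ : Monotone h₁) (hm₂ : Monotone h₂)
    (hb₁ : ∃ B, ∀ t, h₁ t ≤ B) (hb₂ : ¬ ∃ B, ∀ t, h₂ t ≤ B) (u : ℕ) :
    ∃ v, ∀ᶠ t in atTop, stageVal N h₁ h₂ t u = v := by
  obtain ⟨B, hB⟩ := exists_max_of_monotone hb₁
  have hconst : ∀ t, B ≤ t → h₁ t = h₁ B := fun t ht => le_antisymm (hB t) (hm₁ ht)
  induction u using code_induction with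
  | one => exact ⟨_, Eventually.of_forall fun t => by rw [stageVal, Ops.fold_one]⟩
  | inv s ih =>
    obtain ⟨v, hv⟩ := ih
    refine ⟨(tripleOps N).inv v, hv.mono fun t ht => ?_⟩
    rw [← ht, stageVal, Ops.fold_inv, stageVal]
  | mul s s' ihs iht =>
    obtain ⟨v, hv⟩ := ihs
    obtain ⟨w, hw⟩ := iht
    refine ⟨(tripleOps N).mul v w, (hv.and hw).mono fun t ht => ?_⟩
    rw [← ht.1, ← ht.2, stageVal, Ops.fold_mul, stageVal, stageVal]
  | atom k hk =>
    push Not at hb₂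
    obtain ⟨c, hc⟩ := hb₂ (h₂ k.unpair.2)
    -- From stage `c` on, the second counter exceeds its value at the index of the generator, so the
    -- factor no longer changes.
    have hfr : ∀ t, c ≤ t → frozenFactorial h₂ k.unpair.2 t = frozenFactorial h₂ k.unpair.2 c := by
      intro t ht
      induction t, ht using Nat.le_induction with
      | base => rfl
      | succ t ht ih =>
        rw [frozenFactorial_succ, if_neg, ih]
        exact not_le.2 (hc.trans_le (hm₂ (ht.trans (Nat.le_succ t))))
    refine ⟨stageVal N h₁ h₂ (max B c) k, ?_⟩
    filter_upwards [eventually_ge_atTop (max B c)] with t ht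
    rw [stageVal, stageVal, Ops.fold_atom _ _ hk, Ops.fold_atom _ _ hk, genVal, genVal,
      hconst t ((le_max_left _ _).trans ht), hconst _ (le_max_left _ _),
      hfr t ((le_max_right _ _).trans ht), hfr _ (le_max_right _ _)]

/-- The constant pair satisfies the axioms, and every name is eventually a fixed triple, so the pair
generates and the normal form identifies the group. -/
theorem ScottPair.nonempty_mulEquiv_namedGroup (h : ScottPair G N P Q a b)
    (hm₁ : Monotone h₁) (hm₂ : Monotone h₂) (hb₁ : ∃ B, ∀ t, h₁ t ≤ B)
    (hb₂ : ¬ ∃ B, ∀ t, h₂ t ≤ B) : Nonempty (NamedGroup h.nf.rel h₁ h₂ ≃* G) := by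
  obtain ⟨x, y, hx, hy⟩ := exists_const_namedElt h.nf.rel h₂ hb₁
  refine (h.normalForm (isBasisLike_of_const h.basis hx hy) fun z => ?_).nonempty_mulEquiv h.nf
  obtain ⟨_, u, rfl⟩ := z
  obtain ⟨v, hv⟩ := eventually_stageVal_const N hm₁ hm₂ hb₁ hb₂ u
  refine ⟨v, Subtype.ext ?_⟩
  rw [coe_triple_of_const hx hy]
  exact coeMulHom_eq_iff.2 (hv.mono fun t ht => by rw [ht])

-- Under an isomorphism the constant pair would be basis-like in `G`, hence generate by rigidity.
-- Everything would then be an eventually constant sequence, but the generator whose index maximises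
-- the second counter has strictly increasing exponents.
open Nat in
theorem ScottPair.isEmpty_mulEquiv_namedGroup_of_bounded (h : ScottPair G N P Q a b)
    (hm₁ : Monotone h₁) (hb₁ : ∃ B, ∀ t, h₁ t ≤ B)
    (hb₂ : ∃ B, ∀ t, h₂ t ≤ B) : IsEmpty (NamedGroup h.nf.rel h₁ h₂ ≃* G) := by
  refine ⟨fun e => ?_⟩
  obtain ⟨x, y, hx, hy⟩ := exists_const_namedElt h.nf.rel h₂ hb₁
  obtain ⟨q, hq⟩ := exists_max_of_monotone hb₂
  have hcode : IsAtomCode (Nat.pair 1 q) := by simp [IsAtomCode, codeOps]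
  obtain ⟨u, hu⟩ := h.gen ((isBasisLike_of_const h.basis hx hy).map e)
    (e (namedElt h.nf.rel h₁ h₂ (Nat.pair 1 q)))
  have hu' : namedElt h.nf.rel h₁ h₂ (Nat.pair 1 q) = triple x y u :=
    e.injective (hu.trans (map_triple e.toMonoidHom x y u).symm)
  have h1 := congrArg Subtype.val hu'
  rw [coe_triple_of_const hx hy] at h1
  have h2 : ∀ᶠ t in atTop,
      a ^ ((rootPrime N ^ h₁ t * (t + 1)! : ℕ) : ℤ) = triple a b u := by
    refine (coeMulHom_eq_iff.1 h1).mono fun t ht => ?_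
    rw [← ht]
    simp [stageVal, Ops.fold_atom _ _ hcode, genVal, natTriple, triple,
      frozenFactorial_of_le (hq t)]
  obtain ⟨t, ht⟩ := eventually_atTop.1 h2
  have h3 := h.nf.zpow_injective ((ht t le_rfl).trans (ht (t + 1) (Nat.le_succ t)).symm)
  have h4 : rootPrime N ^ h₁ t * (t + 1)! = rootPrime N ^ h₁ (t + 1) * (t + 2)! := by
    exact_mod_cast h3
  have hp : 0 < rootPrime N := Nat.succ_pos _
  have h5 : rootPrime N ^ h₁ t * (t + 1)! < rootPrime N ^ h₁ (t + 1) * (t + 2)! :=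
    Nat.mul_lt_mul_of_le_of_lt (Nat.pow_le_pow_right hp (hm₁ (Nat.le_succ t)))
      (Nat.factorial_lt (Nat.succ_pos t) |>.2 (Nat.lt_succ_self _)) (by positivity)
  exact h5.ne h4

/-- At a late stage, the values of early names are divisible by a high power. -/
theorem dvd_stageVal (N : ℤ) (hm₁ : Monotone h₁) {m u : ℕ} (hu : u ≤ m) (t : ℕ) :
    (rootPrime N : ℤ) ^ (h₁ t - h₁ m) ∣ (stageVal N h₁ h₂ t u).2.1 := by
  induction u using code_induction with
  | one =>
    rw [stageVal, Ops.fold_one]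
    exact dvd_zero _
  | inv s ih =>
    rw [stageVal, Ops.fold_inv]
    exact (dvd_neg).2 (ih ((le_inv_code s).trans hu))
  | mul s s' ihs iht =>
    rw [stageVal, Ops.fold_mul]
    exact ((ihs ((le_mul_code_left s s').trans hu)).mul_left _).add
      ((iht ((le_mul_code_right s s').trans hu)).mul_left _)
  | atom k hk =>
    rw [stageVal, Ops.fold_atom _ _ hk, genVal, natTriple]
    have hq := hm₁ ((Nat.unpair_right_le k).trans hu)
    split_ifs
    · push_cast
      exact pow_dvd_pow _ (by omega)
    · push_cast
      exact (pow_dvd_pow _ (Nat.sub_le _ _)).mul_right _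
    · exact dvd_zero _

/-- Suppose the preimages of `a` and `b` have names `s` and `s'`. All words in them have exponents
divisible by a power of `rootPrime N` fixed by `max s s'`, while a root introduced later has a
smaller exponent of that power. -/
theorem ScottPair.isEmpty_mulEquiv_namedGroup_of_unbounded (h : ScottPair G N P Q a b)
    (hm₁ : Monotone h₁) (hb₁ : ¬ ∃ B, ∀ t, h₁ t ≤ B) :
    IsEmpty (NamedGroup h.nf.rel h₁ h₂ ≃* G) := by
  refine ⟨fun e => ?_⟩
  obtain ⟨s, hs⟩ := namedElt_surjective h.nf.rel h₁ h₂ (e.symm a)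
  obtain ⟨s', hs'⟩ := namedElt_surjective h.nf.rel h₁ h₂ (e.symm b)
  push Not at hb₁
  obtain ⟨q, hq⟩ := hb₁ (h₁ (max s s'))
  obtain ⟨u, hu⟩ := h.nf.gen (e (namedElt h.nf.rel h₁ h₂ (Nat.pair 0 q)))
  have hu' : namedElt h.nf.rel h₁ h₂ (Nat.pair 0 q) =
      triple (namedElt h.nf.rel h₁ h₂ s) (namedElt h.nf.rel h₁ h₂ s') u := by
    rw [hs, hs']
    exact ((e.symm_apply_apply _).symm.trans (congrArg e.symm hu)).trans
      (map_triple e.symm.toMonoidHom a b u)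
  have h1 := congrArg Subtype.val hu'
  have h2 := map_triple (Subgroup.subtype _) (namedElt h.nf.rel h₁ h₂ s)
    (namedElt h.nf.rel h₁ h₂ s') u
  have h3 := h1.trans h2
  simp only [Subgroup.subtype_apply, namedElt, nameVal] at h3
  rw [← map_triple, coeMulHom_eq_iff] at h3
  -- A single stage `t ≥ q` suffices, so the argument takes place in `G`; `t ≥ q` keeps the
  -- subtraction of counters from truncating.
  obtain ⟨t, ht, htq⟩ := (h3.and (eventually_ge_atTop q)).exists
  have h4 := map_triple (Pi.evalMonoidHom (fun _ : ℕ => G) t)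
    (fun t => triple a b (stageVal N h₁ h₂ t s)) (fun t => triple a b (stageVal N h₁ h₂ t s')) u
  simp only [Pi.evalMonoidHom_apply] at h4
  rw [h4] at ht
  have hq' := hm₁ htq
  have hcop : IsCoprime (rootPrime N : ℤ) N := by
    rw [Int.isCoprime_iff_gcd_eq_one, Int.gcd, Int.natAbs_natCast, rootPrime]
    simp
  have h5 : a ^ ((rootPrime N : ℤ) ^ (h₁ t - h₁ q)) ∈
      divisibleTriples h.nf.rel ((rootPrime N : ℤ) ^ (h₁ t - h₁ (max s s'))) := by
    have h6 : a ^ ((rootPrime N : ℤ) ^ (h₁ t - h₁ q)) =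
        triple a b (stageVal N h₁ h₂ t (Nat.pair 0 q)) := by
      simp [stageVal, Ops.fold_atom _ _ (isAtomCode_pair_zero q), genVal, natTriple, triple]
    rw [h6, ht]
    have hmem : ∀ v ≤ max s s', triple a b (stageVal N h₁ h₂ t v) ∈
        divisibleTriples h.nf.rel ((rootPrime N : ℤ) ^ (h₁ t - h₁ (max s s'))) :=
      fun v hv => ⟨_, dvd_stageVal N hm₁ hv t, rfl⟩
    exact triple_mem (hmem s (le_max_left _ _)) (hmem s' (le_max_right _ _)) u
  have h7 := h.nf.dvd_of_mem_divisibleTriples hcop.pow_left h5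
  have h8 : 1 < rootPrime N := by
    have := Int.natAbs_pos.2 h.ne_zero
    simp only [rootPrime]
    omega
  have h9 := Int.natCast_dvd_natCast.1 (by push_cast; exact h7 :
    ((rootPrime N ^ (h₁ t - h₁ (max s s')) : ℕ) : ℤ) ∣ ((rootPrime N ^ (h₁ t - h₁ q) : ℕ) : ℤ))
  have := (Nat.pow_dvd_pow_iff_le_right h8).1 h9
  omega

theorem ScottPair.nonempty_mulEquiv_namedGroup_iff (h : ScottPair G N P Q a b)
    (hm₁ : Monotone h₁) (hm₂ : Monotone h₂) : Nonempty (NamedGroup h.nf.rel h₁ h₂ ≃* G) ↔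
      (∃ B, ∀ t, h₁ t ≤ B) ∧ ¬ ∃ B, ∀ t, h₂ t ≤ B := by
  refine ⟨fun he => ?_, fun hb => h.nonempty_mulEquiv_namedGroup hm₁ hm₂ hb.1 hb.2⟩
  by_contra hb
  rw [← not_isEmpty_iff] at he
  by_cases hb₁ : ∃ B, ∀ t, h₁ t ≤ B
  · exact he (h.isEmpty_mulEquiv_namedGroup_of_bounded hm₁ hb₁
      (not_not.1 fun hb₂ => hb ⟨hb₁, hb₂⟩))
  · exact he (h.isEmpty_mulEquiv_namedGroup_of_unbounded hm₁ hb₁)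

end Names

/-! ### Deciding the word problem -/

-- Computable arithmetic on natural numbers

section Arithmetic

variable {α : Type*} [Primcodable α]

theorem _root_.Computable.nat_add' {f g : α → ℕ} (hf : Computable f) (hg : Computable g) :
    Computable fun a => f a + g a := Primrec.nat_add.to_comp.comp hf hg

theorem _root_.Computable.nat_sub' {f g : α → ℕ} (hf : Computable f) (hg : Computable g) :
    Computable fun a => f a - g a := Primrec.nat_sub.to_comp.comp hf hg

theorem _root_.Computable.nat_mul' {f g : α → ℕ} (hf : Computable f) (hg : Computable g) :
    Computable fun a => f a * g a := Primrec.nat_mul.to_comp.comp hf hg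

theorem _root_.Computable.const_pow (c : ℕ) {g : α → ℕ} (hg : Computable g) :
    Computable fun a => c ^ g a :=
  (Computable.nat_rec (h := fun _ (q : ℕ × ℕ) => q.2 * c) hg (Computable.const 1)
    (Computable.nat_mul' (Computable.snd.comp Computable.snd) (Computable.const c)).to₂).of_eq
    fun a => by
      induction g a with
      | zero => rfl
      | succ n ih => rw [pow_succ, ← ih]

open Nat in
theorem _root_.Computable.factorial {g : α → ℕ} (hg : Computable g) :
    Computable fun a => (g a)! :=
  (Computable.nat_rec (h := fun _ (q : ℕ × ℕ) => (q.1 + 1) * q.2) hg (Computable.const 1)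
    (Computable.nat_mul' (Computable.succ.comp (Computable.fst.comp Computable.snd))
      (Computable.snd.comp Computable.snd)).to₂).of_eq
    fun a => by
      induction g a with
      | zero => rfl
      | succ n ih => rw [Nat.factorial_succ, ← ih]

end Arithmetic

/-! #### Integers as differences of natural numbers -/

def diff (x : ℕ × ℕ) : ℤ := x.1 - x.2

def diffAdd (x y : ℕ × ℕ) : ℕ × ℕ := (x.1 + y.1, x.2 + y.2)

def diffMul (x y : ℕ × ℕ) : ℕ × ℕ := (x.1 * y.1 + x.2 * y.2, x.1 * y.2 + x.2 * y.1)

def diffPow (N : ℤ) (e : ℕ) : ℕ × ℕ :=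
  Nat.rec (1, 0) (fun _ r => diffMul (N.toNat, (-N).toNat) r) e

theorem diff_add (x y : ℕ × ℕ) : diff (diffAdd x y) = diff x + diff y := by
  simp only [diff, diffAdd]; push_cast; ring

theorem diff_mul (x y : ℕ × ℕ) : diff (diffMul x y) = diff x * diff y := by
  simp only [diff, diffMul]; push_cast; ring

theorem diff_pow (N : ℤ) (e : ℕ) : diff (diffPow N e) = N ^ e := by
  induction e with
  | zero => simp [diff, diffPow]
  | succ e ih =>
    have h : diffPow N (e + 1) = diffMul (N.toNat, (-N).toNat) (diffPow N e) := rfl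
    have h' : diff (N.toNat, (-N).toNat) = N := Int.toNat_sub_toNat_neg N
    rw [h, diff_mul, ih, h', pow_succ']

theorem diff_eq_zero_iff (x : ℕ × ℕ) : diff x = 0 ↔ x.1 = x.2 := by
  rw [diff]; omega

/-- The operations on triples, with integers represented by differences. -/
def diffOps (N : ℤ) : Ops (ℕ × (ℕ × ℕ) × ℕ) where
  one := (0, (0, 0), 0)
  inv u := (u.2.2, u.2.1.swap, u.1)
  mul u v := (u.1 + (v.1 - u.2.2),
    diffAdd (diffMul (diffPow N (v.1 - u.2.2)) u.2.1) (diffMul (diffPow N (u.2.2 - v.1)) v.2.1),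
    (u.2.2 - v.1) + v.2.2)

def diffTriple (u : ℕ × (ℕ × ℕ) × ℕ) : ℕ × ℤ × ℕ := (u.1, diff u.2.1, u.2.2)

theorem diffTriple_hom (N : ℤ) : (diffOps N).Hom (tripleOps N) diffTriple where
  one := rfl
  inv u := by simp [diffTriple, diffOps, tripleOps, diff]
  mul u v := by simp [diffTriple, diffOps, tripleOps, diff_add, diff_mul, diff_pow]

section Arithmetic

variable {α : Type*} [Primcodable α]

theorem computable_diffAdd {f g : α → ℕ × ℕ} (hf : Computable f) (hg : Computable g) :
    Computable fun a => diffAdd (f a) (g a) :=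
  (Computable.nat_add' (Computable.fst.comp hf) (Computable.fst.comp hg)).pair
    (Computable.nat_add' (Computable.snd.comp hf) (Computable.snd.comp hg))

theorem computable_diffMul {f g : α → ℕ × ℕ} (hf : Computable f) (hg : Computable g) :
    Computable fun a => diffMul (f a) (g a) := by
  have f1 := Computable.fst.comp hf
  have f2 := Computable.snd.comp hf
  have g1 := Computable.fst.comp hg
  have g2 := Computable.snd.comp hg
  exact (Computable.nat_add' (Computable.nat_mul' f1 g1) (Computable.nat_mul' f2 g2)).pair
    (Computable.nat_add' (Computable.nat_mul' f1 g2) (Computable.nat_mul' f2 g1))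

theorem computable_diffPow (N : ℤ) {g : α → ℕ} (hg : Computable g) :
    Computable fun a => diffPow N (g a) :=
  Computable.nat_rec (h := fun _ (q : ℕ × ℕ × ℕ) => diffMul (N.toNat, (-N).toNat) q.2) hg
    (Computable.const (1, 0))
    (computable_diffMul (Computable.const _) (Computable.snd.comp Computable.snd)).to₂

end Arithmetic

theorem diffOps_isComputable (N : ℤ) : (diffOps N).IsComputable where
  inv := by
    have h2 := Computable.snd (α := ℕ) (β := (ℕ × ℕ) × ℕ)
    have h3 := Computable.fst.comp h2
    exact (Computable.snd.comp h2).pair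
      (((Computable.snd.comp h3).pair (Computable.fst.comp h3)).pair Computable.fst)
  mul := by
    have u := Computable.fst (α := ℕ × (ℕ × ℕ) × ℕ) (β := ℕ × (ℕ × ℕ) × ℕ)
    have v := Computable.snd (α := ℕ × (ℕ × ℕ) × ℕ) (β := ℕ × (ℕ × ℕ) × ℕ)
    have u1 := Computable.fst.comp u
    have u2 := Computable.fst.comp (Computable.snd.comp u)
    have u3 := Computable.snd.comp (Computable.snd.comp u)
    have v1 := Computable.fst.comp v
    have v2 := Computable.fst.comp (Computable.snd.comp v)
    have v3 := Computable.snd.comp (Computable.snd.comp v)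
    have d := Computable.nat_sub' v1 u3
    have d' := Computable.nat_sub' u3 v1
    exact ((Computable.nat_add' u1 d).pair
      ((computable_diffAdd (computable_diffMul (computable_diffPow N d) u2)
        (computable_diffMul (computable_diffPow N d') v2)).pair (Computable.nat_add' d' v3))).to₂

theorem boundOps_isComputable (N : ℤ) : (boundOps N).IsComputable where
  inv := by
    have h2 := Computable.snd (α := ℕ) (β := ℕ × ℕ)
    exact (Computable.snd.comp h2).pair ((Computable.fst.comp h2).pair Computable.fst)
  mul := by
    have u := Computable.fst (α := ℕ × ℕ × ℕ) (β := ℕ × ℕ × ℕ)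
    have v := Computable.snd (α := ℕ × ℕ × ℕ) (β := ℕ × ℕ × ℕ)
    have u1 := Computable.fst.comp u
    have u2 := Computable.fst.comp (Computable.snd.comp u)
    have u3 := Computable.snd.comp (Computable.snd.comp u)
    have v1 := Computable.fst.comp v
    have v2 := Computable.fst.comp (Computable.snd.comp v)
    have v3 := Computable.snd.comp (Computable.snd.comp v)
    have d := Computable.nat_sub' v1 u3
    have d' := Computable.nat_sub' u3 v1
    exact ((Computable.nat_add' u1 d).pair
      ((Computable.nat_add' (Computable.nat_mul' (Computable.const_pow _ d) u2)
        (Computable.nat_mul' (Computable.const_pow _ d') v2)).pair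
        (Computable.nat_add' d' v3))).to₂

theorem computable_decisionStage (N : ℤ) : Computable (decisionStage N) := by
  have hg : Computable boundGen := by
    have h1 := Computable.fst.comp Computable.unpair
    have c := Computable.const (α := ℕ) (0, 1, 0)
    refine (Computable.ite_eq (c := 0) h1 c <| Computable.ite_eq (c := 1) h1 c <|
      Computable.const (0, 0, 1)).of_eq fun k => ?_
    rw [boundGen]
    split_ifs <;> tauto
  have hb : Computable (boundVal N) :=
    ((boundOps_isComputable N).fold (γ := Unit) (g := fun _ k => boundGen k)
      (hg.comp Computable.snd).to₂).comp (Computable.const ()) Computable.id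
  exact Computable.nat_add' Computable.id (Computable.fst.comp (Computable.snd.comp hb))

-- The decision procedure for names

section Decide

variable {h₁ h₂ : ℕ → ℕ → ℕ} (N : ℤ) (P : Bool)

theorem computable_frozenFactorial (hh : Computable₂ h₂) :
    Computable fun p : ℕ × ℕ × ℕ => frozenFactorial (h₂ p.1) p.2.1 p.2.2 := by
  have p := Computable.fst (α := ℕ × ℕ × ℕ) (β := ℕ × ℕ)
  have r := Computable.snd (α := ℕ × ℕ × ℕ) (β := ℕ × ℕ)
  have r1 := Computable.succ.comp (Computable.fst.comp r)
  have x := Computable.fst.comp p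
  have hle := (Primrec.nat_le.decide.to_comp).comp (hh.comp x r1)
    (hh.comp x (Computable.fst.comp (Computable.snd.comp p)))
  have hstep : Computable fun a : (ℕ × ℕ × ℕ) × ℕ × ℕ =>
      if h₂ a.1.1 (a.2.1 + 1) ≤ h₂ a.1.1 a.1.2.1 then (a.2.1 + 2).factorial else a.2.2 :=
    (Computable.ite_true hle (Computable.factorial (Computable.succ.comp r1))
      (Computable.snd.comp r)).of_eq fun a => by simp only [decide_eq_true_eq, Nat.succ_eq_add_one]
  exact (Computable.nat_rec (Computable.snd.comp Computable.snd) (Computable.const 1)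
    hstep.to₂).of_eq fun p => rfl

/-- The value of a name at a stage, computed by natural numbers. -/
def diffVal (h₁ h₂ : ℕ → ℕ) (t u : ℕ) : ℕ × (ℕ × ℕ) × ℕ :=
  (diffOps N).fold (fun k => ((genVal N h₁ h₂ t k).1, ((genVal N h₁ h₂ t k).2.1, 0),
    (genVal N h₁ h₂ t k).2.2)) u

theorem diffTriple_diffVal (h₁ h₂ : ℕ → ℕ) (t u : ℕ) :
    diffTriple (diffVal N h₁ h₂ t u) = stageVal N h₁ h₂ t u := by
  rw [diffVal, (diffTriple_hom N).fold, stageVal]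
  refine congrArg (fun g => (tripleOps N).fold g u) (funext fun k => ?_)
  simp [diffTriple, diff, natTriple]

theorem computable_diffVal (hh₁ : Computable₂ h₁) (hh₂ : Computable₂ h₂) :
    Computable₂ fun (p : ℕ × ℕ) (u : ℕ) => diffVal N (h₁ p.1) (h₂ p.1) p.2 u := by
  have hg : Computable₂ fun (p : ℕ × ℕ) (k : ℕ) => genVal N (h₁ p.1) (h₂ p.1) p.2 k := by
    have p := Computable.fst (α := ℕ × ℕ) (β := ℕ)
    have x := Computable.fst.comp p
    have t := Computable.snd.comp p
    have k := Computable.unpair.comp (Computable.snd (α := ℕ × ℕ) (β := ℕ))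
    have c := Computable.fst.comp k
    have q := Computable.snd.comp k
    have z := Computable.const (α := (ℕ × ℕ) × ℕ) 0
    exact (Computable.ite_eq c (z.pair ((Computable.const_pow _
        (Computable.nat_sub' (hh₁.comp x t) (hh₁.comp x q))).pair z)) <|
      Computable.ite_eq c (z.pair ((Computable.nat_mul' (Computable.const_pow _ (hh₁.comp x t))
        ((computable_frozenFactorial hh₂).comp (x.pair (q.pair t)))).pair z)) <|
      Computable.const (0, 0, 1)).to₂
  refine (diffOps_isComputable N).fold ?_
  exact ((Computable.fst.comp hg).pair
    (((Computable.fst.comp (Computable.snd.comp hg)).pair (Computable.const 0)).pair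
      (Computable.snd.comp (Computable.snd.comp hg)))).to₂

/-- The decision procedure for the equality of two names. -/
def decideNames (h₁ h₂ : ℕ → ℕ) (u v : ℕ) : Bool :=
  let w := codeOps.mul u (codeOps.inv v)
  let d := diffVal N h₁ h₂ (decisionStage N w) w
  decide (d.2.1.1 = d.2.1.2) && (!P || decide (d.1 = d.2.2))

theorem computable_decideNames (hh₁ : Computable₂ h₁) (hh₂ : Computable₂ h₂) :
    Computable fun p : ℕ × ℕ × ℕ => decideNames N P (h₁ p.1) (h₂ p.1) p.2.1 p.2.2 := by
  have x := Computable.fst (α := ℕ) (β := ℕ × ℕ)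
  have u := Computable.fst.comp (Computable.snd (α := ℕ) (β := ℕ × ℕ))
  have v := Computable.snd.comp (Computable.snd (α := ℕ) (β := ℕ × ℕ))
  have w := codeOps_isComputable.mul.comp u (codeOps_isComputable.inv.comp v)
  have d := (computable_diffVal N hh₁ hh₂).comp
    (x.pair ((computable_decisionStage N).comp w)) w
  have d2 := Computable.snd.comp d
  have r := Computable.fst.comp d2
  exact Computable.and (Computable.decide_eq (Computable.fst.comp r) (Computable.snd.comp r))
    (Computable.or (Computable.const _)
      (Computable.decide_eq (Computable.fst.comp d) (Computable.snd.comp d2)))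

theorem decideNames_iff {G : Type*} [Group G] {a b : G} (h : NormalForm N (P = true) a b)
    {h₁ h₂ : ℕ → ℕ} (hm₁ : Monotone h₁) (hm₂ : Monotone h₂) (u v : ℕ) :
    decideNames N P h₁ h₂ u v = true ↔ namedElt h.rel h₁ h₂ u = namedElt h.rel h₁ h₂ v := by
  have hom := nameVal_hom h.rel h₁ h₂
  have h1 : nameVal N h₁ h₂ a b u = nameVal N h₁ h₂ a b v ↔
      nameVal N h₁ h₂ a b (codeOps.mul u (codeOps.inv v)) = 1 := by
    rw [hom.mul, hom.inv]
    exact mul_inv_eq_one.symm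
  rw [← Subtype.coe_inj, namedElt, namedElt, h1, nameVal_eq_one_iff h hm₁ hm₂, decideNames]
  generalize codeOps.mul u (codeOps.inv v) = w
  rw [← diffTriple_diffVal]
  generalize diffVal N h₁ h₂ (decisionStage N w) w = d
  simp only [diffTriple, diff_eq_zero_iff, Bool.and_eq_true, Bool.or_eq_true,
    decide_eq_true_eq, Bool.not_eq_true', ← Bool.not_eq_true, imp_iff_not_or]

end Decide

/-! ### Hardness of the index set -/

/-- Bounded first counter and unbounded second counter is membership in `S₁` and not in `S₂`, and it
is also the criterion for the named group to be isomorphic to `G`. -/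
theorem ScottPair.manyOneReducible_indexSet {G : Type} [Group G] {N : ℤ} {P : Bool}
    {Q : ℕ → ℤ → ℤ → Prop} {a b : G} (h : ScottPair G N (P = true) Q a b) {T : Set ℕ}
    (hT : IsDSigma2Set T) : (fun x => x ∈ T) ≤₀ (fun x => x ∈ indexSet G) := by
  obtain ⟨S₁, S₂, hS₁, hS₂, rfl⟩ := hT
  obtain ⟨h₁, hc₁, hm₁, hb₁⟩ := hS₁.exists_counter
  obtain ⟨h₂, hc₂, hm₂, hb₂⟩ := hS₂.exists_counter
  obtain ⟨f, hf, hfG⟩ := exists_computable_mem_indexSet_iff (G := G)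
    (E := fun x => decideNames N P (h₁ x) (h₂ x)) (computable_decideNames N P hc₁ hc₂) (fun x => NamedGroup h.nf.rel (h₁ x) (h₂ x))
    (fun x => namedElt h.nf.rel (h₁ x) (h₂ x)) (fun x => namedElt_surjective _ _ _)
    (fun x => namedElt_hom _ _ _) (fun x => decideNames_iff N P h.nf (hm₁ x) (hm₂ x))
  refine ⟨f, hf, fun x => ?_⟩
  beta_reduce
  rw [hfG, h.nonempty_mulEquiv_namedGroup_iff (hm₁ x) (hm₂ x), ← hb₁, ← hb₂, Set.mem_sdiff]

/-! ### The three families of Baumslag–Solitar groups -/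

section Arithmetic

variable {α : Type*} [Primcodable α]

theorem _root_.Computable.nat_mod' {f g : α → ℕ} (hf : Computable f) (hg : Computable g) :
    Computable fun a => f a % g a := Primrec.nat_mod.to_comp.comp hf hg

/-- Coprimality to a fixed number is decided by a finite table. -/
theorem _root_.Computable.coprime_const (n : ℕ) {f : α → ℕ} (hf : Computable f) :
    Computable fun a => decide ((f a).Coprime n) := by
  have h := (Primrec.list_getD false).to_comp.comp
    (Computable.const ((List.range n).map fun r => decide (r.Coprime n)))
    (Computable.nat_mod' hf (Computable.const n))
  have h' := Computable.ite_true (Computable.decide_eq (Computable.const n) (Computable.const 0))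
    (Computable.decide_eq hf (Computable.const 1)) h
  refine h'.of_eq fun a => ?_
  rcases Nat.eq_zero_or_pos n with rfl | hn
  · simp
  · have hr := Nat.mod_lt (f a) hn
    have : (f a % n).Coprime n ↔ (f a).Coprime n := by
      rw [Nat.Coprime, Nat.Coprime, ← Nat.gcd_rec, Nat.gcd_comm]
    simp [hn.ne', hr, this]

end Arithmetic

/-- This includes `p = 0`: remainders modulo `0` are the numbers themselves, and `0` divides only
`0`. -/
theorem dvd_sub_iff_mod_eq (p k₁ k₂ : ℕ) : (p : ℤ) ∣ (k₁ : ℤ) - k₂ ↔ k₁ % p = k₂ % p := by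
  rw [← Int.modEq_iff_dvd, Int.natCast_modEq_iff]
  exact eq_comm

/-- Decision procedures for the forbidden equations, on differences of natural numbers. -/
def decideGeneral (n : ℤ) (i : ℕ × ℕ × ℕ × ℕ × ℕ) : Bool :=
  !decide (i.2.2.2.1 % i.1 = i.2.2.2.2 % i.1) ||
    (decide (i.2.2.2.1 = i.2.2.2.2) && (!decide (i.2.1 % i.1 = i.2.2.1 % i.1) &&
      (decide (i.1 = 0) || decide (i.1.Coprime n.natAbs))))

def decidePlane (i : ℕ × ℕ × ℕ × ℕ × ℕ) : Bool :=
  !(decide (i.2.1 % i.1 = i.2.2.1 % i.1) && decide (i.2.2.2.1 % i.1 = i.2.2.2.2 % i.1))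

def decideLine (i : ℕ × ℕ × ℕ × ℕ × ℕ) : Bool :=
  decide (i.2.2.2.1 = i.2.2.2.2) && !decide (i.2.1 % i.1 = i.2.2.1 % i.1)

theorem decideGeneral_iff (n : ℤ) (p k₁ k₂ l₁ l₂ : ℕ) :
    decideGeneral n (p, k₁, k₂, l₁, l₂) = true ↔ rootsGeneral n p (k₁ - k₂) (l₁ - l₂) := by
  simp [decideGeneral, rootsGeneral, dvd_sub_iff_mod_eq, sub_eq_zero]

theorem decidePlane_iff (p k₁ k₂ l₁ l₂ : ℕ) :
    decidePlane (p, k₁, k₂, l₁, l₂) = true ↔ rootsPlane p (k₁ - k₂) (l₁ - l₂) := by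
  simp [decidePlane, rootsPlane, dvd_sub_iff_mod_eq, imp_iff_not_or]

theorem decideLine_iff (p k₁ k₂ l₁ l₂ : ℕ) :
    decideLine (p, k₁, k₂, l₁, l₂) = true ↔ rootsLine p (k₁ - k₂) (l₁ - l₂) := by
  simp [decideLine, rootsLine, dvd_sub_iff_mod_eq, sub_eq_zero]

theorem computable_decide_roots (n : ℤ) :
    Computable (decideGeneral n) ∧ Computable decidePlane ∧ Computable decideLine := by
  have p := Computable.fst (α := ℕ) (β := ℕ × ℕ × ℕ × ℕ)
  have i2 := Computable.snd (α := ℕ) (β := ℕ × ℕ × ℕ × ℕ)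
  have k₁ := Computable.fst.comp i2
  have i3 := Computable.snd.comp i2
  have k₂ := Computable.fst.comp i3
  have i4 := Computable.snd.comp i3
  have l₁ := Computable.fst.comp i4
  have l₂ := Computable.snd.comp i4
  have hk := Computable.decide_eq (Computable.nat_mod' k₁ p) (Computable.nat_mod' k₂ p)
  have hl := Computable.decide_eq (Computable.nat_mod' l₁ p) (Computable.nat_mod' l₂ p)
  have h0 := Computable.decide_eq l₁ l₂
  exact ⟨Computable.or (Computable.not hl) (Computable.and h0 (Computable.and (Computable.not hk)
      (Computable.or (Computable.decide_eq p (Computable.const 0))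
        (Computable.coprime_const n.natAbs p)))),
    Computable.not (Computable.and hk hl), Computable.and h0 (Computable.not hk)⟩

/-- A group with a Scott pair whose forbidden equations are decidable has a computable d-`Σ₂` Scott
sentence, and its index set is m-complete d-`Σ₂`. -/
theorem ScottPair.exists_scottSentence_and_isMCompleteDSigma2 {G : Type} [Group G] {N : ℤ} {P : Bool} {Q : ℕ → ℤ → ℤ → Prop} {a b : G}
    (h : ScottPair G N (P = true) Q a b) (hN : P ≠ true → N = 1)
    {q : ℕ × ℕ × ℕ × ℕ × ℕ → Bool} (hq : Computable q)
    (hqQ : ∀ p k₁ k₂ l₁ l₂ : ℕ, q (p, k₁, k₂, l₁, l₂) = true ↔ Q p (k₁ - k₂) (l₁ - l₂)) :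
    (∃ φ : InfFormula 0, φ.IsDSigma 2 ∧ φ.IsComputable ∧ IsScottSentence φ G) ∧
      IsMCompleteDSigma2 (indexSet G) := by
  let s : BasisSpec := ⟨N, P, q⟩
  have hQ : ∀ p k l, s.Q p k l ↔ Q p k l := by
    intro p k l
    have := hqQ p k.toNat (-k).toNat l.toNat (-l).toNat
    rwa [Int.toNat_sub_toNat_neg, Int.toNat_sub_toNat_neg] at this
  have hs : s.Coherent :=
    ⟨fun p k₁ k₂ l₁ l₂ hi => (hQ _ _ _).2 ((hqQ p k₁ k₂ l₁ l₂).1 hi), hN⟩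
  obtain rfl : Q = s.Q := by
    funext p k l
    exact propext (hQ p k l).symm
  exact ⟨ScottPair.exists_scottSentence hs hq h, ScottPair.isDSigma2Set_indexSet hs hq h,
    fun T hT => h.manyOneReducible_indexSet hT⟩

end ScottBS

theorem mainTheorem7 (n : ℤ) :
    (∃ φ : ScottBS.InfFormula 0, φ.IsDSigma 2 ∧ φ.IsComputable ∧
      ScottBS.IsScottSentence φ (ScottBS.BaumslagSolitar 1 n)) ∧
    ScottBS.IsMCompleteDSigma2 (ScottBS.indexSet (ScottBS.BaumslagSolitar 1 n)) := by
  obtain ⟨hg, hp, hl⟩ := ScottBS.computable_decide_roots n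
  by_cases h0 : n = 0
  · subst h0
    have h := ScottBS.scottPair_line
    -- The axiomatisation stores `P` as a Boolean, so `False` is rewritten as `false = true`; the
    -- other cases rewrite `True` likewise.
    rw [← Bool.false_eq_true] at h
    exact h.exists_scottSentence_and_isMCompleteDSigma2 (fun _ => rfl) hl ScottBS.decideLine_iff
  by_cases h1 : n = 1
  · subst h1
    have h := ScottBS.scottPair_plane
    rw [← eq_self (true)] at h
    exact h.exists_scottSentence_and_isMCompleteDSigma2 (absurd rfl) hp ScottBS.decidePlane_iff
  · have h := ScottBS.scottPair_general h0 h1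
    rw [← eq_self (true)] at h
    exact h.exists_scottSentence_and_isMCompleteDSigma2 (absurd rfl) hg (ScottBS.decideGeneral_iff n)
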